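/- **Setting.** Let $M$ be a smooth ($C^\infty$, Hausdorff, $\sigma$-compact) manifold of dimension $N\ge 3$. A *Finsler space* $\mathcal F^N=(M,F)$ consists of an open set $\mathcal D\subset TM\setminus 0$ of admissible tangent vectors, which meets every $T_xM$ and satisfies $(x,ky)\in\mathcal D$ for $(x,y)\in\mathcal D$, $k>0$ (the choice $\mathcal D=TM\setminus0$ is allowed), and a smooth function $F:\mathcal D\to(0,\infty)$ with $F(x,ky)=kF(x,y)$ for $k>0$, such that the metric tensor $g_{mn}(x,y)=\tfrac12\,\partial^2F^2/\partial y^m\partial y^n$ is positive definite on $\mathcal D$. The indicatrix at $x$ is $\{y\in T_xM:(x,y)\in\mathcal D,\ F(x,y)=1\}$, with the Riemannian metric induced by $g(x,\cdot)$. We say that *the indicatrix is a space of constant curvature* $K=K(x)$ if for every $x\in M$ the indicatrix at $x$ has constant curvature $K(x)$, where $K(x)$ may depend on $x$. Let $S$ be a smooth Riemannian metric on $M$, with $S_x$ the inner product on $T_xM$, and let $H:M\to(0,\infty)$ be a function. A *conformal automorphism* of degree $H$ with multiplier $q$ on an open conic set $W\subset\mathcal D$ is an injective map $(x,y)\mapsto(x,\bar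 y(x,y))$, $W\to TM$, smooth in $(x,y)$, together with a function $q:W\to(0,\infty)$, such that - $\bar y(x,ky)=k^{H(x)}\,\bar y(x,y)$ for $k>0$; - $F(x,y)=1$ implies $S_x(\bar y,\bar y)=1$ (unit vectors are sent to unit vectors); - $g(x,y)(\xi,\eta)=q(x,y)\,S_x(\bar y'\xi,\bar y'\eta)$ for all $\xi,\eta\in T_xM$, where $\bar y'$ is the differential of $\bar y(x,\cdot)$ at $y$. $\mathcal F^N$ is *conformally automorphic to the Riemannian space $(M,S)$ with degree $H$* if every point of $\mathcal D$ lies in such an open conic set $W$ on which there is a conformal automorphism of degree $H$ (the notion is local in the base manifold and in the tangent spaces). **Proposition 2.1.** A Finsler space $\mathcal F^N$, $N\ge3$, is conformally automorphic to some Riemannian space $(M,S)$, with some degree $H>0$, if and only if its indicatrix is a space of constant positive curvature $K=K(x)>0$. If $\mathcal F^N$ is conformally automorphic to $(M,S)$ with degree $H$, then the indicatrix is a space of constant curvature, its curvature is $H(x)^2$ (and no other value) for every $x\in M$, and every conformal automorphism of degree $H$ to $(M,S)$ has the multiplier $q=p^2$ with $$p=\frac1H\,F^{1-H}.$$ -/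

import Mathlib

open scoped Manifold ContDiff

noncomputable section

namespace FinslerConformal

/-! ### Curvature of a Riemannian metric given in coordinates

A metric on (an open part of) `ℝⁿ` is a matrix-valued function `γ`, with `γ u i j = γ_{ij}(u)`. -/

/-- The partial derivative `∂f/∂uⁱ` at the point `u`. -/
def partialDeriv {n : ℕ} (i : Fin n) (f : EuclideanSpace ℝ (Fin n) → ℝ)
    (u : EuclideanSpace ℝ (Fin n)) : ℝ :=
  fderiv ℝ f u (EuclideanSpace.single i 1)

/-- The Christoffel symbol of the second kind
`Γᵏ_{ij} = ½ ∑ₗ γᵏˡ (∂ᵢ γ_{jl} + ∂ⱼ γ_{il} - ∂ₗ γ_{ij})`. -/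
def christoffel {n : ℕ} (γ : EuclideanSpace ℝ (Fin n) → Matrix (Fin n) (Fin n) ℝ)
    (k i j : Fin n) (u : EuclideanSpace ℝ (Fin n)) : ℝ :=
  (1 / 2 : ℝ) * ∑ l, (γ u)⁻¹ k l *
    (partialDeriv i (fun w => γ w j l) u + partialDeriv j (fun w => γ w i l) u
      - partialDeriv l (fun w => γ w i j) u)

/-- The component `Rˡ_{kij}` of the Riemann curvature tensor, that is, the `l`-th component
of `R(∂ᵢ, ∂ⱼ) ∂ₖ = ∇ᵢ ∇ⱼ ∂ₖ - ∇ⱼ ∇ᵢ ∂ₖ`. -/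
def riemannTensor {n : ℕ} (γ : EuclideanSpace ℝ (Fin n) → Matrix (Fin n) (Fin n) ℝ)
    (l k i j : Fin n) (u : EuclideanSpace ℝ (Fin n)) : ℝ :=
  partialDeriv i (christoffel γ l j k) u - partialDeriv j (christoffel γ l i k) u
    + ∑ m, (christoffel γ l i m u * christoffel γ m j k u
      - christoffel γ l j m u * christoffel γ m i k u)

/-- The metric `γ` has constant curvature `K` on the set `V`:
`R(X, Y) Z = K (⟨Y, Z⟩ X - ⟨X, Z⟩ Y)` at all points of `V`. -/
def HasConstantCurvatureOn {n : ℕ}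
    (γ : EuclideanSpace ℝ (Fin n) → Matrix (Fin n) (Fin n) ℝ)
    (V : Set (EuclideanSpace ℝ (Fin n))) (K : ℝ) : Prop :=
  ∀ u ∈ V, ∀ l k i j : Fin n,
    riemannTensor γ l k i j u =
      K * (γ u j k * (if l = i then 1 else 0) - γ u i k * (if l = j then 1 else 0))

/-! ### Finsler spaces -/

/-- The second-order derivative tensor `½ ∂²f² / ∂yᵐ∂yⁿ` of a function `f` on `ℝᴺ`, evaluated at
the point `y` on the vectors `ξ, η`. -/
def halfHessianSq {N : ℕ} (f : EuclideanSpace ℝ (Fin N) → ℝ)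
    (y ξ η : EuclideanSpace ℝ (Fin N)) : ℝ :=
  (1 / 2 : ℝ) * fderiv ℝ (fun z => fderiv ℝ (fun w => f w ^ 2) z ξ) y η

/-- A Finsler space over the `N`-dimensional smooth manifold `M`. The Finsler metric function
`F` lives on an open conic part `domain` of the slit tangent bundle which meets every tangent space;
it is smooth, positive, positively homogeneous of degree one, and its fundamental tensor
`g = ½ ∂²F² / ∂y∂y` is positive definite. The choice `domain = {v | v.2 ≠ 0}` is allowed.

Recall that `TangentSpace (𝓡 N) x` is by definition a copy of `EuclideanSpace ℝ (Fin N)`; calculus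
in the fixed tangent space at `x` is done in that copy. -/
structure FinslerSpace (N : ℕ) (M : Type*) [TopologicalSpace M]
    [ChartedSpace (EuclideanSpace ℝ (Fin N)) M] [IsManifold (𝓡 N) ∞ M] where
  /-- The set of admissible tangent vectors. -/
  domain : Set (TangentBundle (𝓡 N) M)
  /-- The Finsler metric function. -/
  F : TangentBundle (𝓡 N) M → ℝ
  isOpen_domain : IsOpen domain
  ne_zero : ∀ v ∈ domain, v.2 ≠ 0
  conic : ∀ v ∈ domain, ∀ k : ℝ, 0 < k → (⟨v.1, k • v.2⟩ : TangentBundle (𝓡 N) M) ∈ domain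
  fiber_nonempty : ∀ x : M, ∃ y : TangentSpace (𝓡 N) x,
    (⟨x, y⟩ : TangentBundle (𝓡 N) M) ∈ domain
  smooth : ContMDiffOn (𝓡 N).tangent 𝓘(ℝ, ℝ) ∞ F domain
  pos : ∀ v ∈ domain, 0 < F v
  homogeneous : ∀ v ∈ domain, ∀ k : ℝ, 0 < k → F ⟨v.1, k • v.2⟩ = k * F v
  posDef : ∀ v ∈ domain, ∀ ξ : EuclideanSpace ℝ (Fin N), ξ ≠ 0 →
    0 < halfHessianSq (fun w => F ⟨v.1, w⟩) v.2 ξ ξ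

variable {N : ℕ} {M : Type*} [TopologicalSpace M]
  [ChartedSpace (EuclideanSpace ℝ (Fin N)) M] [IsManifold (𝓡 N) ∞ M]

/-- The Finslerian metric tensor `g_{mn}(x, y) = ½ ∂²F² / ∂yᵐ∂yⁿ`, where `v = (x, y)`. -/
def FinslerSpace.metricTensor (Φ : FinslerSpace N M) (v : TangentBundle (𝓡 N) M)
    (ξ η : EuclideanSpace ℝ (Fin N)) : ℝ :=
  halfHessianSq (fun w => Φ.F ⟨v.1, w⟩) v.2 ξ η

/-- The indicatrix `{y ∈ T_x M | F(x, y) = 1}`. -/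
def FinslerSpace.indicatrix (Φ : FinslerSpace N M) (x : M) : Set (EuclideanSpace ℝ (Fin N)) :=
  {y | (⟨x, y⟩ : TangentBundle (𝓡 N) M) ∈ Φ.domain ∧ Φ.F ⟨x, y⟩ = 1}

/-- A local parametrization of the indicatrix at `x`: a smooth immersion `φ` of an open set `V` of
`ℝᴺ⁻¹` into `T_x M` with values in the indicatrix. -/
structure FinslerSpace.IsIndicatrixParam (Φ : FinslerSpace N M) (x : M)
    (V : Set (EuclideanSpace ℝ (Fin (N - 1))))
    (φ : EuclideanSpace ℝ (Fin (N - 1)) → EuclideanSpace ℝ (Fin N)) : Prop where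
  isOpen : IsOpen V
  smooth : ContDiffOn ℝ ∞ φ V
  mapsTo : Set.MapsTo φ V (Φ.indicatrix x)
  immersion : ∀ u ∈ V, Function.Injective (fderiv ℝ φ u)

/-- The metric induced on the indicatrix at `x` by the Finslerian metric tensor, in the local
parameters given by `φ`: `γ_{ij}(u) = g(x, φ(u)) (∂ᵢφ, ∂ⱼφ)`. -/
def FinslerSpace.inducedMetric (Φ : FinslerSpace N M) (x : M)
    (φ : EuclideanSpace ℝ (Fin (N - 1)) → EuclideanSpace ℝ (Fin N))
    (u : EuclideanSpace ℝ (Fin (N - 1))) : Matrix (Fin (N - 1)) (Fin (N - 1)) ℝ :=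
  Matrix.of fun i j => Φ.metricTensor ⟨x, φ u⟩
    (fderiv ℝ φ u (EuclideanSpace.single i 1)) (fderiv ℝ φ u (EuclideanSpace.single j 1))

/-- For every `x`, the indicatrix at `x`, with the Riemannian metric induced by the Finslerian
metric tensor, is a space of constant curvature `K x`. -/
def FinslerSpace.IndicatrixHasConstantCurvature (Φ : FinslerSpace N M) (K : M → ℝ) : Prop :=
  ∀ (x : M) (V : Set (EuclideanSpace ℝ (Fin (N - 1))))
    (φ : EuclideanSpace ℝ (Fin (N - 1)) → EuclideanSpace ℝ (Fin N)),
    Φ.IsIndicatrixParam x V φ → HasConstantCurvatureOn (Φ.inducedMetric x φ) V (K x)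

/-! ### Conformal automorphisms -/


/-- Smooth Riemannian metrics on the manifold `M`. -/
abbrev RiemMetric (N : ℕ) (M : Type*) [TopologicalSpace M]
    [ChartedSpace (EuclideanSpace ℝ (Fin N)) M] [IsManifold (𝓡 N) ∞ M] :=
  Bundle.ContMDiffRiemannianMetric (𝓡 N) ∞ (EuclideanSpace ℝ (Fin N))
    (fun x : M => TangentSpace (𝓡 N) x)

/-- The map `(x, y) ↦ (x, C(x, y))` of the tangent bundle over the identity of `M` determined by a
family `C` of (in general non-linear) maps of the tangent spaces. -/
def totalMap (C : (x : M) → TangentSpace (𝓡 N) x → TangentSpace (𝓡 N) x)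
    (v : TangentBundle (𝓡 N) M) : TangentBundle (𝓡 N) M :=
  ⟨v.1, C v.1 v.2⟩

/-- The differential at `y` of the map `C x` of the tangent space at `x`. -/
def tangentDeriv (C : (x : M) → TangentSpace (𝓡 N) x → TangentSpace (𝓡 N) x)
    (v : TangentBundle (𝓡 N) M) :
    EuclideanSpace ℝ (Fin N) →L[ℝ] EuclideanSpace ℝ (Fin N) :=
  fderiv ℝ (fun w : EuclideanSpace ℝ (Fin N) => (C v.1 w : EuclideanSpace ℝ (Fin N))) v.2

/-- `ȳ = C(x, y)`, defined on the open conic set `W` of tangent vectors, is a conformal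
automorphism between the Finsler space and the Riemannian space `(M, S)`, of degree `H x` and with
conformal multiplier `q`: it is smooth and invertible, it keeps the base points, it is positively
homogeneous of degree `H x` in `y`, it carries Finslerian unit vectors to Riemannian unit vectors,
and `g(x, y) (ξ, η) = q(x, y) S_x(C'ξ, C'η)`, where `C'` is the differential of `C(x, ·)` at `y`. -/
structure IsConformalAutomorphismOn (Φ : FinslerSpace N M) (S : RiemMetric N M)
    (H : M → ℝ) (W : Set (TangentBundle (𝓡 N) M))
    (C : (x : M) → TangentSpace (𝓡 N) x → TangentSpace (𝓡 N) x)
    (q : TangentBundle (𝓡 N) M → ℝ) : Prop where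
  isOpen : IsOpen W
  subset : W ⊆ Φ.domain
  conic : ∀ v ∈ W, ∀ k : ℝ, 0 < k → (⟨v.1, k • v.2⟩ : TangentBundle (𝓡 N) M) ∈ W
  smooth : ContMDiffOn (𝓡 N).tangent (𝓡 N).tangent ∞ (totalMap C) W
  injective : Set.InjOn (totalMap C) W
  homogeneous : ∀ v ∈ W, ∀ k : ℝ, 0 < k → C v.1 (k • v.2) = (k ^ H v.1) • C v.1 v.2
  unit : ∀ v ∈ W, Φ.F v = 1 → S.inner v.1 (C v.1 v.2) (C v.1 v.2) = 1
  multiplier_pos : ∀ v ∈ W, 0 < q v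
  conformal : ∀ v ∈ W, ∀ ξ η : EuclideanSpace ℝ (Fin N),
    Φ.metricTensor v ξ η = q v * S.inner v.1 (tangentDeriv C v ξ) (tangentDeriv C v η)

/-- The Finsler space is conformally automorphic to the Riemannian space `(M, S)`, with degree
`H > 0`. The notion is local in the base manifold and in the tangent spaces. -/
def IsConformallyAutomorphic (Φ : FinslerSpace N M) (S : RiemMetric N M) (H : M → ℝ) : Prop :=
  (∀ x, 0 < H x) ∧ ∀ v ∈ Φ.domain, ∃ W C q, v ∈ W ∧ IsConformalAutomorphismOn Φ S H W C q

end FinslerConformal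

end

open scoped Manifold ContDiff

noncomputable section

namespace FinslerConformal

open Set Filter Topology

/-! The statement is about single tangent spaces, except that the conformal map must also depend
smoothly on the base point.

From a conformal map to curvature: Euler's relation for degree `H` gives `c'(y) y = H c(y)`, and
`g(y, y) = F²`. The unit condition and homogeneity give `|c(y)|² = F^(2H)`. Putting `ξ = η = y` in
the conformality relation then forces `q = (F^(1-H) / H)²` (`IsConicNorm.multiplier_eq`). On the
indicatrix `q = H⁻²`, so `c` carries the indicatrix into the unit sphere of `S_x` and multiplies its
metric by `H²`. Hence the indicatrix is locally a sphere of radius `1/H`, and its curvature is `H²`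
(`hasConstantCurvatureOn_of_unit`). Since the indicatrix has dimension at least two, one component
of the curvature tensor determines the constant (`HasUnitCurvature.unique`).

From curvature to a conformal map: any Riemannian metric `S` will do, with `H = √K`; one exists by a
partition of unity (`nonempty_riemMetric`). A metric `γ` of curvature `K > 0` is realized on a
sphere by solving Gauss' equations `∂ᵢ∂ⱼψ = Γᵏᵢⱼ ∂ₖψ - K γᵢⱼ ψ`. This linear system is a connection
on the trivial bundle of rank `N`, which is flat exactly when `γ` has constant curvature `K`
(`gaussConnection_flat_iff`). A parallel frame (`exists_parallel_frame`) preserves the form `ds² +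
Kγ` (`gaussFormAt_parallel`). Its position-vector column, followed by a linear isometry onto `(T_xM,
S_x)`, maps the indicatrix into the unit sphere (`exists_sphere_map`). The extension `F^H ψ` along
rays is conformal (`halfHessianSq_eq_of_sphere_map`).

Dependence on the base point is handled by carrying a parameter through the whole construction
(`exists_conformal_family`). The parallel frame solves a linear Volterra equation in the Banach
algebra of curves on the unit interval, so it is obtained by inverting an operator that depends
smoothly on the parameter. The function `K` is not assumed to be smooth; it is smooth because it is
a quotient of a curvature component by a metric component. -/

/-! ### Smooth families of continuous functions on the unit interval -/

section Curry

variable {Q F : Type*} [NormedAddCommGroup Q] [NormedSpace ℝ Q]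
  [NormedAddCommGroup F] [NormedSpace ℝ F]

/-- The curve `t ↦ f (q, t)` on the unit interval. -/
def curryUnit (f : Q × ℝ → F) (hf : Continuous f) (q : Q) : C(unitInterval, F) :=
  ⟨fun t => f (q, t), by fun_prop⟩

omit [NormedSpace ℝ Q] [NormedSpace ℝ F] in
theorem continuous_curryUnit (f : Q × ℝ → F) (hf : Continuous f) :
    Continuous (curryUnit f hf) := by
  have h : Continuous fun x : Q × unitInterval => f (x.1, (x.2 : ℝ)) := by fun_prop
  exact (ContinuousMap.curry ⟨_, h⟩).continuous

/-- The derivative of `q ↦ f (q, ·)`. -/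
def curryUnitDeriv [FiniteDimensional ℝ Q] (f : Q × ℝ → F) (hf : ContDiff ℝ ∞ f) (q : Q) :
    Q →L[ℝ] C(unitInterval, F) :=
  LinearMap.toContinuousLinearMap
    { toFun := fun y => ⟨fun t => fderiv ℝ f (q, (t : ℝ)) (y, 0), by
        have := hf.continuous_fderiv (by simp)
        fun_prop⟩
      map_add' := fun y z => by
        ext t
        have : ((y + z, 0) : Q × ℝ) = (y, 0) + (z, 0) := by
          rw [Prod.mk_add_mk, add_zero]
        exact (congrArg (fderiv ℝ f (q, (t : ℝ))) this).trans (map_add _ _ _)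
      map_smul' := fun c y => by
        ext t
        have : ((c • y, 0) : Q × ℝ) = c • (y, 0) := by rw [Prod.smul_mk, smul_zero]
        exact (congrArg (fderiv ℝ f (q, (t : ℝ))) this).trans (map_smul _ _ _) }

theorem curryUnitDeriv_apply [FiniteDimensional ℝ Q] (f : Q × ℝ → F) (hf : ContDiff ℝ ∞ f)
    (q y : Q) (t : unitInterval) :
    curryUnitDeriv f hf q y t = fderiv ℝ f (q, (t : ℝ)) (y, 0) := rfl

/-- The remainder must be small uniformly in `t`. The partial derivative `D` in the first variable,
curried as well, is continuous for the sup norm. On a small ball it is therefore `ε`-close to its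
value at `q` for all `t` at once, and the mean value inequality applies for each `t`. -/
theorem hasFDerivAt_curryUnit [FiniteDimensional ℝ Q] (f : Q × ℝ → F) (hf : ContDiff ℝ ∞ f)
    (q : Q) : HasFDerivAt (curryUnit f hf.continuous) (curryUnitDeriv f hf q) q := by
  have hdf := hf.continuous_fderiv (by simp)
  let D : Q × ℝ → (Q →L[ℝ] F) := fun x => (fderiv ℝ f x).comp (ContinuousLinearMap.inl ℝ Q ℝ)
  have hD : Continuous D := by fun_prop
  have hcD := continuous_curryUnit D hD
  rw [hasFDerivAt_iff_isLittleO_nhds_zero, Asymptotics.isLittleO_iff]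
  intro ε hε
  obtain ⟨δ, hδ, hball⟩ := Metric.continuousAt_iff.1 (hcD.continuousAt (x := q)) ε hε
  filter_upwards [Metric.ball_mem_nhds (0 : Q) hδ] with y hy
  rw [ContinuousMap.norm_le _ (by positivity)]
  intro t
  have key := (convex_ball q δ).norm_image_sub_le_of_norm_hasFDerivWithin_le' (𝕜 := ℝ)
    (f := fun q' => f (q', (t : ℝ))) (f' := fun q' => D (q', (t : ℝ))) (φ := D (q, (t : ℝ)))
    (C := ε) (x := q) (y := q + y) ?_ ?_ (Metric.mem_ball_self hδ) (by simpa using hy)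
  · simpa [curryUnit, curryUnitDeriv_apply, D] using key
  · intro q' _
    have h1 : HasFDerivAt f (fderiv ℝ f (q', (t : ℝ))) (q', (t : ℝ)) :=
      (hf.differentiable (by simp) _).hasFDerivAt
    have h2 : HasFDerivAt (fun q' : Q => (q', (t : ℝ))) (ContinuousLinearMap.inl ℝ Q ℝ) q' :=
      hasFDerivAt_prodMk_left q' (t : ℝ)
    exact (h1.comp q' h2).hasFDerivWithinAt
  · intro q' hq'
    have := (ContinuousMap.dist_apply_le_dist (f := curryUnit D hD q') (g := curryUnit D hD q) t)
    rw [dist_eq_norm] at this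
    exact this.trans (hball hq').le

/-- The induction closes because each directional derivative is again a curried smooth function,
namely that of `fderiv ℝ f x (y, 0)`. -/
theorem contDiff_curryUnit [FiniteDimensional ℝ Q] (f : Q × ℝ → F) (hf : ContDiff ℝ ∞ f) :
    ContDiff ℝ ∞ (curryUnit f hf.continuous) := by
  rw [contDiff_infty]
  intro n
  induction n generalizing f with
  | zero => exact contDiff_zero.2 (continuous_curryUnit f hf.continuous)
  | succ n ih =>
    have h := hasFDerivAt_curryUnit f hf
    rw [Nat.cast_succ, contDiff_succ_iff_fderiv_apply]
    refine ⟨fun q => (h q).differentiableAt, by simp, fun y => ?_⟩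
    have hg : ContDiff ℝ ∞ fun x : Q × ℝ => fderiv ℝ f x (y, 0) :=
      (hf.fderiv_right (by simp)).clm_apply contDiff_const
    convert ih _ hg using 2 with q
    rw [(h q).fderiv]
    rfl

end Curry

/-! ### Integration of curves -/

section Primitive

variable {F : Type*} [NormedAddCommGroup F] [NormedSpace ℝ F]

/-- The primitive vanishing at `0` of a curve on the unit interval. -/
def primitiveUnit : C(unitInterval, F) →L[ℝ] C(unitInterval, F) :=
  LinearMap.mkContinuous
    { toFun := fun g => ⟨fun t => ∫ s in (0 : ℝ)..t, IccExtend zero_le_one g s, by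
        have hc : Continuous (IccExtend (zero_le_one (α := ℝ)) g) := g.continuous.Icc_extend'
        exact (intervalIntegral.continuous_primitive
          (fun a b => hc.intervalIntegrable a b) 0).comp continuous_subtype_val⟩
      map_add' := fun g k => by
        ext t
        have hg : Continuous (IccExtend (zero_le_one (α := ℝ)) g) := g.continuous.Icc_extend'
        have hk : Continuous (IccExtend (zero_le_one (α := ℝ)) k) := k.continuous.Icc_extend'
        exact intervalIntegral.integral_add (hg.intervalIntegrable 0 t)
          (hk.intervalIntegrable 0 t)
      map_smul' := fun c g => by
        ext t
        exact intervalIntegral.integral_smul c _ }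
    1 (by
      intro g
      rw [ContinuousMap.norm_le _ (by positivity)]
      intro t
      have h := intervalIntegral.norm_integral_le_of_norm_le_const (a := 0) (b := t) (C := ‖g‖)
        (f := IccExtend (zero_le_one (α := ℝ)) g) (fun x _ => g.norm_coe_le_norm _)
      refine h.trans ?_
      rw [sub_zero, abs_of_nonneg t.2.1, one_mul]
      exact mul_le_of_le_one_right (norm_nonneg _) t.2.2)

/-- The extension of `g` by constants beyond the endpoints is continuous on `ℝ`, so the derivative
is two-sided even at `0` and `1`. -/
theorem hasDerivAt_integral_IccExtend [CompleteSpace F] (g : C(unitInterval, F)) (t : ℝ) :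
    HasDerivAt (fun t => ∫ s in (0 : ℝ)..t, IccExtend zero_le_one g s)
      (IccExtend zero_le_one g t) t := by
  have hg : Continuous (IccExtend (zero_le_one (α := ℝ)) g) := g.continuous.Icc_extend'
  exact intervalIntegral.integral_hasDerivAt_right (hg.intervalIntegrable _ _)
    hg.aestronglyMeasurable.stronglyMeasurableAtFilter hg.continuousAt

end Primitive

/-- Multiplication by a bump function supported in `O` makes a germ global. This lets the
construction of parallel frames work with connection forms defined everywhere. -/
theorem exists_contDiff_eventuallyEq {E F : Type*} [NormedAddCommGroup E] [NormedSpace ℝ E]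
    [FiniteDimensional ℝ E] [NormedAddCommGroup F] [NormedSpace ℝ F] {f : E → F} {O : Set E}
    (hO : IsOpen O) (hf : ContDiffOn ℝ ∞ f O) {x : E} (hx : x ∈ O) :
    ∃ g : E → F, ContDiff ℝ ∞ g ∧ g =ᶠ[𝓝 x] f := by
  obtain ⟨r, hr, hrO⟩ := Metric.isOpen_iff.1 hO x hx
  let χ : ContDiffBump x := ⟨r / 3, r / 2, by positivity, by linarith⟩
  refine ⟨fun y => χ y • f y, ?_, ?_⟩
  · rw [contDiff_iff_contDiffAt]
    intro y
    by_cases hy : y ∈ O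
    · exact χ.contDiff.contDiffAt.smul (hf.contDiffAt (hO.mem_nhds hy))
    · have : y ∈ (tsupport χ)ᶜ := by
        rw [χ.tsupport_eq]
        intro hmem
        exact hy (hrO (Metric.closedBall_subset_ball (by change r / 2 < r; linarith) hmem))
      have h0 : (fun y => χ y • f y) =ᶠ[𝓝 y] fun _ => 0 := by
        filter_upwards [(isClosed_tsupport χ).isOpen_compl.mem_nhds this] with z hz
        simp [image_eq_zero_of_notMem_tsupport hz]
      exact contDiffAt_const.congr_of_eventuallyEq h0
  · filter_upwards [χ.eventuallyEq_one] with y hy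
    simp [hy]

/-! ### Parallel frames of a flat connection depending on parameters -/

section Frobenius

variable {P U 𝔸 : Type*} [NormedAddCommGroup P] [NormedSpace ℝ P] [FiniteDimensional ℝ P]
  [NormedAddCommGroup U] [NormedSpace ℝ U] [FiniteDimensional ℝ U]
  [NormedRing 𝔸] [NormedAlgebra ℝ 𝔸] [CompleteSpace 𝔸]

/-- The curvature of the connection form `A`. -/
def connectionCurvature (A : U → U →L[ℝ] 𝔸) (u v w : U) : 𝔸 :=
  fderiv ℝ A u v w - fderiv ℝ A u w v + A u v * A u w - A u w * A u v

-- The equation reads `(1 - V q) ζ = 1` with a bounded operator `V q` depending smoothly on `q`.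
-- Inversion in the Banach algebra of operators is smooth on the open set of units. That set
-- contains every `q` with `β q = 0`, where `V q = 0`.
omit [FiniteDimensional ℝ P] [CompleteSpace 𝔸] in
theorem exists_contDiffOn_volterra {C : Type*} [NormedRing C] [NormedAlgebra ℝ C]
    [CompleteSpace C] (J : C →L[ℝ] C) {β : P → C} (hβ : ContDiff ℝ ∞ β) :
    ∃ (ζ : P → C) (Ω : Set P), IsOpen Ω ∧ (∀ q, β q = 0 → q ∈ Ω) ∧ ContDiffOn ℝ ∞ ζ Ω ∧
      ∀ q ∈ Ω, ζ q = 1 + J (ζ q * β q) := by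
  let V : P → C →L[ℝ] C := fun q => J.comp ((ContinuousLinearMap.mul ℝ C).flip (β q))
  have hV : ContDiff ℝ ∞ V := by fun_prop
  refine ⟨fun q => Ring.inverse (1 - V q) 1, {q | IsUnit (1 - V q)},
    Units.isOpen.preimage (continuous_const.sub hV.continuous), fun q hq => by simp [V, hq],
    ?_, ?_⟩
  · intro q hq
    obtain ⟨x, hx⟩ := hq
    have h1 : ContDiffAt ℝ ∞ Ring.inverse (1 - V q) := hx ▸ contDiffAt_ringInverse ℝ x
    have h2 : ContDiffAt ℝ ∞ (fun q => 1 - V q) q := (contDiff_const.sub hV).contDiffAt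
    exact ((h1.comp q h2).clm_apply contDiffAt_const).contDiffWithinAt
  · intro q hq
    have h1 : (1 - V q) * Ring.inverse (1 - V q) = 1 := Ring.mul_inverse_cancel _ hq
    have h2 : Ring.inverse (1 - V q) 1 - V q (Ring.inverse (1 - V q) 1) = 1 := by
      simpa using congrArg (fun L => L (1 : C)) h1
    exact (eq_add_of_sub_eq h2).trans rfl

/-- Here `x`, `y` stand for `a(w)`, `a(u)`, and `X`, `Y` for `∂_w a(u)`, `∂_u a(w)`. Flatness turns
the derivative of `R - t z x` into that same expression times `y`. -/
theorem variation_algebra_identity {𝔸 : Type*} [Ring 𝔸] [Algebra ℝ 𝔸] (t : ℝ) (z R x y X Y : 𝔸)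
    (h : X - Y + x * y - y * x = 0) :
    z * (t • X + x) + R * y - (t • (z * y * x + z * Y) + (1 : ℝ) • (z * x)) =
      (R - t • (z * x)) * y := by
  have h' : z * X = z * Y - z * x * y + z * y * x := by
    have h1 := congrArg (z * ·) h
    simp only [mul_add, mul_sub, mul_zero, ← mul_assoc] at h1
    rw [← sub_eq_zero, ← h1]
    abel
  rw [mul_add, mul_smul_comm, h', one_smul, sub_mul, smul_mul_assoc]
  module

-- The curve `z` is the frame along the ray `t ↦ t u`, and `R` is its variation in the direction
-- `w`. By flatness the defect `R - t z a(w)` solves a homogeneous linear equation with initial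
-- value `0`, so it vanishes by Grönwall. At `t = 1` this says that a frame built along rays is
-- parallel in every direction.
omit [FiniteDimensional ℝ U] [CompleteSpace 𝔸] in
theorem variation_eq_of_flat_along_ray {a : U → U →L[ℝ] 𝔸} (ha : ContDiff ℝ ∞ a) {u w : U}
    {z R : ℝ → 𝔸} {K : ℝ} (hzc : Continuous z) (hRc : Continuous R) (hR0 : R 0 = 0)
    (hz : ∀ t ∈ Ico (0 : ℝ) 1, HasDerivAt z (z t * a (t • u) u) t)
    (hR : ∀ t ∈ Ico (0 : ℝ) 1, HasDerivAt R
      (z t * (t • fderiv ℝ a (t • u) w u + a (t • u) w) + R t * a (t • u) u) t)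
    (hK : ∀ t ∈ Ico (0 : ℝ) 1, ‖a (t • u) u‖ ≤ K)
    (hflat : ∀ t ∈ Ico (0 : ℝ) 1, connectionCurvature a (t • u) w u = 0) :
    R 1 = z 1 * a u w := by
  have had : ∀ u, HasFDerivAt a (fderiv ℝ a u) u := fun u =>
    (ha.differentiable (by simp) u).hasFDerivAt
  have hacont : Continuous fun t : ℝ => a (t • u) w :=
    (ha.continuous.comp (by fun_prop)).clm_apply continuous_const
  let W : ℝ → 𝔸 := fun t => R t - t • (z t * a (t • u) w)
  have hWd : ∀ t ∈ Ico (0 : ℝ) 1, HasDerivAt W (W t * a (t • u) u) t := by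
    intro t ht
    have h1 : HasDerivAt (fun t : ℝ => a (t • u) w) (fderiv ℝ a (t • u) u w) t := by
      have h2 : HasDerivAt (fun t : ℝ => t • u) u t := by
        simpa using (hasDerivAt_id t).smul_const u
      have h3 : HasDerivAt (fun t : ℝ => a (t • u)) (fderiv ℝ a (t • u) u) t :=
        HasFDerivAt.comp_hasDerivAt t (had (t • u)) h2
      exact (ContinuousLinearMap.apply ℝ 𝔸 w).hasFDerivAt.comp_hasDerivAt t h3
    have h3 : HasDerivAt (fun t => z t * a (t • u) w)
        (z t * a (t • u) u * a (t • u) w + z t * fderiv ℝ a (t • u) u w) t :=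
      HasDerivAt.fun_mul (𝕜 := ℝ) (hz t ht) h1
    have h4 : HasDerivAt (fun t => t • (z t * a (t • u) w))
        (t • (z t * a (t • u) u * a (t • u) w + z t * fderiv ℝ a (t • u) u w)
          + (1 : ℝ) • (z t * a (t • u) w)) t :=
      HasDerivAt.fun_smul (hasDerivAt_id' t) h3
    have h5 : HasDerivAt W _ t := HasDerivAt.fun_sub (hR t ht) h4
    refine h5.congr_deriv ?_
    have hf := hflat t ht
    exact variation_algebra_identity t _ _ _ _ _ _ hf
  have hWcont : ContinuousOn W (Icc 0 1) :=
    (hRc.sub (continuous_id.smul (hzc.mul hacont))).continuousOn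
  have hW := eq_zero_of_abs_deriv_le_mul_abs_self_of_eq_zero_right (K := K) hWcont
    (fun t ht => (hWd t ht).hasDerivWithinAt) (by simp [W, hR0]) (fun t ht => by
      refine (norm_mul_le _ _).trans ?_
      rw [mul_comm]
      gcongr
      exact hK t ht) 1 (by simp)
  refine sub_eq_zero.1 ?_
  simpa [W] using hW

/-- The frame is transported along the rays from `0`: the curve `ζ` solves `ζ = 1 + ∫ ζ β` with
`β(t) = A(p, t u) u`, and `Z` is its value at `t = 1`. The Volterra lemma gives smoothness jointly
in `p` and `u`. Flatness enters only in `variation_eq_of_flat_along_ray`, to pass from radial to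
arbitrary directions. -/
theorem exists_parallel_frame_of_contDiff {A : P × U → U →L[ℝ] 𝔸} (hA : ContDiff ℝ ∞ A)
    {p₀ : P} {r : ℝ} (hr : 0 < r)
    (hflat : ∀ p ∈ Metric.ball p₀ r, ∀ u ∈ Metric.ball (0 : U) r, ∀ v w,
      connectionCurvature (fun u => A (p, u)) u v w = 0) :
    ∃ (Z : P × U → 𝔸) (O : Set (P × U)), IsOpen O ∧ (p₀, 0) ∈ O ∧ ContDiffOn ℝ ∞ Z O ∧
      (∀ p, (p, 0) ∈ O → Z (p, 0) = 1) ∧ ∀ p u, (p, u) ∈ O →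
        HasFDerivAt (fun u => Z (p, u)) ((ContinuousLinearMap.mul ℝ 𝔸 (Z (p, u))).comp (A (p, u)))
          u := by
  let B : (P × U) × ℝ → 𝔸 := fun x => A (x.1.1, x.2 • x.1.2) x.1.2
  have hB : ContDiff ℝ ∞ B := by fun_prop
  let β : P × U → C(unitInterval, 𝔸) := curryUnit B hB.continuous
  have hβ : ContDiff ℝ ∞ β := contDiff_curryUnit B hB
  obtain ⟨ζ, Ω, hΩ, hβΩ, hζ, hfix⟩ := exists_contDiffOn_volterra (primitiveUnit (F := 𝔸)) hβ
  have hβ0 : ∀ p, β (p, 0) = 0 := by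
    intro p
    ext t
    simp [β, curryUnit, B]
  let O : Set (P × U) := Ω ∩ Metric.ball p₀ r ×ˢ Metric.ball 0 r
  have hO : IsOpen O := hΩ.inter (Metric.isOpen_ball.prod Metric.isOpen_ball)
  let ev : C(unitInterval, 𝔸) →L[ℝ] 𝔸 := ContinuousMap.evalCLM ℝ 1
  refine ⟨fun q => ev (ζ q), O, hO, ⟨hβΩ _ (hβ0 _), by simp [hr]⟩, ?_, ?_, ?_⟩
  · exact ev.contDiff.comp_contDiffOn (hζ.mono inter_subset_left)
  · intro p hp
    change ev (ζ (p, 0)) = 1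
    rw [hfix _ hp.1, hβ0]
    simp [ev]
  rintro p u ⟨hq, hp, hu⟩
  have hp : p ∈ Metric.ball p₀ r := hp
  have hu : u ∈ Metric.ball (0 : U) r := hu
  have hζd : HasFDerivAt ζ (fderiv ℝ ζ (p, u)) (p, u) :=
    ((hζ.contDiffAt (hΩ.mem_nhds hq)).differentiableAt (by simp)).hasFDerivAt
  have hβd : HasFDerivAt β (curryUnitDeriv B hB (p, u)) (p, u) := hasFDerivAt_curryUnit B hB _
  -- Differentiating the fixed point equation gives the Volterra equation for the variation of `ζ`.
  have hlin : ∀ w : U, fderiv ℝ ζ (p, u) (0, w) = primitiveUnit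
      (ζ (p, u) * curryUnitDeriv B hB (p, u) (0, w) + fderiv ℝ ζ (p, u) (0, w) * β (p, u)) := by
    intro w
    have h1 := ((primitiveUnit (F := 𝔸)).hasFDerivAt.comp (p, u)
      (hζd.mul' hβd)).const_add (1 : C(unitInterval, 𝔸))
    have h2 : HasFDerivAt ζ _ (p, u) := h1.congr_of_eventuallyEq <| by
      filter_upwards [hΩ.mem_nhds hq] with q hq using hfix q hq
    conv_lhs => rw [h2.fderiv]
    simp
  have hu' : HasFDerivAt (fun u : U => (p, u)) (ContinuousLinearMap.inr ℝ P U) u :=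
    hasFDerivAt_prodMk_right p u
  have hmain := (ev.hasFDerivAt.comp (p, u) hζd).comp u hu'
  refine hmain.congr_fderiv ?_
  ext w
  suffices h : fderiv ℝ ζ (p, u) (0, w) 1 = ζ (p, u) 1 * A (p, u) w by simpa [ev] using h
  let a : U → U →L[ℝ] 𝔸 := fun u => A (p, u)
  have ha : ContDiff ℝ ∞ a := by fun_prop
  have had : ∀ u, HasFDerivAt a (fderiv ℝ a u) u := fun u =>
    (ha.differentiable (by simp) u).hasFDerivAt
  let ρ : C(unitInterval, 𝔸) := fderiv ℝ ζ (p, u) (0, w)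
  -- On the unit interval `z` and `R` agree with `ζ (p, u)` and `ρ`. Defining them by integrals
  -- makes them differentiable functions of a real variable.
  let z : ℝ → 𝔸 := fun t =>
    1 + ∫ s in (0 : ℝ)..t, IccExtend zero_le_one (ζ (p, u) * β (p, u)) s
  let R : ℝ → 𝔸 := fun t =>
    ∫ s in (0 : ℝ)..t, IccExtend zero_le_one
      (ζ (p, u) * curryUnitDeriv B hB (p, u) (0, w) + ρ * β (p, u)) s
  have hz : ∀ t : unitInterval, ζ (p, u) t = z t := fun t =>
    congrArg (fun g : C(unitInterval, 𝔸) => g t) (hfix _ hq)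
  have hR : ∀ t : unitInterval, ρ t = R t := fun t =>
    congrArg (fun g : C(unitInterval, 𝔸) => g t) (hlin w)
  have hβt : ∀ t : unitInterval, β (p, u) t = a ((t : ℝ) • u) u := fun t => rfl
  have hβ't : ∀ t : unitInterval, curryUnitDeriv B hB (p, u) (0, w) t =
      (t : ℝ) • fderiv ℝ a ((t : ℝ) • u) w u + a ((t : ℝ) • u) w := by
    intro t
    rw [curryUnitDeriv_apply]
    have h1 : HasFDerivAt B (fderiv ℝ B ((p, u), (t : ℝ))) ((p, u), (t : ℝ)) :=
      (hB.differentiable (by simp) _).hasFDerivAt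
    have h2 := h1.comp u ((hasFDerivAt_prodMk_left (p, u) (t : ℝ)).comp u hu')
    have h3 : HasFDerivAt (fun u : U => (t : ℝ) • u) ((t : ℝ) • ContinuousLinearMap.id ℝ U) u :=
      (hasFDerivAt_id u).const_smul _
    have h4 := ((had ((t : ℝ) • u)).comp u h3).clm_apply (hasFDerivAt_id u)
    have h5 := congrArg (fun L : U →L[ℝ] 𝔸 => L w) (h2.unique h4)
    simpa [add_comm] using h5
  have hzd : ∀ t ∈ Ico (0 : ℝ) 1, HasDerivAt z (z t * a (t • u) u) t := by
    intro t ht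
    have ht' : t ∈ Icc (0 : ℝ) 1 := Ico_subset_Icc_self ht
    have h := (hasDerivAt_integral_IccExtend (ζ (p, u) * β (p, u)) t).const_add (1 : 𝔸)
    rw [IccExtend_of_mem _ _ ht'] at h
    exact h.congr_deriv (congrArg₂ (· * ·) (hz ⟨t, ht'⟩) (hβt ⟨t, ht'⟩))
  have hRd : ∀ t ∈ Ico (0 : ℝ) 1, HasDerivAt R
      (z t * (t • fderiv ℝ a (t • u) w u + a (t • u) w) + R t * a (t • u) u) t := by
    intro t ht
    have ht' : t ∈ Icc (0 : ℝ) 1 := Ico_subset_Icc_self ht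
    have h := hasDerivAt_integral_IccExtend
      (ζ (p, u) * curryUnitDeriv B hB (p, u) (0, w) + ρ * β (p, u)) t
    rw [IccExtend_of_mem _ _ ht'] at h
    exact h.congr_deriv (congrArg₂ (· + ·)
      (congrArg₂ (· * ·) (hz ⟨t, ht'⟩) (hβ't ⟨t, ht'⟩))
      (congrArg₂ (· * ·) (hR ⟨t, ht'⟩) (hβt ⟨t, ht'⟩)))
  have c1 : Continuous R := continuous_iff_continuousAt.2 fun t =>
    (hasDerivAt_integral_IccExtend _ t).continuousAt
  have c2 : Continuous z := continuous_iff_continuousAt.2 fun t =>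
    ((hasDerivAt_integral_IccExtend _ t).const_add (1 : 𝔸)).continuousAt
  have hR0 : R 0 = 0 := intervalIntegral.integral_same
  have key := variation_eq_of_flat_along_ray ha c2 c1 hR0 hzd hRd (K := ‖β (p, u)‖)
    (fun t ht => (β (p, u)).norm_coe_le_norm ⟨t, Ico_subset_Icc_self ht⟩) (fun t ht => by
      refine hflat p hp (t • u) ?_ w u
      rw [mem_ball_zero_iff] at hu ⊢
      refine lt_of_le_of_lt ?_ hu
      rw [norm_smul, Real.norm_of_nonneg ht.1]
      exact mul_le_of_le_one_left (norm_nonneg _) ht.2.le)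
  exact (hR 1).trans (key.trans (congrArg (· * a u w) (hz 1).symm))

/-- A flat connection form depending smoothly on parameters has a parallel frame depending smoothly
on the parameters. -/
theorem exists_parallel_frame {A : P × U → U →L[ℝ] 𝔸} {O : Set (P × U)} (hO : IsOpen O)
    (hA : ContDiffOn ℝ ∞ A O) {p₀ : P} (hp₀ : (p₀, 0) ∈ O)
    (hflat : ∀ p u, (p, u) ∈ O → ∀ v w, connectionCurvature (fun u => A (p, u)) u v w = 0) :
    ∃ (Z : P × U → 𝔸) (r : ℝ), 0 < r ∧ Metric.ball p₀ r ×ˢ Metric.ball 0 r ⊆ O ∧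
      ContDiffOn ℝ ∞ Z (Metric.ball p₀ r ×ˢ Metric.ball 0 r) ∧
      (∀ p ∈ Metric.ball p₀ r, Z (p, 0) = 1) ∧
      ∀ p ∈ Metric.ball p₀ r, ∀ u ∈ Metric.ball (0 : U) r, HasFDerivAt (fun u => Z (p, u))
        ((ContinuousLinearMap.mul ℝ 𝔸 (Z (p, u))).comp (A (p, u))) u := by
  obtain ⟨A', hA', heq⟩ := exists_contDiff_eventuallyEq hO hA hp₀
  have hmem : O ∩ {q | A' q = A q} ∈ 𝓝 (p₀, (0 : U)) := inter_mem (hO.mem_nhds hp₀) heq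
  obtain ⟨r, hr, hball⟩ := Metric.mem_nhds_iff.1 hmem
  rw [← ball_prod_same] at hball
  have hflat' : ∀ p ∈ Metric.ball p₀ r, ∀ u ∈ Metric.ball (0 : U) r, ∀ v w,
      connectionCurvature (fun u => A' (p, u)) u v w = 0 := by
    intro p hp u hu v w
    -- The two forms agree near `u`, not only at `u`, so their derivatives and curvatures agree.
    have h1 : (fun u => A' (p, u)) =ᶠ[𝓝 u] fun u => A (p, u) := by
      filter_upwards [Metric.isOpen_ball.mem_nhds hu] with u' hu' using (hball ⟨hp, hu'⟩).2
    have h2 := hflat p u (hball ⟨hp, hu⟩).1 v w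
    unfold connectionCurvature at h2 ⊢
    rw [h1.fderiv_eq, h1.self_of_nhds]
    exact h2
  obtain ⟨Z, O', hO', hmem', hZ, hZ0, hZd⟩ := exists_parallel_frame_of_contDiff hA' hr hflat'
  obtain ⟨s, hs, hballs⟩ := Metric.mem_nhds_iff.1 (hO'.mem_nhds hmem')
  rw [← ball_prod_same] at hballs
  have hsub : Metric.ball p₀ (min r s) ×ˢ Metric.ball (0 : U) (min r s) ⊆
      Metric.ball p₀ s ×ˢ Metric.ball 0 s :=
    prod_mono (Metric.ball_subset_ball (min_le_right _ _))
      (Metric.ball_subset_ball (min_le_right _ _))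
  have hsub' : Metric.ball p₀ (min r s) ×ˢ Metric.ball (0 : U) (min r s) ⊆
      Metric.ball p₀ r ×ˢ Metric.ball 0 r :=
    prod_mono (Metric.ball_subset_ball (min_le_left _ _))
      (Metric.ball_subset_ball (min_le_left _ _))
  have hpos : 0 < min r s := lt_min hr hs
  refine ⟨Z, min r s, hpos, fun q hq => (hball (hsub' hq)).1, hZ.mono (hsub.trans hballs),
    fun p hp => hZ0 p (hballs (hsub ⟨hp, Metric.mem_ball_self hpos⟩)), fun p hp u hu => ?_⟩
  have h := hZd p u (hballs (hsub ⟨hp, hu⟩))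
  rwa [(hball (hsub' ⟨hp, hu⟩)).2] at h

end Frobenius

/-! ### Smoothness of Christoffel symbols -/

section Smoothness

variable {P : Type*} [NormedAddCommGroup P] [NormedSpace ℝ P] {n : ℕ}

theorem contDiffOn_partialDeriv {g : P × EuclideanSpace ℝ (Fin n) → ℝ}
    {O : Set (P × EuclideanSpace ℝ (Fin n))} (hO : IsOpen O) (hg : ContDiffOn ℝ ∞ g O)
    (i : Fin n) :
    ContDiffOn ℝ ∞ (fun q : P × EuclideanSpace ℝ (Fin n) =>
      partialDeriv i (fun u => g (q.1, u)) q.2) O := by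
  have h1 : ContDiffOn ℝ ∞ (fun q => fderiv ℝ g q (0, EuclideanSpace.single i 1)) O :=
    (hg.fderiv_of_isOpen hO (by simp)).clm_apply contDiffOn_const
  refine h1.congr fun q hq => ?_
  have h2 : HasFDerivAt g (fderiv ℝ g q) (q.1, q.2) :=
    ((hg.contDiffAt (hO.mem_nhds hq)).differentiableAt (by simp)).hasFDerivAt
  have h3 := h2.comp q.2 (hasFDerivAt_prodMk_right q.1 q.2)
  change fderiv ℝ (g ∘ Prod.mk q.1) q.2 _ = _
  rw [h3.fderiv]
  simp

theorem contDiffOn_matrix_det {m : Type*} [Fintype m] [DecidableEq m] {g : P → Matrix m m ℝ}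
    {O : Set P} (hg : ∀ i j, ContDiffOn ℝ ∞ (fun q => g q i j) O) :
    ContDiffOn ℝ ∞ (fun q => (g q).det) O := by
  simp only [Matrix.det_apply]
  refine ContDiffOn.sum fun σ _ => ?_
  simp only [Units.smul_def, zsmul_eq_mul]
  exact contDiffOn_const.mul (contDiffOn_prod fun i _ => hg _ _)

theorem contDiffOn_matrix_inv {m : Type*} [Fintype m] [DecidableEq m] {g : P → Matrix m m ℝ}
    {O : Set P} (hg : ∀ i j, ContDiffOn ℝ ∞ (fun q => g q i j) O)
    (hdet : ∀ q ∈ O, (g q).det ≠ 0) (i j : m) :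
    ContDiffOn ℝ ∞ (fun q => (g q)⁻¹ i j) O := by
  simp only [Matrix.inv_def, Ring.inverse_eq_inv', Matrix.smul_apply, smul_eq_mul,
    Matrix.adjugate_apply]
  refine ((contDiffOn_matrix_det hg).inv hdet).mul (contDiffOn_matrix_det fun a b => ?_)
  by_cases h : a = j
  · subst h
    simpa using contDiffOn_const
  · simpa [Matrix.updateRow_ne h] using hg a b

variable {γ : P → EuclideanSpace ℝ (Fin n) → Matrix (Fin n) (Fin n) ℝ}
  {O : Set (P × EuclideanSpace ℝ (Fin n))}

theorem contDiffOn_christoffel (hO : IsOpen O)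
    (hγ : ∀ i j, ContDiffOn ℝ ∞ (fun q : P × EuclideanSpace ℝ (Fin n) => γ q.1 q.2 i j) O)
    (hdet : ∀ q ∈ O, (γ q.1 q.2).det ≠ 0) (k i j : Fin n) :
    ContDiffOn ℝ ∞ (fun q : P × EuclideanSpace ℝ (Fin n) => christoffel (γ q.1) k i j q.2) O := by
  unfold christoffel
  refine contDiffOn_const.mul (ContDiffOn.sum fun l _ => ?_)
  exact (contDiffOn_matrix_inv hγ hdet k l).mul
    (((contDiffOn_partialDeriv hO (hγ j l) i).add (contDiffOn_partialDeriv hO (hγ i l) j)).sub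
      (contDiffOn_partialDeriv hO (hγ i j) l))

/-- This is what makes the curvature `K` of the indicatrices a smooth function of the base point. -/
theorem contDiffOn_riemannTensor (hO : IsOpen O)
    (hγ : ∀ i j, ContDiffOn ℝ ∞ (fun q : P × EuclideanSpace ℝ (Fin n) => γ q.1 q.2 i j) O)
    (hdet : ∀ q ∈ O, (γ q.1 q.2).det ≠ 0) (l k i j : Fin n) :
    ContDiffOn ℝ ∞ (fun q : P × EuclideanSpace ℝ (Fin n) =>
      riemannTensor (γ q.1) l k i j q.2) O := by
  have hc := contDiffOn_christoffel hO hγ hdet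
  unfold riemannTensor
  refine ((contDiffOn_partialDeriv hO (hc l j k) i).sub
    (contDiffOn_partialDeriv hO (hc l i k) j)).add (ContDiffOn.sum fun m _ => ?_)
  exact ((hc l i m).mul (hc m j k)).sub ((hc l j m).mul (hc m i k))

end Smoothness

/-! ### Connections given by matrices of functions -/

section MatrixConnection

variable {n : ℕ} {ι : Type*} [Fintype ι] [DecidableEq ι]

local notation:max "𝔼" n:max => EuclideanSpace ℝ (Fin n)

theorem fderiv_sum_smul_const_apply {α E F : Type*} [Fintype α] [NormedAddCommGroup E]
    [NormedSpace ℝ E] [NormedAddCommGroup F] [NormedSpace ℝ F] (c : α → F) {f : α → E → ℝ} {u : E}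
    (hf : ∀ a, DifferentiableAt ℝ (f a) u) (v : E) :
    fderiv ℝ (fun u => ∑ a, f a u • c a) u v = ∑ a, fderiv ℝ (f a) u v • c a := by
  have h : HasFDerivAt (fun u => ∑ a, f a u • c a)
      (∑ a, (fderiv ℝ (f a) u).smulRight (c a)) u :=
    HasFDerivAt.fun_sum fun a _ => (hf a).hasFDerivAt.smul_const (c a)
  rw [h.fderiv]
  simp

theorem connectionCurvature_apply {U G : Type*} [NormedAddCommGroup U] [NormedSpace ℝ U]
    [NormedAddCommGroup G] [NormedSpace ℝ G] (A : U → U →L[ℝ] G →L[ℝ] G) (u v w : U) (x : G) :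
    connectionCurvature A u v w x =
      fderiv ℝ A u v w x - fderiv ℝ A u w v x + A u v (A u w x) - A u w (A u v x) := rfl

theorem eq_sum_smul_single (x : EuclideanSpace ℝ ι) :
    x = ∑ i, x i • EuclideanSpace.single i (1 : ℝ) := by
  simpa using ((EuclideanSpace.basisFun ι ℝ).sum_repr x).symm

/-- Curvature is bilinear in the two directions, so basis vectors suffice. -/
theorem connectionCurvature_eq_zero_iff {G : Type*} [NormedAddCommGroup G] [NormedSpace ℝ G]
    (A : 𝔼 n → 𝔼 n →L[ℝ] G →L[ℝ] G) (u : 𝔼 n) : (∀ v w, connectionCurvature A u v w = 0) ↔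
      ∀ i j, connectionCurvature A u (EuclideanSpace.single i 1) (EuclideanSpace.single j 1) = 0 := by
  refine ⟨fun h i j => h _ _, fun h => ?_⟩
  let m := (ContinuousLinearMap.mul ℝ (G →L[ℝ] G)).bilinearComp (A u) (A u)
  let T : 𝔼 n →L[ℝ] 𝔼 n →L[ℝ] G →L[ℝ] G :=
    fderiv ℝ A u - (fderiv ℝ A u).flip + m - m.flip
  have hT : ∀ v w, T v w = connectionCurvature A u v w := fun v w => rfl
  have h0 : ∀ v w, T v w = 0 := by
    intro v w
    rw [eq_sum_smul_single v, eq_sum_smul_single w]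
    simp [map_sum, hT, h]
  exact fun v w => (hT v w).symm.trans (h0 v w)


/-- The map `(w, x) ↦ wᵢ xₒ eₚ`. -/
def elementaryForm (i : Fin n) (p o : ι) :
    𝔼 n →L[ℝ] EuclideanSpace ℝ ι →L[ℝ] EuclideanSpace ℝ ι :=
  (EuclideanSpace.proj i : 𝔼 n →L[ℝ] ℝ).smulRight
    ((EuclideanSpace.proj o : EuclideanSpace ℝ ι →L[ℝ] ℝ).smulRight (EuclideanSpace.single p 1))

theorem elementaryForm_apply (i : Fin n) (p o q : ι) (w : 𝔼 n)
    (x : EuclideanSpace ℝ ι) : elementaryForm i p o w x q =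
      w i * x o * (EuclideanSpace.single p (1 : ℝ) : EuclideanSpace ℝ ι) q := by
  simp [elementaryForm]

/-- The connection form `w ↦ ∑ᵢ wᵢ Mᵢ(u)`. -/
def matrixConnection (m : Fin n → ι → ι → 𝔼 n → ℝ) (u : 𝔼 n) :
    𝔼 n →L[ℝ] EuclideanSpace ℝ ι →L[ℝ] EuclideanSpace ℝ ι :=
  ∑ x : Fin n × ι × ι, m x.1 x.2.1 x.2.2 u • elementaryForm x.1 x.2.1 x.2.2

variable (m : Fin n → ι → ι → 𝔼 n → ℝ) (u : 𝔼 n)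

theorem matrixConnection_apply (w : 𝔼 n) (x : EuclideanSpace ℝ ι) (p : ι) :
    matrixConnection m u w x p = ∑ i, ∑ o, w i * x o * m i p o u := by
  simp only [matrixConnection, FunLike.coe_sum, Finset.sum_apply, FunLike.coe_smul,
    Pi.smul_apply, WithLp.ofLp_sum, WithLp.ofLp_smul, elementaryForm_apply, smul_eq_mul,
    Fintype.sum_prod_type]
  refine Finset.sum_congr rfl fun i _ => ?_
  rw [Finset.sum_comm]
  refine Finset.sum_congr rfl fun o _ => ?_
  rw [Finset.sum_eq_single p]
  · simp
    ring
  · intro q _ hq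
    simp [hq.symm]
  · simp

theorem sum_single_mul (i : ι) (f : ι → ℝ) :
    ∑ a, (EuclideanSpace.single i (1 : ℝ) : EuclideanSpace ℝ ι) a * f a = f i := by
  simp

theorem matrixConnection_single_apply (i : Fin n) (x : EuclideanSpace ℝ ι) (p : ι) :
    matrixConnection m u (EuclideanSpace.single i 1) x p = ∑ o, m i p o u * x o := by
  simp only [matrixConnection_apply, mul_assoc, ← Finset.mul_sum, sum_single_mul]
  simp only [mul_comm]

theorem matrixConnection_single_single (i : Fin n) (p o : ι) :
    matrixConnection m u (EuclideanSpace.single i 1) (EuclideanSpace.single o 1) p =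
      m i p o u := by
  simp [matrixConnection_single_apply]

variable {m u}

theorem fderiv_matrixConnection_apply (hm : ∀ i p o, DifferentiableAt ℝ (m i p o) u)
    (v w : 𝔼 n) (x : EuclideanSpace ℝ ι) (p : ι) :
    fderiv ℝ (matrixConnection m) u v w x p = ∑ i, ∑ o, w i * x o * fderiv ℝ (m i p o) u v := by
  have h : fderiv ℝ (matrixConnection m) u v =
      matrixConnection (fun i p o _ => fderiv ℝ (m i p o) u v) u := by
    unfold matrixConnection
    exact fderiv_sum_smul_const_apply (fun x : Fin n × ι × ι => elementaryForm x.1 x.2.1 x.2.2)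
      (fun x => hm x.1 x.2.1 x.2.2) v
  rw [h, matrixConnection_apply]

theorem fderiv_matrixConnection_single (hm : ∀ i p o, DifferentiableAt ℝ (m i p o) u)
    (i j : Fin n) (p o : ι) :
    fderiv ℝ (matrixConnection m) u (EuclideanSpace.single i 1) (EuclideanSpace.single j 1)
      (EuclideanSpace.single o 1) p = partialDeriv i (m j p o) u := by
  rw [fderiv_matrixConnection_apply hm]
  simp only [mul_assoc, ← Finset.mul_sum, sum_single_mul]
  rfl

theorem connectionCurvature_matrixConnection
    (hm : ∀ i p o, DifferentiableAt ℝ (m i p o) u) (i j : Fin n) (p o : ι) :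
    connectionCurvature (matrixConnection m) u (EuclideanSpace.single i 1)
      (EuclideanSpace.single j 1) (EuclideanSpace.single o 1) p =
    partialDeriv i (m j p o) u - partialDeriv j (m i p o) u
      + ∑ q, m i p q u * m j q o u - ∑ q, m j p q u * m i q o u := by
  rw [connectionCurvature_apply]
  simp only [PiLp.add_apply, PiLp.sub_apply, fderiv_matrixConnection_single hm,
    matrixConnection_single_apply _ _ _ (matrixConnection m u _ _), matrixConnection_single_single]

theorem matrixConnection_flat_iff (hm : ∀ i p o, DifferentiableAt ℝ (m i p o) u) :
    (∀ v w, connectionCurvature (matrixConnection m) u v w = 0) ↔ ∀ i j p o,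
      partialDeriv i (m j p o) u - partialDeriv j (m i p o) u
        + ∑ q, m i p q u * m j q o u - ∑ q, m j p q u * m i q o u = 0 := by
  rw [connectionCurvature_eq_zero_iff]
  refine forall₂_congr fun i j => ?_
  simp only [← connectionCurvature_matrixConnection hm]
  constructor
  · intro h p o
    rw [h]
    simp
  · intro h
    refine ContinuousLinearMap.ext fun x => ?_
    rw [eq_sum_smul_single x, map_sum]
    refine Finset.sum_eq_zero fun o _ => ?_
    rw [map_smul]
    have : connectionCurvature (matrixConnection m) u (EuclideanSpace.single i 1)
      (EuclideanSpace.single j 1) (EuclideanSpace.single o 1) = 0 := by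
      ext p
      exact h p o
    rw [this, smul_zero]

end MatrixConnection

/-! ### The connection of Gauss' equations

A hypersurface of constant curvature `κ` in a Euclidean space has position vector `ψ` and frame
`∂ᵢψ` with `∂ᵢ∂ⱼψ = Γᵏᵢⱼ ∂ₖψ - κ γᵢⱼ ψ`. The connection below encodes this system; the index
`none` stands for the position vector. -/

section Gauss

variable {n : ℕ}

local notation:max "𝔼" n:max => EuclideanSpace ℝ (Fin n)

/-- The coefficients of the connection of Gauss' equations. -/
def gaussCoeff (γ : 𝔼 n → Matrix (Fin n) (Fin n) ℝ) (κ : ℝ) (i : Fin n) :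
    Option (Fin n) → Option (Fin n) → 𝔼 n → ℝ
  | none, none => fun _ => 0
  | some k, none => fun _ => if k = i then 1 else 0
  | none, some j => fun u => -κ * γ u i j
  | some k, some j => christoffel γ k i j

variable {γ : 𝔼 n → Matrix (Fin n) (Fin n) ℝ} {κ : ℝ} {u : 𝔼 n}

/-- Lowering the index cancels the inverse matrix and leaves the Christoffel symbol of the first
kind, which is linear in the derivatives of the metric. -/
theorem sum_metric_mul_christoffel (hdet : (γ u).det ≠ 0) (i j l : Fin n) :
    ∑ m, γ u l m * christoffel γ m i j u = (1 / 2 : ℝ) *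
      (partialDeriv i (fun w => γ w j l) u + partialDeriv j (fun w => γ w i l) u
        - partialDeriv l (fun w => γ w i j) u) := by
  have hinv : γ u * (γ u)⁻¹ = 1 := Matrix.mul_nonsing_inv _ (isUnit_iff_ne_zero.2 hdet)
  let b : Fin n → ℝ := fun l => (1 / 2 : ℝ) *
      (partialDeriv i (fun w => γ w j l) u + partialDeriv j (fun w => γ w i l) u
        - partialDeriv l (fun w => γ w i j) u)
  have h1 : (fun m => christoffel γ m i j u) = Matrix.mulVec (γ u)⁻¹ b := by
    funext m
    simp only [christoffel, Matrix.mulVec, dotProduct, b, Finset.mul_sum]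
    exact Finset.sum_congr rfl fun l _ => by ring
  have h2 : Matrix.mulVec (γ u) (fun m => christoffel γ m i j u) = b := by
    rw [h1, Matrix.mulVec_mulVec, hinv, Matrix.one_mulVec]
  exact congrFun h2 l

theorem partialDeriv_metric_symm (hsymm : ∀ᶠ w in 𝓝 u, (γ w).IsSymm) (l i j : Fin n) :
    partialDeriv l (fun w => γ w i j) u = partialDeriv l (fun w => γ w j i) u := by
  have : (fun w => γ w i j) =ᶠ[𝓝 u] fun w => γ w j i := by
    filter_upwards [hsymm] with w hw using hw.apply j i
  unfold partialDeriv
  rw [this.fderiv_eq]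

theorem christoffel_symm (hsymm : ∀ᶠ w in 𝓝 u, (γ w).IsSymm) (k i j : Fin n) :
    christoffel γ k i j u = christoffel γ k j i u := by
  unfold christoffel
  congr 1
  refine Finset.sum_congr rfl fun l _ => ?_
  rw [partialDeriv_metric_symm hsymm l i j]
  ring

/-- Compatibility of the Levi-Civita connection with the metric: in the sum of the two symbols of
the first kind, all but one derivative cancel. -/
theorem partialDeriv_metric (hdet : (γ u).det ≠ 0) (hsymm : ∀ᶠ w in 𝓝 u, (γ w).IsSymm)
    (l i j : Fin n) : partialDeriv l (fun w => γ w i j) u =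
      ∑ m, γ u j m * christoffel γ m l i u + ∑ m, γ u i m * christoffel γ m l j u := by
  rw [sum_metric_mul_christoffel hdet, sum_metric_mul_christoffel hdet,
    partialDeriv_metric_symm hsymm l j i, partialDeriv_metric_symm hsymm i l j,
    partialDeriv_metric_symm hsymm j l i]
  rw [partialDeriv_metric_symm hsymm i j l, partialDeriv_metric_symm hsymm j i l]
  ring

theorem differentiableAt_gaussCoeff
    (hγ : ∀ i j, DifferentiableAt ℝ (fun w => γ w i j) u)
    (hΓ : ∀ k i j, DifferentiableAt ℝ (christoffel γ k i j) u) (i : Fin n)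
    (p o : Option (Fin n)) : DifferentiableAt ℝ (gaussCoeff γ κ i p o) u := by
  rcases p with _ | k <;> rcases o with _ | j
  · exact differentiableAt_const _
  · exact (hγ i j).const_mul _
  · exact differentiableAt_const _
  · exact hΓ k i j

/-- The connection of Gauss' equations is flat precisely when the metric has constant
curvature `κ`. -/
theorem gaussConnection_flat_iff
    (hγ : ∀ i j, DifferentiableAt ℝ (fun w => γ w i j) u)
    (hΓ : ∀ k i j, DifferentiableAt ℝ (christoffel γ k i j) u)
    (hdet : (γ u).det ≠ 0) (hsymm : ∀ᶠ w in 𝓝 u, (γ w).IsSymm) :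
    (∀ v w, connectionCurvature (matrixConnection (gaussCoeff γ κ)) u v w = 0) ↔
      ∀ l k i j : Fin n, riemannTensor γ l k i j u =
        κ * (γ u j k * (if l = i then 1 else 0) - γ u i k * (if l = j then 1 else 0)) := by
  rw [matrixConnection_flat_iff (differentiableAt_gaussCoeff hγ hΓ)]
  have hs : ∀ i j, γ u i j = γ u j i := fun i j => hsymm.self_of_nhds.apply j i
  have hc : ∀ (i : Fin n) (c : ℝ), partialDeriv i (fun _ => c) u = 0 := fun i c => by
    simp [partialDeriv]
  have hm : ∀ i j k, partialDeriv i (fun u => -κ * γ u j k) u =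
      -κ * partialDeriv i (fun u => γ u j k) u := fun i j k => by
    unfold partialDeriv
    rw [((hγ j k).hasFDerivAt.const_mul (-κ)).fderiv]
    simp
  -- The tangential components of the curvature are exactly the defect from constant curvature `κ`.
  have hsnd : ∀ i j k l, partialDeriv i (christoffel γ l j k) u
      - partialDeriv j (christoffel γ l i k) u
      + ((if l = i then 1 else 0) * (-κ * γ u j k) +
          ∑ q, christoffel γ l i q u * christoffel γ q j k u)
      - ((if l = j then 1 else 0) * (-κ * γ u i k) +
          ∑ q, christoffel γ l j q u * christoffel γ q i k u) = riemannTensor γ l k i j u -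
        κ * (γ u j k * (if l = i then 1 else 0) - γ u i k * (if l = j then 1 else 0)) := by
    intro i j k l
    simp only [riemannTensor, Finset.sum_sub_distrib]
    ring
  constructor
  · intro h l k i j
    have := h i j (some l) (some k)
    simp only [gaussCoeff, Fintype.sum_option, hsnd] at this
    exact sub_eq_zero.1 this
  -- The other three blocks vanish for every metric: the first by symmetry of `γ`, the second by the
  -- formula for the symbols of the first kind, the third by symmetry of the Christoffel symbols.
  · intro h i j p o
    rcases p with _ | l <;> rcases o with _ | k <;>
      simp only [gaussCoeff, Fintype.sum_option, hc, hm]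
    · simp [hs i j]
    · simp only [mul_assoc, ← Finset.mul_sum, sum_metric_mul_christoffel hdet]
      rw [partialDeriv_metric_symm hsymm j k i, partialDeriv_metric_symm hsymm i k j,
        partialDeriv_metric_symm hsymm k i j]
      ring
    · simp [christoffel_symm hsymm l i j]
    · rw [hsnd, h, sub_self]

end Gauss

/-! ### Derivatives along the fibres -/

section FiberDeriv

variable {P E G : Type*} [NormedAddCommGroup P] [NormedSpace ℝ P]
  [NormedAddCommGroup E] [NormedSpace ℝ E] [NormedAddCommGroup G] [NormedSpace ℝ G]

theorem contDiffOn_fderiv_snd {F : P × E → G} {O : Set (P × E)} (hO : IsOpen O)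
    (hF : ContDiffOn ℝ ∞ F O) :
    ContDiffOn ℝ ∞ (fun q : P × E => fderiv ℝ (fun y => F (q.1, y)) q.2) O := by
  have h1 : ContDiffOn ℝ ∞ (fun q => (fderiv ℝ F q).comp (ContinuousLinearMap.inr ℝ P E)) O :=
    (hF.fderiv_of_isOpen hO (by simp)).clm_comp contDiffOn_const
  refine h1.congr fun q hq => ?_
  have h2 : HasFDerivAt F (fderiv ℝ F q) (q.1, q.2) :=
    ((hF.contDiffAt (hO.mem_nhds hq)).differentiableAt (by simp)).hasFDerivAt
  exact (h2.comp q.2 (hasFDerivAt_prodMk_right q.1 q.2)).fderiv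

theorem contDiffOn_snd_of_contDiffOn {F : P × E → G} {O : Set (P × E)}
    (hF : ContDiffOn ℝ ∞ F O) (p : P) : ContDiffOn ℝ ∞ (fun y => F (p, y)) {y | (p, y) ∈ O} :=
  hF.comp (contDiff_prodMk_right p).contDiffOn fun _ hy => hy

omit [NormedSpace ℝ P] [NormedSpace ℝ E] in
theorem isOpen_fiber {O : Set (P × E)} (hO : IsOpen O) (p : P) : IsOpen {y | (p, y) ∈ O} :=
  hO.preimage (by fun_prop)

end FiberDeriv

/-! ### Norms on a vector space with positive definite fundamental tensor -/

section ConicNorm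

variable {N : ℕ}

local notation:max "𝔼" n:max => EuclideanSpace ℝ (Fin n)

/-- A smooth positive function `h` on an open cone `D`, homogeneous of degree one, with positive
definite `½ ∂²h² / ∂y∂y`. -/
structure IsConicNorm (D : Set (𝔼 N)) (h : 𝔼 N → ℝ) : Prop where
  isOpen : IsOpen D
  ne_zero : ∀ y ∈ D, y ≠ 0
  conic : ∀ y ∈ D, ∀ k : ℝ, 0 < k → k • y ∈ D
  smooth : ContDiffOn ℝ ∞ h D
  pos : ∀ y ∈ D, 0 < h y
  homogeneous : ∀ y ∈ D, ∀ k : ℝ, 0 < k → h (k • y) = k * h y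
  posDef : ∀ y ∈ D, ∀ ξ : 𝔼 N, ξ ≠ 0 → 0 < halfHessianSq h y ξ ξ

theorem halfHessianSq_eq {h : 𝔼 N → ℝ} {y : 𝔼 N}
    (hd : DifferentiableAt ℝ (fderiv ℝ fun w => h w ^ 2) y) (ξ η : 𝔼 N) :
    halfHessianSq h y ξ η = (1 / 2 : ℝ) * fderiv ℝ (fderiv ℝ fun w => h w ^ 2) y η ξ := by
  unfold halfHessianSq
  have h1 : HasFDerivAt (fun z => fderiv ℝ (fun w => h w ^ 2) z ξ) _ y :=
    (ContinuousLinearMap.apply ℝ ℝ ξ).hasFDerivAt.comp y hd.hasFDerivAt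
  rw [h1.fderiv]
  rfl

theorem halfHessianSq_comp (h : 𝔼 N → ℝ) (A : 𝔼 N ≃L[ℝ] 𝔼 N) (y ξ η : 𝔼 N) :
    halfHessianSq (fun w => h (A w)) y ξ η = halfHessianSq h (A y) (A ξ) (A η) := by
  unfold halfHessianSq
  have h1 : ∀ z, fderiv ℝ (fun w => h (A w) ^ 2) z ξ = fderiv ℝ (fun w => h w ^ 2) (A z) (A ξ) := by
    intro z
    have := A.comp_right_fderiv (f := fun w => h w ^ 2) (x := z)
    change fderiv ℝ ((fun w => h w ^ 2) ∘ A) z ξ = _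
    rw [this]
    rfl
  simp only [h1]
  have h2 := A.comp_right_fderiv (f := fun z => fderiv ℝ (fun w => h w ^ 2) z (A ξ)) (x := y)
  change _ * fderiv ℝ ((fun z => fderiv ℝ (fun w => h w ^ 2) z (A ξ)) ∘ A) y η = _
  rw [h2]
  rfl

namespace IsConicNorm

variable {D : Set (𝔼 N)} {h : 𝔼 N → ℝ} (hh : IsConicNorm D h) {y : 𝔼 N}

include hh

theorem contDiffOn_fderiv_sq : ContDiffOn ℝ ∞ (fderiv ℝ fun w => h w ^ 2) D :=
  (hh.smooth.pow 2).fderiv_of_isOpen hh.isOpen (by simp)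

theorem differentiableAt (hy : y ∈ D) : DifferentiableAt ℝ h y :=
  (hh.smooth.contDiffAt (hh.isOpen.mem_nhds hy)).differentiableAt (by simp)

theorem differentiableAt_fderiv_sq (hy : y ∈ D) :
    DifferentiableAt ℝ (fderiv ℝ fun w => h w ^ 2) y :=
  (hh.contDiffOn_fderiv_sq.contDiffAt (hh.isOpen.mem_nhds hy)).differentiableAt (by simp)

theorem halfHessianSq_apply (hy : y ∈ D) (ξ η : 𝔼 N) : halfHessianSq h y ξ η =
    (1 / 2 : ℝ) * fderiv ℝ (fderiv ℝ fun w => h w ^ 2) y η ξ :=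
  halfHessianSq_eq (hh.differentiableAt_fderiv_sq hy) ξ η

theorem halfHessianSq_symm (hy : y ∈ D) (ξ η : 𝔼 N) :
    halfHessianSq h y ξ η = halfHessianSq h y η ξ := by
  rw [hh.halfHessianSq_apply hy, hh.halfHessianSq_apply hy]
  have : IsSymmSndFDerivAt ℝ (fun w => h w ^ 2) y :=
    ((hh.smooth.pow 2).contDiffAt (hh.isOpen.mem_nhds hy)).isSymmSndFDerivAt (by simpa using ENat.LEInfty.out)
  rw [this.eq]

theorem fderiv_sq_smul (hy : y ∈ D) {k : ℝ} (hk : 0 < k) :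
    fderiv ℝ (fun w => h w ^ 2) (k • y) = k • fderiv ℝ (fun w => h w ^ 2) y := by
  have h1 : (fun w => h (k • w) ^ 2) =ᶠ[𝓝 y] fun w => k ^ 2 • h w ^ 2 := by
    filter_upwards [hh.isOpen.mem_nhds hy] with w hw
    rw [hh.homogeneous w hw k hk, smul_eq_mul]
    ring
  have h2 := h1.fderiv_eq (𝕜 := ℝ)
  have h3 := fderiv_comp_smul (𝕜 := ℝ) (f := fun w => h w ^ 2) (x := y) k
  rw [h3, fderiv_fun_const_smul ((hh.differentiableAt hy).fun_pow 2)] at h2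
  have h4 : k • fderiv ℝ (fun w => h w ^ 2) (k • y) =
    k • k • fderiv ℝ (fun w => h w ^ 2) y := by
    rw [h2, smul_smul, sq]
  exact smul_right_injective _ hk.ne' h4

theorem halfHessianSq_smul (hy : y ∈ D) {k : ℝ} (hk : 0 < k) (ξ η : 𝔼 N) :
    halfHessianSq h (k • y) ξ η = halfHessianSq h y ξ η := by
  rw [hh.halfHessianSq_apply hy, hh.halfHessianSq_apply (hh.conic y hy k hk)]
  have h1 : (fun w => fderiv ℝ (fun w => h w ^ 2) (k • w)) =ᶠ[𝓝 y]
      fun w => k • fderiv ℝ (fun w => h w ^ 2) w := by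
    filter_upwards [hh.isOpen.mem_nhds hy] with w hw using hh.fderiv_sq_smul hw hk
  have h2 := h1.fderiv_eq (𝕜 := ℝ)
  have h3 := fderiv_comp_smul (𝕜 := ℝ) (f := fderiv ℝ fun w => h w ^ 2) (x := y) k
  rw [h3, fderiv_fun_const_smul (hh.differentiableAt_fderiv_sq hy)] at h2
  rw [smul_right_injective _ hk.ne' h2]

/-- Euler's relation for the derivative of `h²`, which is homogeneous of degree one. In particular
`y` is orthogonal to the kernel of `dh`, that is, to the level sets of `h`. -/
theorem halfHessianSq_self (hy : y ∈ D) (ξ : 𝔼 N) :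
    halfHessianSq h y y ξ = h y * fderiv ℝ h y ξ := by
  have hline : HasDerivAt (fun t : ℝ => t • y) y 1 := by
    simpa using (hasDerivAt_id (1 : ℝ)).smul_const y
  have h1 : HasDerivAt (fun t : ℝ => fderiv ℝ (fun w => h w ^ 2) (t • y))
      (fderiv ℝ (fderiv ℝ fun w => h w ^ 2) y y) 1 := by
    refine HasFDerivAt.comp_hasDerivAt_of_eq (1 : ℝ)
      (hh.differentiableAt_fderiv_sq hy).hasFDerivAt hline (by simp)
  have h2 : HasDerivAt (fun t : ℝ => t • fderiv ℝ (fun w => h w ^ 2) y)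
      (fderiv ℝ (fun w => h w ^ 2) y) 1 := by
    simpa using (hasDerivAt_id (1 : ℝ)).smul_const (fderiv ℝ (fun w => h w ^ 2) y)
  have h3 : (fun t : ℝ => fderiv ℝ (fun w => h w ^ 2) (t • y)) =ᶠ[𝓝 1]
      fun t : ℝ => t • fderiv ℝ (fun w => h w ^ 2) y := by
    filter_upwards [eventually_gt_nhds (zero_lt_one (α := ℝ))] with t ht
      using hh.fderiv_sq_smul hy ht
  have h4 := h1.unique (h2.congr_of_eventuallyEq h3)
  rw [hh.halfHessianSq_symm hy, hh.halfHessianSq_apply hy, h4,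
    ((hh.differentiableAt hy).hasFDerivAt.pow 2).fderiv]
  simp
  ring

theorem fderiv_self (hy : y ∈ D) : fderiv ℝ h y y = h y := by
  have hline : HasDerivAt (fun t : ℝ => t • y) y 1 := by
    simpa using (hasDerivAt_id (1 : ℝ)).smul_const y
  have h1 : HasDerivAt (fun t : ℝ => h (t • y)) (fderiv ℝ h y y) 1 :=
    HasFDerivAt.comp_hasDerivAt_of_eq (1 : ℝ) (hh.differentiableAt hy).hasFDerivAt hline (by simp)
  have h2 : HasDerivAt (fun t : ℝ => t * h y) (h y) 1 := by
    simpa using (hasDerivAt_id (1 : ℝ)).mul_const (h y)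
  refine h1.unique (h2.congr_of_eventuallyEq ?_)
  filter_upwards [eventually_gt_nhds (zero_lt_one (α := ℝ))] with t ht
    using hh.homogeneous y hy t ht

theorem halfHessianSq_self_self (hy : y ∈ D) : halfHessianSq h y y y = h y ^ 2 := by
  rw [hh.halfHessianSq_self hy, hh.fderiv_self hy, sq]

theorem inv_smul_mem (hy : y ∈ D) : (h y)⁻¹ • y ∈ D := hh.conic y hy _ (inv_pos.2 (hh.pos y hy))

theorem apply_inv_smul (hy : y ∈ D) : h ((h y)⁻¹ • y) = 1 := by
  rw [hh.homogeneous y hy _ (inv_pos.2 (hh.pos y hy)), inv_mul_cancel₀ (hh.pos y hy).ne']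

/-- The multiplier of a homogeneous conformal map preserving unit vectors. -/
theorem multiplier_eq (hy : y ∈ D) {c : 𝔼 N → 𝔼 N} {H q : ℝ} {s : 𝔼 N →L[ℝ] 𝔼 N →L[ℝ] ℝ}
    (hH : 0 < H) (hc : DifferentiableAt ℝ c y)
    (hhom : ∀ k : ℝ, 0 < k → c (k • y) = (k ^ H) • c y)
    (hunit : s (c ((h y)⁻¹ • y)) (c ((h y)⁻¹ • y)) = 1)
    (hconf : halfHessianSq h y y y = q * s (fderiv ℝ c y y) (fderiv ℝ c y y)) :
    q = (1 / H * h y ^ (1 - H)) ^ 2 := by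
  have hpos := hh.pos y hy
  have hline : HasDerivAt (fun t : ℝ => t • y) y 1 := by
    simpa using (hasDerivAt_id (1 : ℝ)).smul_const y
  have h1 : HasDerivAt (fun t : ℝ => c (t • y)) (fderiv ℝ c y y) 1 :=
    HasFDerivAt.comp_hasDerivAt_of_eq (1 : ℝ) hc.hasFDerivAt hline (by simp)
  have h2 : HasDerivAt (fun t : ℝ => t ^ H • c y) (H • c y) 1 := by
    have := (Real.hasDerivAt_rpow_const (x := 1) (p := H) (Or.inl one_ne_zero)).smul_const (c y)
    simpa using this
  -- Euler's relation for a map of degree `H`, from differentiating along the ray at `t = 1`.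
  have h3 : fderiv ℝ c y y = H • c y := by
    refine h1.unique (h2.congr_of_eventuallyEq ?_)
    filter_upwards [eventually_gt_nhds (zero_lt_one (α := ℝ))] with t ht using hhom t ht
  rw [hh.halfHessianSq_self_self hy, h3] at hconf
  rw [hhom _ (inv_pos.2 hpos)] at hunit
  simp only [map_smul, FunLike.coe_smul, Pi.smul_apply, smul_eq_mul] at hunit hconf
  rw [Real.inv_rpow hpos.le] at hunit
  have hp : 0 < h y ^ H := Real.rpow_pos_of_pos hpos H
  rw [Real.rpow_sub hpos, Real.rpow_one]
  -- The unit condition holds at `y / h(y)`; homogeneity transports it back to `y`.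
  have h4 : s (c y) (c y) = (h y ^ H) ^ 2 := by
    field_simp at hunit
    exact hunit
  rw [h4] at hconf
  field_simp
  linarith

end IsConicNorm

end ConicNorm

/-! ### Hypersurfaces of constant curvature -/

section Hypersurface

variable {n : ℕ}

local notation:max "𝔼" n:max => EuclideanSpace ℝ (Fin n)

/-- The integrability conditions for a frame which satisfies a linear total differential system. -/
theorem integrability_of_frame {ι E : Type*} [Fintype ι] [NormedAddCommGroup E]
    [NormedSpace ℝ E] {V : Set (𝔼 n)} (hV : IsOpen V) {m : Fin n → ι → ι → 𝔼 n → ℝ}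
    {X : ι → 𝔼 n → E} {u : 𝔼 n} (hu : u ∈ V)
    (hm : ∀ i p o, DifferentiableAt ℝ (m i p o) u)
    (hX : ∀ o, ContDiffOn ℝ ∞ (X o) V)
    (hd : ∀ u ∈ V, ∀ i o, fderiv ℝ (X o) u (EuclideanSpace.single i 1) = ∑ p, m i p o u • X p u)
    (hli : LinearIndependent ℝ fun o => X o u) (i j : Fin n) (p o : ι) :
    partialDeriv i (m j p o) u - partialDeriv j (m i p o) u
        + ∑ q, m i p q u * m j q o u - ∑ q, m j p q u * m i q o u = 0 := by
  have hXd : ∀ o, DifferentiableAt ℝ (X o) u := fun o =>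
    ((hX o).contDiffAt (hV.mem_nhds hu)).differentiableAt (by simp)
  have key : ∀ i j, fderiv ℝ (fderiv ℝ (X o)) u (EuclideanSpace.single i 1)
      (EuclideanSpace.single j 1) =
      ∑ p, (partialDeriv i (m j p o) u + ∑ q, m i p q u * m j q o u) • X p u := by
    intro i j
    have h1 : DifferentiableAt ℝ (fderiv ℝ (X o)) u :=
      (((hX o).fderiv_of_isOpen hV (m := ∞) (by simp)).contDiffAt
        (hV.mem_nhds hu)).differentiableAt (by simp)
    have h2 : HasFDerivAt (fun u => fderiv ℝ (X o) u (EuclideanSpace.single j 1)) _ u :=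
      (ContinuousLinearMap.apply ℝ E (EuclideanSpace.single j (1 : ℝ))).hasFDerivAt.comp u
        h1.hasFDerivAt
    have h3 : (fun u => fderiv ℝ (X o) u (EuclideanSpace.single j 1)) =ᶠ[𝓝 u]
        fun u => ∑ p, m j p o u • X p u := by
      filter_upwards [hV.mem_nhds hu] with w hw using hd w hw j o
    have h4 : HasFDerivAt (fun u => ∑ p, m j p o u • X p u) _ u :=
      HasFDerivAt.fun_sum fun p _ => (hm j p o).hasFDerivAt.smul (hXd p).hasFDerivAt
    have h5 := congrArg (fun L : 𝔼 n →L[ℝ] E => L (EuclideanSpace.single i 1))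
      (h2.unique (h4.congr_of_eventuallyEq h3))
    simp only [ContinuousLinearMap.comp_apply, ContinuousLinearMap.apply_apply,
      FunLike.coe_sum, Finset.sum_apply, FunLike.coe_add, Pi.add_apply, FunLike.coe_smul,
      Pi.smul_apply, ContinuousLinearMap.smulRight_apply, hd u hu] at h5
    rw [h5, Finset.sum_add_distrib]
    simp only [add_smul, Finset.sum_add_distrib, Finset.sum_smul, Finset.smul_sum, smul_smul]
    rw [add_comm, Finset.sum_comm (f := fun q p => (m j q o u * m i p q u) • X p u)]
    simp only [mul_comm, partialDeriv]
  -- Second derivatives commute, and linear independence of the frame allows comparison of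
  -- coefficients.
  have hsymm : IsSymmSndFDerivAt ℝ (X o) u :=
    ((hX o).contDiffAt (hV.mem_nhds hu)).isSymmSndFDerivAt (by simpa using ENat.LEInfty.out)
  have h0 := hsymm.eq (EuclideanSpace.single i 1) (EuclideanSpace.single j 1)
  rw [key i j, key j i, ← sub_eq_zero, ← Finset.sum_sub_distrib] at h0
  simp only [← sub_smul] at h0
  have := Fintype.linearIndependent_iff.1 hli _ h0 p
  linarith

/-- A dummy real parameter reduces this to the version for families. -/
theorem contDiffOn_christoffel_of_isOpen {γ : 𝔼 n → Matrix (Fin n) (Fin n) ℝ} {V : Set (𝔼 n)}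
    (hV : IsOpen V) (hγ : ∀ i j, ContDiffOn ℝ ∞ (fun u => γ u i j) V)
    (hdet : ∀ u ∈ V, (γ u).det ≠ 0) (k i j : Fin n) :
    ContDiffOn ℝ ∞ (christoffel γ k i j) V := by
  have hO : IsOpen {q : ℝ × 𝔼 n | q.2 ∈ V} := hV.preimage continuous_snd
  have hγ' : ∀ i j, ContDiffOn ℝ ∞ (fun q : ℝ × 𝔼 n => γ q.2 i j) {q : ℝ × 𝔼 n | q.2 ∈ V} :=
    fun i j => (hγ i j).comp contDiff_snd.contDiffOn fun q hq => hq
  have h : ContDiffOn ℝ ∞ (fun q : ℝ × 𝔼 n => christoffel γ k i j q.2)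
      {q : ℝ × 𝔼 n | q.2 ∈ V} :=
    contDiffOn_christoffel (γ := fun _ : ℝ => γ) hO hγ' (fun q hq => hdet q.2 hq) k i j
  have h1 := contDiffOn_snd_of_contDiffOn h 0
  exact h1

/-- The matrix of a positive definite form in linearly independent vectors is invertible. -/
theorem det_ne_zero_of_gram {E : Type*} [AddCommGroup E] [Module ℝ E] {b : E → E → ℝ}
    {g : Matrix (Fin n) (Fin n) ℝ} {L : 𝔼 n →ₗ[ℝ] E} (hL : Function.Injective L)
    (hpos : ∀ x, x ≠ 0 → 0 < b x x)
    (hg : ∀ v, ∑ i, ∑ j, g i j * v i * v j = b (L v) (L v)) : g.det ≠ 0 := by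
  intro h0
  obtain ⟨v, hv, hgv⟩ := Matrix.exists_mulVec_eq_zero_iff.2 h0
  have h1 : ∑ i, ∑ j, g i j * v i * v j = 0 := by
    refine Finset.sum_eq_zero fun i _ => ?_
    have := congrFun hgv i
    simp only [Matrix.mulVec, dotProduct, Pi.zero_apply] at this
    calc ∑ j, g i j * v i * v j = v i * ∑ j, g i j * v j := by
          rw [Finset.mul_sum]
          exact Finset.sum_congr rfl fun j _ => by ring
      _ = 0 := by rw [this, mul_zero]
  have h2 := hg (WithLp.toLp 2 v)
  rw [h1] at h2
  refine (hpos (L (WithLp.toLp 2 v)) fun h => hv ?_).ne h2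
  have : (WithLp.toLp 2 v : 𝔼 n) = 0 := hL (by rw [h, map_zero])
  simpa using this

theorem sum_sum_apply_single {E F : Type*} [NormedAddCommGroup E] [NormedSpace ℝ E]
    [NormedAddCommGroup F] [NormedSpace ℝ F]
    (L : 𝔼 n →L[ℝ] E) (s : E →L[ℝ] E →L[ℝ] F) (v w : 𝔼 n) :
    ∑ i, ∑ j, (v i * w j) • s (L (EuclideanSpace.single i 1)) (L (EuclideanSpace.single j 1)) =
      s (L v) (L w) := by
  conv_rhs => rw [eq_sum_smul_single v, eq_sum_smul_single w]
  simp only [map_sum, map_smul, FunLike.coe_sum, Finset.sum_apply, FunLike.coe_smul,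
    Pi.smul_apply, Finset.smul_sum, smul_smul]
  rw [Finset.sum_comm]
  exact Finset.sum_congr rfl fun i _ => Finset.sum_congr rfl fun j _ => by rw [mul_comm]

/-- The map `ψ` lies on the unit sphere of `s`, so `ψ` and its partial derivatives form a frame of
`E`. Differentiating their scalar products shows that this frame satisfies Gauss' equations. The
integrability conditions of that system say that its connection is flat, which is the curvature
condition by `gaussConnection_flat_iff`. -/
theorem hasConstantCurvatureOn_of_unit {E : Type*} [NormedAddCommGroup E] [NormedSpace ℝ E]
    [FiniteDimensional ℝ E] (hE : Module.finrank ℝ E = n + 1) {V : Set (𝔼 n)} (hV : IsOpen V)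
    {ψ : 𝔼 n → E} (hψ : ContDiffOn ℝ ∞ ψ V) {s : E →L[ℝ] E →L[ℝ] ℝ} (hs : ∀ x y, s x y = s y x)
    (hpos : ∀ x, x ≠ 0 → 0 < s x x) {κ : ℝ} (hκ : 0 < κ) (hunit : ∀ u ∈ V, s (ψ u) (ψ u) = 1)
    {γ : 𝔼 n → Matrix (Fin n) (Fin n) ℝ}
    (hγ : ∀ u ∈ V, ∀ i j, κ * γ u i j =
      s (fderiv ℝ ψ u (EuclideanSpace.single i 1)) (fderiv ℝ ψ u (EuclideanSpace.single j 1)))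
    (himm : ∀ u ∈ V, Function.Injective (fderiv ℝ ψ u)) : HasConstantCurvatureOn γ V κ := by
  have hdψ : ContDiffOn ℝ ∞ (fderiv ℝ ψ) V := hψ.fderiv_of_isOpen hV (by simp)
  let X : Option (Fin n) → 𝔼 n → E := fun o =>
    o.elim ψ fun i u => fderiv ℝ ψ u (EuclideanSpace.single i 1)
  have hX : ∀ o, ContDiffOn ℝ ∞ (X o) V := by
    rintro (_ | i)
    · exact hψ
    · exact hdψ.clm_apply contDiffOn_const
  have hXd : ∀ u ∈ V, ∀ o, HasFDerivAt (X o) (fderiv ℝ (X o) u) u := fun u hu o =>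
    (((hX o).contDiffAt (hV.mem_nhds hu)).differentiableAt (by simp)).hasFDerivAt
  have hγ' : ∀ u ∈ V, ∀ i j, γ u i j = κ⁻¹ * s (X (some i) u) (X (some j) u) := by
    intro u hu i j
    change _ = κ⁻¹ * s (fderiv ℝ ψ u _) (fderiv ℝ ψ u _)
    rw [← hγ u hu, ← mul_assoc, inv_mul_cancel₀ hκ.ne', one_mul]
  have hγs : ∀ i j, ContDiffOn ℝ ∞ (fun u => γ u i j) V := by
    intro i j
    refine ContDiffOn.congr ?_ fun u hu => hγ' u hu i j
    exact contDiffOn_const.mul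
      ((contDiffOn_const.clm_apply (hX (some i))).clm_apply (hX (some j)))
  have hsymm : ∀ u ∈ V, (γ u).IsSymm := by
    intro u hu
    refine Matrix.IsSymm.ext fun i j => ?_
    rw [hγ' u hu, hγ' u hu, hs]
  have hdet : ∀ u ∈ V, (γ u).det ≠ 0 := by
    intro u hu
    refine det_ne_zero_of_gram (b := fun x y => κ⁻¹ * s x y) (L := (fderiv ℝ ψ u).toLinearMap)
      (himm u hu) (fun x hx => mul_pos (inv_pos.2 hκ) (hpos x hx)) fun v => ?_
    change _ = κ⁻¹ * s (fderiv ℝ ψ u v) (fderiv ℝ ψ u v)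
    rw [← sum_sum_apply_single, Finset.mul_sum]
    refine Finset.sum_congr rfl fun i _ => ?_
    rw [Finset.mul_sum]
    refine Finset.sum_congr rfl fun j _ => ?_
    rw [← hγ u hu, smul_eq_mul]
    field_simp
  have hΓ := contDiffOn_christoffel_of_isOpen hV hγs hdet
  -- the derivative of the scalar products of the frame
  have hsd : ∀ u ∈ V, ∀ o p i, fderiv ℝ (fun u => s (X o u) (X p u)) u (EuclideanSpace.single i 1) =
      s (fderiv ℝ (X o) u (EuclideanSpace.single i 1)) (X p u) +
        s (X o u) (fderiv ℝ (X p) u (EuclideanSpace.single i 1)) := by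
    intro u hu o p i
    have h1 : HasFDerivAt (fun u => s (X o u)) (s.comp (fderiv ℝ (X o) u)) u :=
      s.hasFDerivAt.comp u (hXd u hu o)
    have h2 := h1.clm_apply (hXd u hu p)
    rw [h2.fderiv]
    simp [add_comm]
  -- Obtained by differentiating `s(ψ, ψ) = 1`.
  have horth : ∀ u ∈ V, ∀ i, s (X (some i) u) (X none u) = 0 := by
    intro u hu i
    have h1 : (fun u => s (X none u) (X none u)) =ᶠ[𝓝 u] fun _ => 1 := by
      filter_upwards [hV.mem_nhds hu] with w hw using hunit w hw
    have h2 := hsd u hu none none i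
    rw [h1.fderiv_eq, hs (X none u)] at h2
    have h3 : fderiv ℝ (X none) u (EuclideanSpace.single i 1) = X (some i) u := rfl
    rw [h3] at h2
    simp at h2
    linarith
  have hli : ∀ u ∈ V, LinearIndependent ℝ fun o => X o u := by
    intro u hu
    rw [Fintype.linearIndependent_iff]
    intro g hg
    rw [Fintype.sum_option] at hg
    have h1 : ∑ i, g (some i) • X (some i) u = fderiv ℝ ψ u (WithLp.toLp 2 fun i => g (some i)) := by
      conv_rhs => rw [eq_sum_smul_single (WithLp.toLp 2 fun i => g (some i) : 𝔼 n)]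
      simp [X]
    have h2 : g none = 0 := by
      have := congrArg (fun x => s x (X none u)) hg
      simp only [map_add, map_sum, map_smul, FunLike.coe_add, Pi.add_apply, FunLike.coe_smul,
        Pi.smul_apply, FunLike.coe_sum, Finset.sum_apply, horth u hu, map_zero] at this
      simpa [X, hunit u hu] using this
    rw [h2, zero_smul, zero_add, h1] at hg
    have h3 : (WithLp.toLp 2 fun i => g (some i) : 𝔼 n) = 0 := himm u hu (by rw [hg, map_zero])
    rintro (_ | i)
    · exact h2
    · simpa using congrArg (fun x : 𝔼 n => x i) h3
  have hd : ∀ u ∈ V, ∀ i o, fderiv ℝ (X o) u (EuclideanSpace.single i 1) =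
      ∑ p, gaussCoeff γ κ i p o u • X p u := by
    intro u hu i o
    rcases o with _ | j
    · rw [Fintype.sum_option]
      simp [gaussCoeff]
      rfl
    -- both sides have the same products with the frame
    rw [← sub_eq_zero]
    set R := fderiv ℝ (X (some j)) u (EuclideanSpace.single i 1) -
      ∑ p, gaussCoeff γ κ i p (some j) u • X p u with hR
    have hsec : ∀ i j, fderiv ℝ (X (some j)) u (EuclideanSpace.single i 1) =
        fderiv ℝ (fderiv ℝ ψ) u (EuclideanSpace.single i 1) (EuclideanSpace.single j 1) := by
      intro i j
      have h1 : DifferentiableAt ℝ (fderiv ℝ ψ) u :=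
        (hdψ.contDiffAt (hV.mem_nhds hu)).differentiableAt (by simp)
      have h2 : HasFDerivAt (X (some j)) _ u :=
        (ContinuousLinearMap.apply ℝ E (EuclideanSpace.single j (1 : ℝ))).hasFDerivAt.comp u
          h1.hasFDerivAt
      rw [h2.fderiv]
      rfl
    have hsec' : ∀ i j, fderiv ℝ (X (some j)) u (EuclideanSpace.single i 1) =
        fderiv ℝ (X (some i)) u (EuclideanSpace.single j 1) := by
      intro i j
      rw [hsec, hsec]
      exact ((hψ.contDiffAt (hV.mem_nhds hu)).isSymmSndFDerivAt
        (by simpa using ENat.LEInfty.out)).eq _ _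
    have hγd : ∀ l i j, κ * partialDeriv l (fun u => γ u i j) u =
        s (fderiv ℝ (X (some i)) u (EuclideanSpace.single l 1)) (X (some j) u) +
        s (X (some i) u) (fderiv ℝ (X (some j)) u (EuclideanSpace.single l 1)) := by
      intro l i j
      rw [← hsd u hu]
      have h1 : (fun u => s (X (some i) u) (X (some j) u)) =ᶠ[𝓝 u] fun u => κ * γ u i j := by
        filter_upwards [hV.mem_nhds hu] with w hw using (hγ w hw i j).symm
      have h2 : DifferentiableAt ℝ (fun u => γ u i j) u :=
        ((hγs i j).contDiffAt (hV.mem_nhds hu)).differentiableAt (by simp)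
      rw [h1.fderiv_eq, (h2.hasFDerivAt.const_mul κ).fderiv]
      simp [partialDeriv]
    have hRX : ∀ o, s R (X o u) = 0 := by
      intro o
      simp only [hR, map_sub, map_sum, map_smul, FunLike.coe_sub, Pi.sub_apply, FunLike.coe_sum,
        Finset.sum_apply, FunLike.coe_smul, Pi.smul_apply, Fintype.sum_option, smul_eq_mul,
        map_add, FunLike.coe_add, Pi.add_apply]
      rcases o with _ | l
      -- Differentiating the orthogonality of `ψ` and `∂ⱼψ` produces the normal coefficient `-κ
      -- γᵢⱼ`.
      · have h1 : (fun u => s (X (some j) u) (X none u)) =ᶠ[𝓝 u] fun _ => 0 := by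
          filter_upwards [hV.mem_nhds hu] with w hw using horth w hw j
        have h2 := hsd u hu (some j) none i
        rw [h1.fderiv_eq] at h2
        have h3 : s (X (some j) u) (fderiv ℝ (X none) u (EuclideanSpace.single i 1)) =
            κ * γ u i j := by rw [hγ u hu, hs]; rfl
        rw [h3] at h2
        have h4 : s (X none u) (X none u) = 1 := hunit u hu
        simp only [horth u hu, h4, gaussCoeff, mul_zero, Finset.sum_const_zero]
        simp at h2
        linarith
      · have h1 := sum_metric_mul_christoffel (hdet u hu) i j l
        have h2 : ∑ m, christoffel γ m i j u * s (X (some m) u) (X (some l) u) =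
            κ * ∑ m, γ u l m * christoffel γ m i j u := by
          rw [Finset.mul_sum]
          refine Finset.sum_congr rfl fun m _ => ?_
          rw [hs, ← mul_assoc, hγ u hu, mul_comm]
          rfl
        simp only [gaussCoeff, hs (X none u), horth u hu, h2, h1]
        -- Koszul's computation: the three cyclic derivatives of the metric, combined with `∂ᵢ∂ⱼψ =
        -- ∂ⱼ∂ᵢψ`, isolate the tangential part of `∂ᵢ∂ⱼψ`.
        have e1 := hγd i j l
        have e2 := hγd j i l
        have e3 := hγd l i j
        rw [hsec' j i] at e2
        rw [hsec' l i, hsec' l j] at e3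
        rw [hs (X (some j) u)] at e1
        rw [hs (X (some i) u)] at e2 e3
        have e4 := hs (X (some j) u) (fderiv ℝ (X (some l)) u (EuclideanSpace.single i 1))
        have e5 := hs (X (some j) u) (fderiv ℝ (X (some i)) u (EuclideanSpace.single l 1))
        linarith
    have hspan : R ∈ Submodule.span ℝ (Set.range fun o => X o u) := by
      rw [(hli u hu).span_eq_top_of_card_eq_finrank' (by simp [hE])]
      exact Submodule.mem_top
    have hRR : ∀ x ∈ Submodule.span ℝ (Set.range fun o => X o u), s R x = 0 := by
      intro x hx
      induction hx using Submodule.span_induction with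
      | mem x hx => obtain ⟨o, rfl⟩ := hx; exact hRX o
      | zero => simp
      | add x y _ _ hx hy => rw [map_add, hx, hy, add_zero]
      | smul c x _ hx => rw [map_smul, hx, smul_zero]
    -- The defect `R` lies in the span of the frame and is orthogonal to it, so `s R R = 0`.
    by_contra hne
    exact (hpos R hne).ne' (hRR R hspan)
  intro u hu
  have hΓd : ∀ k i j, DifferentiableAt ℝ (christoffel γ k i j) u := fun k i j =>
    ((hΓ k i j).contDiffAt (hV.mem_nhds hu)).differentiableAt (by simp)
  have hγd : ∀ i j, DifferentiableAt ℝ (fun u => γ u i j) u := fun i j =>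
    ((hγs i j).contDiffAt (hV.mem_nhds hu)).differentiableAt (by simp)
  have hsy : ∀ᶠ w in 𝓝 u, (γ w).IsSymm := by
    filter_upwards [hV.mem_nhds hu] with w hw using hsymm w hw
  rw [← gaussConnection_flat_iff hγd hΓd (hdet u hu) hsy,
    matrixConnection_flat_iff (differentiableAt_gaussCoeff hγd hΓd)]
  exact integrability_of_frame hV hu (differentiableAt_gaussCoeff hγd hΓd) hX hd (hli u hu)

end Hypersurface

/-! ### The unit hypersurface of a conic norm -/

section UnitParam

variable {N n : ℕ}

local notation:max "𝔼" n:max => EuclideanSpace ℝ (Fin n)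

/-- A local parametrization of the hypersurface `h = 1` in `D`. -/
structure IsUnitParam (D : Set (𝔼 N)) (h : 𝔼 N → ℝ) (V : Set (𝔼 n)) (φ : 𝔼 n → 𝔼 N) : Prop where
  isOpen : IsOpen V
  smooth : ContDiffOn ℝ ∞ φ V
  mem : ∀ u ∈ V, φ u ∈ D
  unit : ∀ u ∈ V, h (φ u) = 1
  immersion : ∀ u ∈ V, Function.Injective (fderiv ℝ φ u)

/-- The metric induced on a parametrized hypersurface. -/
def fiberMetric (h : 𝔼 N → ℝ) (φ : 𝔼 n → 𝔼 N) (u : 𝔼 n) : Matrix (Fin n) (Fin n) ℝ :=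
  Matrix.of fun i j => halfHessianSq h (φ u)
    (fderiv ℝ φ u (EuclideanSpace.single i 1)) (fderiv ℝ φ u (EuclideanSpace.single j 1))

/-- The hypersurface `h = 1` in `D` has constant curvature `K`. -/
def HasUnitCurvature (n : ℕ) (D : Set (𝔼 N)) (h : 𝔼 N → ℝ) (K : ℝ) : Prop :=
  ∀ (V : Set (𝔼 n)) (φ : 𝔼 n → 𝔼 N), IsUnitParam D h V φ →
    HasConstantCurvatureOn (fiberMetric h φ) V K

/-- The form `½ ∂²h² / ∂y∂y`. -/
def hessForm (h : 𝔼 N → ℝ) (y : 𝔼 N) : 𝔼 N →L[ℝ] 𝔼 N →L[ℝ] ℝ :=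
  (1 / 2 : ℝ) • fderiv ℝ (fderiv ℝ fun w => h w ^ 2) y

variable {D : Set (𝔼 N)} {h : 𝔼 N → ℝ}

theorem IsConicNorm.halfHessianSq_eq_hessForm (hh : IsConicNorm D h) {y : 𝔼 N} (hy : y ∈ D)
    (ξ η : 𝔼 N) : halfHessianSq h y ξ η = hessForm h y ξ η := by
  rw [hh.halfHessianSq_symm hy, hh.halfHessianSq_apply hy]
  rfl

variable {V : Set (𝔼 n)} {φ : 𝔼 n → 𝔼 N}

theorem fiberMetric_sum (hh : IsConicNorm D h) (hφ : IsUnitParam D h V φ) {u : 𝔼 n} (hu : u ∈ V)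
    (v w : 𝔼 n) : ∑ i, ∑ j, v i * w j * fiberMetric h φ u i j =
      halfHessianSq h (φ u) (fderiv ℝ φ u v) (fderiv ℝ φ u w) := by
  rw [hh.halfHessianSq_eq_hessForm (hφ.mem u hu), ← sum_sum_apply_single]
  refine Finset.sum_congr rfl fun i _ => Finset.sum_congr rfl fun j _ => ?_
  rw [← hh.halfHessianSq_eq_hessForm (hφ.mem u hu)]
  rfl

theorem fiberMetric_isSymm (hh : IsConicNorm D h) (hφ : IsUnitParam D h V φ) {u : 𝔼 n}
    (hu : u ∈ V) : (fiberMetric h φ u).IsSymm :=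
  Matrix.IsSymm.ext fun _ _ => hh.halfHessianSq_symm (hφ.mem u hu) _ _

theorem fiberMetric_det_ne_zero (hh : IsConicNorm D h) (hφ : IsUnitParam D h V φ) {u : 𝔼 n}
    (hu : u ∈ V) : (fiberMetric h φ u).det ≠ 0 := by
  refine det_ne_zero_of_gram (b := halfHessianSq h (φ u)) (L := (fderiv ℝ φ u).toLinearMap)
    (hφ.immersion u hu) (hh.posDef _ (hφ.mem u hu)) fun v => ?_
  refine Eq.trans ?_ (fiberMetric_sum hh hφ hu v v)
  exact Finset.sum_congr rfl fun i _ => Finset.sum_congr rfl fun j _ => by ring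

theorem fiberMetric_diag_pos (hh : IsConicNorm D h) (hφ : IsUnitParam D h V φ) {u : 𝔼 n}
    (hu : u ∈ V) (i : Fin n) : 0 < fiberMetric h φ u i i := by
  refine hh.posDef _ (hφ.mem u hu) _ fun h0 => ?_
  have := hφ.immersion u hu (h0.trans (map_zero _).symm)
  simpa using congrArg (fun x : 𝔼 n => x i) this

theorem fderiv_norm_comp_param (hh : IsConicNorm D h) (hφ : IsUnitParam D h V φ) {u : 𝔼 n}
    (hu : u ∈ V) (v : 𝔼 n) : fderiv ℝ h (φ u) (fderiv ℝ φ u v) = 0 := by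
  have h1 : HasFDerivAt φ (fderiv ℝ φ u) u :=
    ((hφ.smooth.contDiffAt (hφ.isOpen.mem_nhds hu)).differentiableAt (by simp)).hasFDerivAt
  have h2 := (hh.differentiableAt (hφ.mem u hu)).hasFDerivAt.comp u h1
  have h3 : h ∘ φ =ᶠ[𝓝 u] fun _ => 1 := by
    filter_upwards [hφ.isOpen.mem_nhds hu] with w hw using hφ.unit w hw
  have h4 := h2.unique ((hasFDerivAt_const (1 : ℝ) u).congr_of_eventuallyEq h3)
  exact congrArg (fun L : 𝔼 n →L[ℝ] ℝ => L v) h4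

/-- The curvature of the unit hypersurface of a norm with a homogeneous conformal map. -/
theorem hasUnitCurvature_of_conformal (hh : IsConicNorm D h) (hN : N = n + 1)
    {s : 𝔼 N →L[ℝ] 𝔼 N →L[ℝ] ℝ} (hs : ∀ x y, s x y = s y x) (hpos : ∀ x, x ≠ 0 → 0 < s x x)
    {H : ℝ} (hH : 0 < H)
    (hloc : ∀ y ∈ D, ∃ (W : Set (𝔼 N)) (c : 𝔼 N → 𝔼 N) (q : 𝔼 N → ℝ), IsOpen W ∧ y ∈ W ∧ W ⊆ D ∧
      ContDiffOn ℝ ∞ c W ∧ (∀ w ∈ W, ∀ k : ℝ, 0 < k → c (k • w) = (k ^ H) • c w) ∧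
      (∀ w ∈ W, h w = 1 → s (c w) (c w) = 1) ∧
      ∀ w ∈ W, ∀ ξ η, halfHessianSq h w ξ η = q w * s (fderiv ℝ c w ξ) (fderiv ℝ c w η)) :
    HasUnitCurvature n D h (H ^ 2) := by
  intro V φ hφ u hu
  obtain ⟨W, c, q, hW, hyW, hWD, hc, hhom, hunit, hconf⟩ := hloc _ (hφ.mem u hu)
  -- The curvature condition is checked point by point, so the part of the chart on which `c` is
  -- available is enough.
  have hV' : IsOpen (V ∩ φ ⁻¹' W) := hφ.smooth.continuousOn.isOpen_inter_preimage hφ.isOpen hW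
  have hcd : ∀ w ∈ W, HasFDerivAt c (fderiv ℝ c w) w := fun w hw =>
    ((hc.contDiffAt (hW.mem_nhds hw)).differentiableAt (by simp)).hasFDerivAt
  -- On the unit hypersurface the multiplier is constant, so `c ∘ φ` is a homothety into the unit
  -- sphere.
  have hq : ∀ w ∈ W, h w = 1 → q w = (H ^ 2)⁻¹ := by
    intro w hw hw1
    have := hh.multiplier_eq (hWD hw) (s := s) hH (hcd w hw).differentiableAt (hhom w hw)
      (by rw [hw1]; simpa using hunit w hw hw1) (hconf w hw w w)
    rw [this, hw1, Real.one_rpow]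
    field_simp
  have hψd : ∀ u ∈ V ∩ φ ⁻¹' W,
      fderiv ℝ (c ∘ φ) u = (fderiv ℝ c (φ u)).comp (fderiv ℝ φ u) := by
    rintro u ⟨hu, huW⟩
    have h1 : HasFDerivAt φ (fderiv ℝ φ u) u :=
      ((hφ.smooth.contDiffAt (hφ.isOpen.mem_nhds hu)).differentiableAt (by simp)).hasFDerivAt
    exact ((hcd _ huW).comp u h1).fderiv
  refine hasConstantCurvatureOn_of_unit (E := 𝔼 N) (ψ := c ∘ φ) (by simp [hN]) hV'
    (hc.comp (hφ.smooth.mono inter_subset_left) fun u hu => hu.2) hs hpos (pow_pos hH 2)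
    (fun u hu => hunit _ hu.2 (hφ.unit u hu.1)) ?_ ?_ u ⟨hu, hyW⟩
  · intro u hu i j
    rw [hψd u hu]
    have := hconf _ hu.2 (fderiv ℝ φ u (EuclideanSpace.single i 1))
      (fderiv ℝ φ u (EuclideanSpace.single j 1))
    rw [hq _ hu.2 (hφ.unit u hu.1)] at this
    change H ^ 2 * halfHessianSq h (φ u) _ _ = _
    rw [this]
    field_simp
    rfl
  · intro u hu
    rw [hψd u hu]
    refine (injective_iff_map_eq_zero _).2 fun v hv => ?_
    have h1 := hconf _ hu.2 (fderiv ℝ φ u v) (fderiv ℝ φ u v)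
    have h2 : fderiv ℝ c (φ u) (fderiv ℝ φ u v) = 0 := hv
    rw [h2, map_zero, mul_zero] at h1
    by_contra hne
    refine (hh.posDef _ (hWD hu.2) _ fun h0 => hne ?_).ne' h1
    exact hφ.immersion u hu.1 (h0.trans (map_zero _).symm)

/-! ### Radial parametrizations -/

/-- A nonzero vector can be split off. -/
theorem exists_splitting (hN : N = n + 1) {y₀ : 𝔼 N} (hy₀ : y₀ ≠ 0) :
    ∃ (L : 𝔼 n →L[ℝ] 𝔼 N) (l : 𝔼 N →L[ℝ] ℝ) (Q : 𝔼 N →L[ℝ] 𝔼 n), l y₀ = 1 ∧ (∀ u, l (L u) = 0) ∧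
      Q y₀ = 0 ∧ (∀ u, Q (L u) = u) ∧ ∀ y, y = l y • y₀ + L (Q y) := by
  let e : (ℝ × 𝔼 n) ≃L[ℝ] 𝔼 N := ContinuousLinearEquiv.ofFinrankEq (by simp [hN, add_comm])
  have hx : e (1, 0) ≠ 0 := by
    intro h0
    have : ((1, 0) : ℝ × 𝔼 n) = 0 := e.injective (h0.trans (map_zero e).symm)
    simpa using congrArg Prod.fst this
  obtain ⟨A, hA⟩ := SeparatingDual.exists_continuousLinearEquiv_apply_eq (R := ℝ) hx hy₀
  let e' := e.trans A
  have he' : e' (1, 0) = y₀ := hA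
  have hes : e'.symm y₀ = (1, 0) := by rw [← he', e'.symm_apply_apply]
  refine ⟨e'.toContinuousLinearMap.comp (ContinuousLinearMap.inr ℝ ℝ (𝔼 n)),
    (ContinuousLinearMap.fst ℝ ℝ (𝔼 n)).comp e'.symm.toContinuousLinearMap,
    (ContinuousLinearMap.snd ℝ ℝ (𝔼 n)).comp e'.symm.toContinuousLinearMap, ?_, ?_, ?_, ?_, ?_⟩
  · simp [hes]
  · simp
  · simp [hes]
  · simp
  · intro y
    apply e'.symm.injective
    simp [hes]

/-- The radial projection of the affine hyperplane `y₀ + L u` to the hypersurface `h = 1`. -/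
def radialParam (h : 𝔼 N → ℝ) (y₀ : 𝔼 N) (L : 𝔼 n →L[ℝ] 𝔼 N) (u : 𝔼 n) : 𝔼 N :=
  (h (y₀ + L u))⁻¹ • (y₀ + L u)

/-- For the immersion property, differentiate `h(y₀ + L u) φ(u) = y₀ + L u`. If `dφ(v) = 0`, then `L
v` is a multiple of `φ(u)`; as `l` vanishes on the range of `L` but not at `φ(u)`, the multiple is
zero and `L v = 0`. -/
theorem isUnitParam_radialParam (hh : IsConicNorm D h) {y₀ : 𝔼 N} {L : 𝔼 n →L[ℝ] 𝔼 N}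
    {l : 𝔼 N →L[ℝ] ℝ} {Q : 𝔼 N →L[ℝ] 𝔼 n} (hl : l y₀ = 1) (hlL : ∀ u, l (L u) = 0)
    (hQL : ∀ u, Q (L u) = u) :
    IsUnitParam D h {u | y₀ + L u ∈ D} (radialParam h y₀ L) := by
  have haff : ContDiff ℝ ∞ fun u : 𝔼 n => y₀ + L u := by fun_prop
  have hV : IsOpen {u | y₀ + L u ∈ D} := hh.isOpen.preimage haff.continuous
  have hcomp : ContDiffOn ℝ ∞ (fun u => h (y₀ + L u)) {u | y₀ + L u ∈ D} :=
    hh.smooth.comp haff.contDiffOn fun _ hu => hu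
  have hsm : ContDiffOn ℝ ∞ (radialParam h y₀ L) {u | y₀ + L u ∈ D} :=
    (hcomp.inv fun u hu => (hh.pos _ hu).ne').smul haff.contDiffOn
  refine ⟨hV, hsm, fun u hu => hh.inv_smul_mem hu, fun u hu => hh.apply_inv_smul hu,
    fun u hu => ?_⟩
  have h1 : HasFDerivAt (radialParam h y₀ L) (fderiv ℝ (radialParam h y₀ L) u) u :=
    ((hsm.contDiffAt (hV.mem_nhds hu)).differentiableAt (by simp)).hasFDerivAt
  have h2 : HasFDerivAt (fun u => h (y₀ + L u)) (fderiv ℝ (fun u => h (y₀ + L u)) u) u :=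
    ((hcomp.contDiffAt (hV.mem_nhds hu)).differentiableAt (by simp)).hasFDerivAt
  have h3 := h2.fun_smul h1
  have h4 : (fun u => h (y₀ + L u) • radialParam h y₀ L u) =ᶠ[𝓝 u] fun u => y₀ + L u := by
    filter_upwards [hV.mem_nhds hu] with w hw
    rw [radialParam, smul_smul, mul_inv_cancel₀ (hh.pos _ hw).ne', one_smul]
  have h5 : HasFDerivAt (fun u => y₀ + L u) L u := L.hasFDerivAt.const_add y₀
  have h6 := h3.unique (h5.congr_of_eventuallyEq h4)
  refine (injective_iff_map_eq_zero _).2 fun v hv => ?_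
  have h7 := congrArg (fun T : 𝔼 n →L[ℝ] 𝔼 N => T v) h6
  simp only [FunLike.coe_add, Pi.add_apply, FunLike.coe_smul, Pi.smul_apply, hv, smul_zero,
    zero_add, ContinuousLinearMap.smulRight_apply] at h7
  have h8 := congrArg l h7
  simp only [map_smul, radialParam, map_add, hl, hlL, add_zero, smul_eq_mul, mul_one] at h8
  have h9 : fderiv ℝ (fun u => h (y₀ + L u)) u v = 0 := by
    rcases mul_eq_zero.1 h8 with h | h
    · exact h
    · exact absurd h (inv_pos.2 (hh.pos _ hu)).ne'
  rw [h9, zero_smul] at h7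
  rw [← hQL v, ← h7, map_zero]

/-- One component with two distinct indices isolates `K`, since the diagonal entries of the metric
are positive. Both the uniqueness of `K` and its smooth dependence on the base point come from this,
and both need dimension at least two. -/
theorem unitCurvature_mul {K : ℝ} (hK : HasUnitCurvature n D h K) (hφ : IsUnitParam D h V φ)
    {u : 𝔼 n} (hu : u ∈ V) {i j : Fin n} (hij : i ≠ j) :
    riemannTensor (fiberMetric h φ) i j i j u = K * fiberMetric h φ u j j := by
  rw [hK V φ hφ u hu i j i j]
  simp [hij]

theorem HasUnitCurvature.unique (hh : IsConicNorm D h) (hN : N = n + 1) (hn : 2 ≤ n)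
    (hD : D.Nonempty) {K K' : ℝ} (hK : HasUnitCurvature n D h K)
    (hK' : HasUnitCurvature n D h K') : K = K' := by
  obtain ⟨y₀, hy₀⟩ := hD
  obtain ⟨L, l, Q, hl, hlL, -, hQL, -⟩ := exists_splitting hN (hh.ne_zero y₀ hy₀)
  have hφ := isUnitParam_radialParam hh hl hlL hQL
  have h0 : (0 : 𝔼 n) ∈ {u | y₀ + L u ∈ D} := by simpa using hy₀
  have hij : (⟨0, by omega⟩ : Fin n) ≠ ⟨1, by omega⟩ := by simp
  have h1 := unitCurvature_mul hK hφ h0 hij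
  rw [unitCurvature_mul hK' hφ h0 hij] at h1
  exact (mul_right_cancel₀ (fiberMetric_diag_pos hh hφ h0 _).ne' h1).symm

end UnitParam

/-! ### Inverse frames and parallel forms -/

section InverseFrame

variable {P U 𝔸 : Type*} [NormedAddCommGroup P] [NormedSpace ℝ P] [FiniteDimensional ℝ P]
  [NormedAddCommGroup U] [NormedSpace ℝ U] [FiniteDimensional ℝ U]
  [NormedRing 𝔸] [NormedAlgebra ℝ 𝔸] [CompleteSpace 𝔸]

/-- A flat connection form depending smoothly on parameters has an invertible parallel frame
depending smoothly on the parameters. -/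
theorem exists_invertible_parallel_frame {A : P × U → U →L[ℝ] 𝔸} {O : Set (P × U)} (hO : IsOpen O)
    (hA : ContDiffOn ℝ ∞ A O) {p₀ : P} (hp₀ : (p₀, 0) ∈ O)
    (hflat : ∀ p u, (p, u) ∈ O → ∀ v w, connectionCurvature (fun u => A (p, u)) u v w = 0) :
    ∃ (Z Y : P × U → 𝔸) (r : ℝ), 0 < r ∧ Metric.ball p₀ r ×ˢ Metric.ball 0 r ⊆ O ∧
      ContDiffOn ℝ ∞ Z (Metric.ball p₀ r ×ˢ Metric.ball 0 r) ∧
      (∀ p ∈ Metric.ball p₀ r, Z (p, 0) = 1 ∧ Y (p, 0) = 1) ∧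
      ∀ p ∈ Metric.ball p₀ r, ∀ u ∈ Metric.ball (0 : U) r, Y (p, u) * Z (p, u) = 1 ∧
        HasFDerivAt (fun u => Z (p, u)) ((ContinuousLinearMap.mul ℝ 𝔸 (Z (p, u))).comp (A (p, u)))
          u ∧
        HasFDerivAt (fun u => Y (p, u))
          (-(((ContinuousLinearMap.mul ℝ 𝔸).flip (Y (p, u))).comp (A (p, u)))) u := by
  obtain ⟨Z, r, hr, hrO, hZ, hZ0, hZd⟩ := exists_parallel_frame hO hA hp₀ hflat
  have hball : IsOpen (Metric.ball p₀ r ×ˢ Metric.ball (0 : U) r) :=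
    Metric.isOpen_ball.prod Metric.isOpen_ball
  have hmem : (p₀, (0 : U)) ∈ Metric.ball p₀ r ×ˢ Metric.ball (0 : U) r := by simp [hr]
  -- Units form an open set and `Z = 1` at the centre, so shrinking the radius makes `Z` invertible.
  have hu : {q | IsUnit (Z q)} ∈ 𝓝 (p₀, (0 : U)) := by
    refine (hZ.contDiffAt (hball.mem_nhds hmem)).continuousAt.preimage_mem_nhds
      (Units.isOpen.mem_nhds ?_)
    change IsUnit (Z (p₀, 0))
    rw [hZ0 _ hmem.1]
    exact isUnit_one
  obtain ⟨t, ht, htball⟩ := Metric.mem_nhds_iff.1 hu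
  rw [← ball_prod_same] at htball
  have hr' : 0 < min r t := lt_min hr ht
  have h1 : Metric.ball p₀ (min r t) ⊆ Metric.ball p₀ r := Metric.ball_subset_ball (min_le_left _ _)
  have h2 : Metric.ball (0 : U) (min r t) ⊆ Metric.ball 0 r :=
    Metric.ball_subset_ball (min_le_left _ _)
  refine ⟨Z, fun q => Ring.inverse (Z q), min r t, hr', (prod_mono h1 h2).trans hrO,
    hZ.mono (prod_mono h1 h2), fun p hp => ?_, fun p hp u hu => ?_⟩
  · simp [hZ0 p (h1 hp)]
  · have hunit : IsUnit (Z (p, u)) := htball ⟨Metric.ball_subset_ball (min_le_right _ _) hp,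
      Metric.ball_subset_ball (min_le_right _ _) hu⟩
    refine ⟨Ring.inverse_mul_cancel _ hunit, hZd p (h1 hp) u (h2 hu), ?_⟩
    obtain ⟨x, hx⟩ := hunit
    -- The derivative of the inverse is `-Z⁻¹ (Z A) Z⁻¹ = -A Z⁻¹`.
    have h3 : HasFDerivAt Ring.inverse _ (Z (p, u)) := hx ▸ hasFDerivAt_ringInverse (𝕜 := ℝ) x
    refine (h3.comp u (hZd p (h1 hp) u (h2 hu))).congr_fderiv ?_
    ext w
    simp [← hx]

/-- A flat connection has an invertible parallel frame depending smoothly on the parameters. -/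
theorem exists_invertible_parallel_frame_apply {G : Type*} [NormedAddCommGroup G] [NormedSpace ℝ G]
    [CompleteSpace G] {A : P × U → U →L[ℝ] G →L[ℝ] G} {O : Set (P × U)}
    (hO : IsOpen O) (hA : ContDiffOn ℝ ∞ A O) {p₀ : P} (hp₀ : (p₀, 0) ∈ O)
    (hflat : ∀ p u, (p, u) ∈ O → ∀ v w, connectionCurvature (fun u => A (p, u)) u v w = 0) :
    ∃ (Z Y : P × U → G →L[ℝ] G) (r : ℝ), 0 < r ∧ Metric.ball p₀ r ×ˢ Metric.ball 0 r ⊆ O ∧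
      ContDiffOn ℝ ∞ Z (Metric.ball p₀ r ×ˢ Metric.ball 0 r) ∧
      (∀ p ∈ Metric.ball p₀ r, ∀ x, Z (p, 0) x = x ∧ Y (p, 0) x = x) ∧
      ∀ p ∈ Metric.ball p₀ r, ∀ u ∈ Metric.ball (0 : U) r, ∀ x, Y (p, u) (Z (p, u) x) = x ∧
        HasFDerivAt (fun u => Z (p, u) x) ((Z (p, u)).comp ((A (p, u)).flip x)) u ∧
        HasFDerivAt (fun u => Y (p, u) x) (-((A (p, u)).flip (Y (p, u) x))) u := by
  obtain ⟨Z, Y, r, hr, hrO, hZ, h0, h⟩ := exists_invertible_parallel_frame hO hA hp₀ hflat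
  refine ⟨Z, Y, r, hr, hrO, hZ, fun p hp x => ?_, fun p hp u hu x => ?_⟩
  · rw [(h0 p hp).1, (h0 p hp).2]
    exact ⟨rfl, rfl⟩
  · obtain ⟨h1, h2, h3⟩ := h p hp u hu
    refine ⟨congrArg (fun T : G →L[ℝ] G => T x) h1, ?_, ?_⟩
    · have := (ContinuousLinearMap.apply ℝ G x).hasFDerivAt.comp u h2
      exact this.congr_fderiv (by ext v; simp)
    · have := (ContinuousLinearMap.apply ℝ G x).hasFDerivAt.comp u h3
      exact this.congr_fderiv (by ext v; simp)

end InverseFrame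

/-! ### Invariance of the form `ds² + κ γ` under parallel transport -/

section Gauss

variable {n : ℕ}

local notation:max "𝔼" n:max => EuclideanSpace ℝ (Fin n)

/-- A bilinear form in the components of which satisfy the equation of parallel forms is invariant
under a parallel frame. -/
theorem fderiv_parallel_form {ι : Type*} [Fintype ι] [DecidableEq ι]
    {m b : ι → ι → ℝ} {b' : ι → ι → ℝ} {x y x' y' : ι → ℝ}
    (hb : ∀ a c, b' a c = ∑ q, m q a * b q c + ∑ q, m q c * b a q)
    (hx : ∀ a, x' a = -∑ c, m a c * x c) (hy : ∀ a, y' a = -∑ c, m a c * y c) :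
    ∑ a, ∑ c, (b' a c * x a * y c + b a c * x' a * y c + b a c * x a * y' c) = 0 := by
  simp only [Finset.sum_add_distrib, hb, hx, hy, add_mul, Finset.sum_mul, mul_neg, neg_mul,
    Finset.sum_neg_distrib, Finset.mul_sum]
  have e1 : ∑ a, ∑ c, ∑ q, m q a * b q c * x a * y c =
      ∑ a, ∑ c, ∑ q, b a c * (m a q * x q) * y c := by
    rw [Finset.sum_comm]
    rw [Finset.sum_comm (f := fun a c => ∑ q, b a c * (m a q * x q) * y c)]
    refine Finset.sum_congr rfl fun c _ => ?_
    rw [Finset.sum_comm]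
    exact Finset.sum_congr rfl fun a _ => Finset.sum_congr rfl fun q _ => by ring
  have e2 : ∑ a, ∑ c, ∑ q, m q c * b a q * x a * y c =
      ∑ a, ∑ c, ∑ q, b a c * x a * (m c q * y q) := by
    refine Finset.sum_congr rfl fun a _ => ?_
    rw [Finset.sum_comm]
    exact Finset.sum_congr rfl fun c _ => Finset.sum_congr rfl fun q _ => by ring
  rw [e1, e2]
  ring

/-- The components of the form `ds² + κ γ`. -/
def gaussForm (γ : 𝔼 n → Matrix (Fin n) (Fin n) ℝ) (κ : ℝ) :
    Option (Fin n) → Option (Fin n) → 𝔼 n → ℝ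
  | none, none => fun _ => 1
  | some _, none => fun _ => 0
  | none, some _ => fun _ => 0
  | some i, some j => fun u => κ * γ u i j

variable {γ : 𝔼 n → Matrix (Fin n) (Fin n) ℝ} {κ : ℝ} {u : 𝔼 n}

theorem differentiableAt_gaussForm (hγ : ∀ i j, DifferentiableAt ℝ (fun w => γ w i j) u)
    (a b : Option (Fin n)) : DifferentiableAt ℝ (gaussForm γ κ a b) u := by
  rcases a with _ | i <;> rcases b with _ | j
  · exact differentiableAt_const _
  · exact differentiableAt_const _
  · exact differentiableAt_const _
  · exact (hγ i j).const_mul _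

/-- Covariant constancy of `ds² + κ γ`. In the mixed components the terms `κ γ` and `-κ γ` cancel;
the tangential components are metric compatibility, `partialDeriv_metric`. -/
theorem partialDeriv_gaussForm (hγ : ∀ i j, DifferentiableAt ℝ (fun w => γ w i j) u)
    (hdet : (γ u).det ≠ 0) (hsymm : ∀ᶠ w in 𝓝 u, (γ w).IsSymm) (i : Fin n)
    (a c : Option (Fin n)) : partialDeriv i (gaussForm γ κ a c) u =
      ∑ q, gaussCoeff γ κ i q a u * gaussForm γ κ q c u +
        ∑ q, gaussCoeff γ κ i q c u * gaussForm γ κ a q u := by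
  have hc : ∀ c : ℝ, partialDeriv i (fun _ => c) u = 0 := fun c => by simp [partialDeriv]
  have hs : ∀ i j, γ u i j = γ u j i := fun i j => hsymm.self_of_nhds.apply j i
  rcases a with _ | j <;> rcases c with _ | k <;>
    simp only [gaussForm, gaussCoeff, hc, Fintype.sum_option]
  · simp
  · simp
  · simp [hs j i]
  · have h1 : partialDeriv i (fun u => κ * γ u j k) u = κ * partialDeriv i (fun u => γ u j k) u := by
      unfold partialDeriv
      rw [((hγ j k).hasFDerivAt.const_mul κ).fderiv]
      simp
    rw [h1, partialDeriv_metric hdet hsymm, mul_zero, mul_zero, zero_add, zero_add, mul_add,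
      Finset.mul_sum, Finset.mul_sum]
    congr 1
    · exact Finset.sum_congr rfl fun m _ => by rw [hs k m]; ring
    · exact Finset.sum_congr rfl fun m _ => by ring

/-- The value of the form `ds² + κ γ`. -/
def gaussFormAt (γ : 𝔼 n → Matrix (Fin n) (Fin n) ℝ) (κ : ℝ) (u : 𝔼 n)
    (x y : EuclideanSpace ℝ (Option (Fin n))) : ℝ :=
  ∑ a, ∑ c, gaussForm γ κ a c u * x a * y c

theorem gaussFormAt_eq (x y : EuclideanSpace ℝ (Option (Fin n))) : gaussFormAt γ κ u x y =
    x none * y none + κ * ∑ i, ∑ j, x (some i) * y (some j) * γ u i j := by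
  simp only [gaussFormAt, Fintype.sum_option, gaussForm, one_mul, zero_mul, Finset.sum_const_zero,
    add_zero, zero_add, Finset.mul_sum]
  congr 1
  exact Finset.sum_congr rfl fun i _ => Finset.sum_congr rfl fun j _ => by ring

/-- The form `ds² + κ γ` is invariant under a parallel frame of the connection of Gauss'
equations. -/
theorem gaussFormAt_parallel {V : Set (𝔼 n)} (hV : IsOpen V) (hconv : Convex ℝ V)
    (h0 : 0 ∈ V) (hγ : ∀ u ∈ V, ∀ i j, DifferentiableAt ℝ (fun w => γ w i j) u)
    (hdet : ∀ u ∈ V, (γ u).det ≠ 0) (hsymm : ∀ u ∈ V, (γ u).IsSymm)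
    {Y : 𝔼 n → EuclideanSpace ℝ (Option (Fin n)) →L[ℝ] EuclideanSpace ℝ (Option (Fin n))}
    (hY0 : ∀ x, Y 0 x = x) (hY : ∀ u ∈ V, ∀ x, HasFDerivAt (fun u => Y u x)
      (-((matrixConnection (gaussCoeff γ κ) u).flip (Y u x))) u)
    (hu : u ∈ V) (x y : EuclideanSpace ℝ (Option (Fin n))) :
    gaussFormAt γ κ u (Y u x) (Y u y) = gaussFormAt γ κ 0 x y := by
  have hYx : ∀ u ∈ V, ∀ (x : EuclideanSpace ℝ (Option (Fin n))) (a : Option (Fin n)),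
      ∃ T : 𝔼 n →L[ℝ] ℝ, HasFDerivAt (fun u => (Y u x a : ℝ)) T u ∧ ∀ i,
        T (EuclideanSpace.single i 1) = -∑ c, gaussCoeff γ κ i a c u * Y u x c := by
    intro u hu x a
    let π : EuclideanSpace ℝ (Option (Fin n)) →L[ℝ] ℝ := EuclideanSpace.proj a
    have h1 : HasFDerivAt (fun u => (Y u x a : ℝ))
        (π.comp (-((matrixConnection (gaussCoeff γ κ) u).flip (Y u x)))) u :=
      π.hasFDerivAt.comp u (hY u hu x)
    refine ⟨_, h1, fun i => ?_⟩
    rw [← matrixConnection_single_apply]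
    simp [π]
  have hF : ∀ u ∈ V, HasFDerivAt (fun u : 𝔼 n => gaussFormAt γ κ u (Y u x) (Y u y)) (0 : 𝔼 n →L[ℝ] ℝ) u := by
    intro u hu
    choose T hT hTi using hYx u hu x
    choose R hR hRi using hYx u hu y
    have h1 : HasFDerivAt (fun u => gaussFormAt γ κ u (Y u x) (Y u y)) _ u :=
      HasFDerivAt.fun_sum fun a _ => HasFDerivAt.fun_sum fun c _ =>
        ((differentiableAt_gaussForm (hγ u hu) a c).hasFDerivAt.fun_mul (hT a)).fun_mul (hR c)
    refine h1.congr_fderiv ?_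
    refine ContinuousLinearMap.ext fun v => ?_
    rw [eq_sum_smul_single v, map_sum, map_sum]
    refine Finset.sum_congr rfl fun i _ => ?_
    rw [map_smul, map_smul]
    congr 1
    have hsy : ∀ᶠ w in 𝓝 u, (γ w).IsSymm := by
      filter_upwards [hV.mem_nhds hu] with w hw using hsymm w hw
    have h2 := fderiv_parallel_form (b' := fun a c => partialDeriv i (gaussForm γ κ a c) u)
      (m := fun a c => gaussCoeff γ κ i a c u) (b := fun a c => gaussForm γ κ a c u)
      (x := fun a => Y u x a) (y := fun a => Y u y a)
      (partialDeriv_gaussForm (hγ u hu) (hdet u hu) hsy i) (fun a => hTi a i) (fun a => hRi a i)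
    rw [FunLike.coe_zero, Pi.zero_apply, ← h2]
    simp only [FunLike.coe_sum, Finset.sum_apply, FunLike.coe_add, Pi.add_apply, FunLike.coe_smul,
      Pi.smul_apply, smul_eq_mul, partialDeriv]
    exact Finset.sum_congr rfl fun a _ => Finset.sum_congr rfl fun c _ => by ring
  have h := hconv.is_const_of_fderivWithin_eq_zero (𝕜 := ℝ)
    (f := fun u => gaussFormAt γ κ u (Y u x) (Y u y))
    (fun u hu => (hF u hu).differentiableAt.differentiableWithinAt)
    (fun u hu => by rw [fderivWithin_of_isOpen hV hu, (hF u hu).fderiv]) hu h0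
  simpa [hY0] using h

end Gauss

/-! ### Smooth families of inner products -/

section Frames

variable {P E G : Type*} [NormedAddCommGroup P] [NormedSpace ℝ P]
  [NormedAddCommGroup E] [NormedSpace ℝ E] [NormedAddCommGroup G] [NormedSpace ℝ G]

/-- A smooth family of inner products has smooth local orthonormal frames. -/
theorem exists_orthonormal_family {t : P → E →L[ℝ] E →L[ℝ] ℝ} {B : Set P} (hB : IsOpen B)
    (ht : ContDiffOn ℝ ∞ t B) (hsymm : ∀ p ∈ B, ∀ x y, t p x y = t p y x)
    (hpos : ∀ p ∈ B, ∀ x, x ≠ 0 → 0 < t p x x) {p₀ : P} (hp₀ : p₀ ∈ B) (d : ℕ)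
    (hd : d ≤ Module.finrank ℝ E) :
    ∃ (e : Fin d → P → E) (B' : Set P), IsOpen B' ∧ p₀ ∈ B' ∧ B' ⊆ B ∧
      (∀ a, ContDiffOn ℝ ∞ (e a) B') ∧
      ∀ p ∈ B', ∀ a b, t p (e a p) (e b p) = if a = b then 1 else 0 := by
  induction d with
  | zero => exact ⟨fun _ _ => 0, B, hB, hp₀, subset_rfl, fun a => a.elim0, fun _ _ a => a.elim0⟩
  | succ d ih =>
    obtain ⟨e, B', hB', hp', hBB, he, horth⟩ := ih (by omega)
    obtain ⟨v, hv⟩ : ∃ v, v ∉ Submodule.span ℝ (Set.range fun a => e a p₀) := by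
      by_contra! hall
      have htop : Submodule.span ℝ (Set.range fun a => e a p₀) = ⊤ :=
        Submodule.eq_top_iff'.2 hall
      have := finrank_range_le_card (R := ℝ) (fun a => e a p₀)
      rw [Set.finrank, htop, finrank_top, Fintype.card_fin] at this
      omega
    -- A Gram–Schmidt step with a constant vector `v` outside the span at `p₀`. The vector `w` is
    -- nonzero at `p₀`, and positivity of its square persists nearby.
    let w : P → E := fun p => v - ∑ a, t p v (e a p) • e a p
    have htB : ContDiffOn ℝ ∞ t B' := ht.mono hBB
    have hw : ContDiffOn ℝ ∞ w B' := contDiffOn_const.sub (ContDiffOn.sum fun a _ =>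
      ((htB.clm_apply contDiffOn_const).clm_apply (he a)).smul (he a))
    have hww : ContDiffOn ℝ ∞ (fun p => t p (w p) (w p)) B' := (htB.clm_apply hw).clm_apply hw
    have hwe : ∀ p ∈ B', ∀ b, t p (w p) (e b p) = 0 := by
      intro p hp b
      simp [w, map_sub, map_sum, horth p hp]
    have hw0 : w p₀ ≠ 0 := by
      intro h0
      refine hv ?_
      rw [sub_eq_zero.1 h0]
      exact Submodule.sum_mem _ fun a _ => Submodule.smul_mem _ _
        (Submodule.subset_span ⟨a, rfl⟩)
    refine ⟨Fin.snoc (α := fun _ => P → E) e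
      fun p => (Real.sqrt (t p (w p) (w p)))⁻¹ • w p,
      B' ∩ (fun p => t p (w p) (w p)) ⁻¹' Ioi 0, hww.continuousOn.isOpen_inter_preimage hB' isOpen_Ioi,
      ⟨hp', hpos p₀ hp₀ _ hw0⟩, inter_subset_left.trans hBB, fun a => ?_, ?_⟩
    · refine Fin.lastCases ?_ (fun a => ?_) a
      · simp only [Fin.snoc_last]
        have h1 := hww.mono (inter_subset_left (t := (fun p => t p (w p) (w p)) ⁻¹' Ioi 0))
        exact ((h1.sqrt fun p hp => (mem_Ioi.1 hp.2).ne').inv fun p hp =>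
          (Real.sqrt_pos.2 hp.2).ne').smul (hw.mono inter_subset_left)
      · simp only [Fin.snoc_castSucc]
        exact (he a).mono inter_subset_left
    · rintro p ⟨hp, hpp⟩ a b
      have hpp : 0 < t p (w p) (w p) := hpp
      have hs := Real.mul_self_sqrt hpp.le
      have hs0 := (Real.sqrt_pos.2 hpp).ne'
      refine Fin.lastCases ?_ (fun a => ?_) a <;> refine Fin.lastCases ?_ (fun b => ?_) b
      · simp only [Fin.snoc_last, map_smul, FunLike.coe_smul, Pi.smul_apply, smul_eq_mul, if_true]
        field_simp
        rw [sq, hs]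
      · simp only [Fin.snoc_last, Fin.snoc_castSucc, map_smul, FunLike.coe_smul, Pi.smul_apply,
          hwe p hp, smul_zero]
        rw [if_neg (Fin.castSucc_lt_last b).ne']
      · rw [hsymm p (hBB hp)]
        simp only [Fin.snoc_last, Fin.snoc_castSucc, map_smul, FunLike.coe_smul, Pi.smul_apply,
          hwe p hp, smul_zero]
        rw [if_neg (Fin.castSucc_lt_last a).ne]
      · simp only [Fin.snoc_castSucc, horth p hp, Fin.castSucc_inj]

theorem parseval_of_orthonormal [FiniteDimensional ℝ E] {t : E →L[ℝ] E →L[ℝ] ℝ} {d : ℕ}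
    (hd : d = Module.finrank ℝ E) {e : Fin d → E}
    (he : ∀ a b, t (e a) (e b) = if a = b then 1 else 0) (x y : E) :
    ∑ a, t (e a) x * t (e a) y = t x y := by
  have hli : LinearIndependent ℝ e := by
    rw [Fintype.linearIndependent_iff]
    intro g hg a
    have := congrArg (t (e a)) hg
    simpa [map_sum, he] using this
  have hx : x ∈ Submodule.span ℝ (Set.range e) := by
    rw [hli.span_eq_top_of_card_eq_finrank' (by simpa using hd)]
    trivial
  obtain ⟨c, rfl⟩ := (Submodule.mem_span_range_iff_exists_fun ℝ).1 hx
  simp [map_sum, he]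

/-- Two smooth families of inner products are related by a smooth family of isometries. -/
theorem exists_smooth_isometry [FiniteDimensional ℝ G] {t : P → G →L[ℝ] G →L[ℝ] ℝ} {s : P → E →L[ℝ] E →L[ℝ] ℝ}
    (hdim : Module.finrank ℝ G = Module.finrank ℝ E) {B : Set P} (hB : IsOpen B)
    (ht : ContDiffOn ℝ ∞ t B) (htsymm : ∀ p ∈ B, ∀ x y, t p x y = t p y x)
    (htpos : ∀ p ∈ B, ∀ x, x ≠ 0 → 0 < t p x x)
    (hs : ContDiffOn ℝ ∞ s B) (hssymm : ∀ p ∈ B, ∀ x y, s p x y = s p y x)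
    (hspos : ∀ p ∈ B, ∀ x, x ≠ 0 → 0 < s p x x) {p₀ : P} (hp₀ : p₀ ∈ B) :
    ∃ (T : P → G →L[ℝ] E) (B' : Set P), IsOpen B' ∧ p₀ ∈ B' ∧ B' ⊆ B ∧ ContDiffOn ℝ ∞ T B' ∧
      ∀ p ∈ B', ∀ x y, s p (T p x) (T p y) = t p x y := by
  obtain ⟨e, B₁, hB₁, hp₁, hBB₁, he, heo⟩ :=
    exists_orthonormal_family hB ht htsymm htpos hp₀ (Module.finrank ℝ G) le_rfl
  obtain ⟨ε, B₂, hB₂, hp₂, hBB₂, hε, hεo⟩ :=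
    exists_orthonormal_family hB hs hssymm hspos hp₀ (Module.finrank ℝ G) hdim.le
  -- The isometry sends one orthonormal frame to the other.
  refine ⟨fun p => ∑ a, (t p (e a p)).smulRight (ε a p), B₁ ∩ B₂, hB₁.inter hB₂, ⟨hp₁, hp₂⟩,
    inter_subset_left.trans hBB₁, ContDiffOn.sum fun a _ => ?_, ?_⟩
  · exact ((ht.mono (inter_subset_left.trans hBB₁)).clm_apply
      ((he a).mono inter_subset_left)).smulRight ((hε a).mono inter_subset_right)
  · rintro p ⟨hp1, hp2⟩ x y
    rw [← parseval_of_orthonormal rfl (heo p hp1) x y]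
    simp [map_sum, hεo p hp2, mul_comm]

end Frames

/-! ### Injectivity of families of immersions -/

/-- A smooth family of maps, one of which is immersive at a point, is injective near that point,
uniformly in the parameter. -/
theorem exists_ball_injOn {P U E : Type*} [NormedAddCommGroup P] [NormedSpace ℝ P]
    [NormedAddCommGroup U] [NormedSpace ℝ U] [FiniteDimensional ℝ U]
    [NormedAddCommGroup E] [NormedSpace ℝ E] [FiniteDimensional ℝ E] {ψ : P × U → E} {O : Set (P × U)} (hO : IsOpen O)
    (hψ : ContDiffOn ℝ ∞ ψ O) {p₀ : P} (hp₀ : (p₀, 0) ∈ O)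
    (hinj : Function.Injective (fderiv ℝ (fun u => ψ (p₀, u)) 0)) :
    ∃ r, 0 < r ∧ ∀ p ∈ Metric.ball p₀ r, InjOn (fun u => ψ (p, u)) (Metric.ball 0 r) := by
  -- With `R` a left inverse of the derivative at the centre, `R ∘ ψ - id` has Lipschitz constant
  -- `1/2` on a small ball for all nearby parameters, which forces injectivity.
  obtain ⟨R, hR⟩ : ∃ R : E →L[ℝ] U, R.comp (fderiv ℝ (fun u => ψ (p₀, u)) 0) =
      ContinuousLinearMap.id ℝ U := by
    obtain ⟨R, hR⟩ := LinearMap.exists_leftInverse_of_injective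
      (fderiv ℝ (fun u => ψ (p₀, u)) 0).toLinearMap (LinearMap.ker_eq_bot.2 hinj)
    exact ⟨LinearMap.toContinuousLinearMap R,
      ContinuousLinearMap.ext fun x => LinearMap.congr_fun hR x⟩
  have hc : ContDiffOn ℝ ∞ (fun q : P × U => R.comp (fderiv ℝ (fun u => ψ (q.1, u)) q.2) -
      ContinuousLinearMap.id ℝ U) O :=
    (contDiffOn_const.clm_comp (contDiffOn_fderiv_snd hO hψ)).sub contDiffOn_const
  have hU : {q | q ∈ O ∧ ‖R.comp (fderiv ℝ (fun u => ψ (q.1, u)) q.2) -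
      ContinuousLinearMap.id ℝ U‖ < 1 / 2} ∈ 𝓝 (p₀, (0 : U)) := by
    refine inter_mem (hO.mem_nhds hp₀) ?_
    refine (hc.continuousOn.norm.continuousAt (hO.mem_nhds hp₀)).eventually_lt
      continuousAt_const ?_
    rw [hR, sub_self, norm_zero]
    norm_num
  obtain ⟨r, hr, hball⟩ := Metric.mem_nhds_iff.1 hU
  rw [← ball_prod_same] at hball
  refine ⟨r, hr, fun p hp u hu v hv huv => ?_⟩
  have hlip := (convex_ball (0 : U) r).norm_image_sub_le_of_norm_hasFDerivWithin_le
    (f := fun u => R (ψ (p, u)) - u) (C := 1 / 2) (f' := fun u => R.comp (fderiv ℝ (fun u => ψ (p, u)) u) -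
      ContinuousLinearMap.id ℝ U) (fun w hw => ?_) (fun w hw => ?_) hu hv
  · have huv : ψ (p, u) = ψ (p, v) := huv
    rw [huv] at hlip
    have : ‖v - u‖ ≤ 1 / 2 * ‖v - u‖ := by
      simpa [norm_sub_rev] using hlip
    have h0 : ‖v - u‖ = 0 := by nlinarith [norm_nonneg (v - u)]
    exact (sub_eq_zero.1 (norm_eq_zero.1 h0)).symm
  · have hw' := (hball (mk_mem_prod hp hw)).1
    have h1 : HasFDerivAt (fun u => ψ (p, u)) (fderiv ℝ (fun u => ψ (p, u)) w) w :=
      (((contDiffOn_snd_of_contDiffOn hψ p).contDiffAt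
        ((isOpen_fiber hO p).mem_nhds hw')).differentiableAt (by simp)).hasFDerivAt
    exact ((R.hasFDerivAt.comp w h1).sub (hasFDerivAt_id w)).hasFDerivWithinAt
  · exact (hball (mk_mem_prod hp hw)).2.le

/-! ### Hypersurface coordinates of metrics of constant positive curvature -/

section SphereMap

variable {P : Type*} [NormedAddCommGroup P] [NormedSpace ℝ P] {n : ℕ}

local notation:max "𝔼" n:max => EuclideanSpace ℝ (Fin n)

theorem contDiffOn_sum_smul_const {X F α : Type*} [NormedAddCommGroup X] [NormedSpace ℝ X]
    [NormedAddCommGroup F] [NormedSpace ℝ F] [Fintype α] (c : α → F) {f : α → X → ℝ} {V : Set X}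
    (hf : ∀ a, ContDiffOn ℝ ∞ (f a) V) : ContDiffOn ℝ ∞ (fun x => ∑ a, f a x • c a) V :=
  ContDiffOn.sum fun a _ => (hf a).smul contDiffOn_const

theorem contDiffOn_matrixConnection {ι : Type*} [Fintype ι] [DecidableEq ι]
    {m : P → Fin n → ι → ι → 𝔼 n → ℝ} {O : Set (P × 𝔼 n)}
    (hm : ∀ i p o, ContDiffOn ℝ ∞ (fun q : P × 𝔼 n => m q.1 i p o q.2) O) :
    ContDiffOn ℝ ∞ (fun q : P × 𝔼 n => matrixConnection (m q.1) q.2) O :=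
  contDiffOn_sum_smul_const (fun x : Fin n × ι × ι => elementaryForm x.1 x.2.1 x.2.2)
    (f := fun x (q : P × 𝔼 n) => m q.1 x.1 x.2.1 x.2.2 q.2) fun x => hm x.1 x.2.1 x.2.2

variable {γ : P → 𝔼 n → Matrix (Fin n) (Fin n) ℝ} {K : P → ℝ} {O : Set (P × 𝔼 n)}

theorem contDiffOn_gaussCoeff (hO : IsOpen O)
    (hγ : ∀ i j, ContDiffOn ℝ ∞ (fun q : P × 𝔼 n => γ q.1 q.2 i j) O)
    (hdet : ∀ q ∈ O, (γ q.1 q.2).det ≠ 0)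
    (hK : ContDiffOn ℝ ∞ (fun q : P × 𝔼 n => K q.1) O) (i : Fin n) (p o : Option (Fin n)) :
    ContDiffOn ℝ ∞ (fun q : P × 𝔼 n => gaussCoeff (γ q.1) (K q.1) i p o q.2) O := by
  rcases p with _ | k <;> rcases o with _ | j
  · exact contDiffOn_const
  · exact hK.neg.mul (hγ i j)
  · exact contDiffOn_const
  · exact contDiffOn_christoffel hO hγ hdet k i j

theorem contDiffOn_gaussForm
    (hγ : ∀ i j, ContDiffOn ℝ ∞ (fun q : P × 𝔼 n => γ q.1 q.2 i j) O)
    (hK : ContDiffOn ℝ ∞ (fun q : P × 𝔼 n => K q.1) O) (p o : Option (Fin n)) :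
    ContDiffOn ℝ ∞ (fun q : P × 𝔼 n => gaussForm (γ q.1) (K q.1) p o q.2) O := by
  rcases p with _ | k <;> rcases o with _ | j
  · exact contDiffOn_const
  · exact contDiffOn_const
  · exact contDiffOn_const
  · exact hK.mul (hγ k j)

/-- The form `ds² + κ γ` as a continuous bilinear form. -/
def gaussFormL (γ : 𝔼 n → Matrix (Fin n) (Fin n) ℝ) (κ : ℝ) (u : 𝔼 n) :
    EuclideanSpace ℝ (Option (Fin n)) →L[ℝ] EuclideanSpace ℝ (Option (Fin n)) →L[ℝ] ℝ :=
  ∑ x : Option (Fin n) × Option (Fin n), gaussForm γ κ x.1 x.2 u •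
    ((EuclideanSpace.proj x.1 : EuclideanSpace ℝ (Option (Fin n)) →L[ℝ] ℝ).smulRight
      (EuclideanSpace.proj x.2 : EuclideanSpace ℝ (Option (Fin n)) →L[ℝ] ℝ))

theorem contDiffOn_gaussFormL {B : Set P}
    (h : ∀ a c, ContDiffOn ℝ ∞ (fun p => gaussForm (γ p) (K p) a c 0) B) :
    ContDiffOn ℝ ∞ (fun p => gaussFormL (γ p) (K p) 0) B :=
  contDiffOn_sum_smul_const (fun x : Option (Fin n) × Option (Fin n) =>
      ((EuclideanSpace.proj x.1 : EuclideanSpace ℝ (Option (Fin n)) →L[ℝ] ℝ).smulRight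
        (EuclideanSpace.proj x.2 : EuclideanSpace ℝ (Option (Fin n)) →L[ℝ] ℝ)))
      (f := fun x p => gaussForm (γ p) (K p) x.1 x.2 0) fun x => h x.1 x.2

theorem gaussFormL_apply (γ : 𝔼 n → Matrix (Fin n) (Fin n) ℝ) (κ : ℝ) (u : 𝔼 n)
    (x y : EuclideanSpace ℝ (Option (Fin n))) : gaussFormL γ κ u x y = gaussFormAt γ κ u x y := by
  simp only [gaussFormL, gaussFormAt, FunLike.coe_sum, Finset.sum_apply, FunLike.coe_smul,
    Pi.smul_apply, Fintype.sum_prod_type, ContinuousLinearMap.smulRight_apply, smul_eq_mul,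
    PiLp.proj_apply, mul_assoc]

theorem gaussFormAt_symm {γ : 𝔼 n → Matrix (Fin n) (Fin n) ℝ} {κ : ℝ} {u : 𝔼 n}
    (hsymm : (γ u).IsSymm) (x y : EuclideanSpace ℝ (Option (Fin n))) :
    gaussFormAt γ κ u x y = gaussFormAt γ κ u y x := by
  rw [gaussFormAt_eq, gaussFormAt_eq, Finset.sum_comm, mul_comm (x none)]
  congr 2
  exact Finset.sum_congr rfl fun i _ => Finset.sum_congr rfl fun j _ => by
    rw [hsymm.apply i j]; ring

theorem gaussFormAt_pos {γ : 𝔼 n → Matrix (Fin n) (Fin n) ℝ} {κ : ℝ} {u : 𝔼 n} (hκ : 0 < κ)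
    (hpos : ∀ v : 𝔼 n, v ≠ 0 → 0 < ∑ i, ∑ j, v i * v j * γ u i j)
    {x : EuclideanSpace ℝ (Option (Fin n))} (hx : x ≠ 0) : 0 < gaussFormAt γ κ u x x := by
  rw [gaussFormAt_eq]
  let v : 𝔼 n := WithLp.toLp 2 fun i => x (some i)
  by_cases hv : v = 0
  · have h1 : ∀ i, x (some i) = 0 := fun i => congrArg (fun w : 𝔼 n => w i) hv
    have h2 : x none ≠ 0 := fun h => hx (by
      ext a
      rcases a with _ | i
      · exact h
      · exact h1 i)
    simp only [h1, zero_mul, Finset.sum_const_zero, mul_zero, add_zero]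
    exact mul_self_pos.2 h2
  · exact add_pos_of_nonneg_of_pos (mul_self_nonneg _) (mul_pos hκ (hpos v hv))

/-- A smooth family of metrics of constant positive curvature `K` is, locally and up to the factor
`K`, induced from a smooth family of unit spheres by a smooth family of embeddings. -/
theorem exists_sphere_map [FiniteDimensional ℝ P] {E : Type*} [NormedAddCommGroup E]
    [NormedSpace ℝ E] [FiniteDimensional ℝ E] (hE : Module.finrank ℝ E = n + 1) (hO : IsOpen O)
    (hγ : ∀ i j, ContDiffOn ℝ ∞ (fun q : P × 𝔼 n => γ q.1 q.2 i j) O)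
    (hdet : ∀ q ∈ O, (γ q.1 q.2).det ≠ 0) (hsymm : ∀ q ∈ O, (γ q.1 q.2).IsSymm)
    (hpos : ∀ q ∈ O, ∀ v : 𝔼 n, v ≠ 0 → 0 < ∑ i, ∑ j, v i * v j * γ q.1 q.2 i j)
    {B : Set P} (hOB : ∀ q ∈ O, q.1 ∈ B) (hK : ContDiffOn ℝ ∞ K B)
    (hKpos : ∀ p ∈ B, 0 < K p)
    (hcurv : ∀ q ∈ O, ∀ l k i j : Fin n, riemannTensor (γ q.1) l k i j q.2 = K q.1 *
      (γ q.1 q.2 j k * (if l = i then 1 else 0) - γ q.1 q.2 i k * (if l = j then 1 else 0)))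
    {s : P → E →L[ℝ] E →L[ℝ] ℝ} (hs : ContDiffOn ℝ ∞ s B)
    (hssymm : ∀ p ∈ B, ∀ x y, s p x y = s p y x) (hspos : ∀ p ∈ B, ∀ x, x ≠ 0 → 0 < s p x x)
    {p₀ : P} (hp₀ : (p₀, 0) ∈ O) :
    ∃ (ψ : P × 𝔼 n → E) (r : ℝ), 0 < r ∧ Metric.ball p₀ r ×ˢ Metric.ball 0 r ⊆ O ∧
      ContDiffOn ℝ ∞ ψ (Metric.ball p₀ r ×ˢ Metric.ball 0 r) ∧
      ∀ p ∈ Metric.ball p₀ r, InjOn (fun u => ψ (p, u)) (Metric.ball 0 r) ∧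
        ∀ u ∈ Metric.ball (0 : 𝔼 n) r, s p (ψ (p, u)) (ψ (p, u)) = 1 ∧
          ∀ v, s p (ψ (p, u)) (fderiv ℝ (fun u => ψ (p, u)) u v) = 0 ∧
            ∀ w, s p (fderiv ℝ (fun u => ψ (p, u)) u v) (fderiv ℝ (fun u => ψ (p, u)) u w) =
              K p * ∑ i, ∑ j, v i * w j * γ p u i j := by
  have hKO : ContDiffOn ℝ ∞ (fun q : P × 𝔼 n => K q.1) O :=
    hK.comp contDiff_fst.contDiffOn hOB
  have hA : ContDiffOn ℝ ∞ (fun q : P × 𝔼 n => matrixConnection (gaussCoeff (γ q.1) (K q.1)) q.2) O :=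
    contDiffOn_matrixConnection (m := fun p => gaussCoeff (γ p) (K p))
      (contDiffOn_gaussCoeff hO hγ hdet hKO)
  have hγd : ∀ p u, (p, u) ∈ O → ∀ i j, DifferentiableAt ℝ (fun w => γ p w i j) u :=
    fun p u hq i j => ((contDiffOn_snd_of_contDiffOn (hγ i j) p).contDiffAt
      ((isOpen_fiber hO p).mem_nhds hq)).differentiableAt (by simp)
  have hΓd : ∀ p u, (p, u) ∈ O → ∀ k i j, DifferentiableAt ℝ (christoffel (γ p) k i j) u :=
    fun p u hq k i j =>
      ((contDiffOn_snd_of_contDiffOn (contDiffOn_christoffel hO hγ hdet k i j) p).contDiffAt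
        ((isOpen_fiber hO p).mem_nhds hq)).differentiableAt (by simp)
  have hflat : ∀ p u, (p, u) ∈ O → ∀ v w, connectionCurvature
      (fun u => matrixConnection (gaussCoeff (γ p) (K p)) u) u v w = 0 := by
    intro p u hq
    have h1 : ∀ l k i j : Fin n, riemannTensor (γ p) l k i j u = K p *
      (γ p u j k * (if l = i then 1 else 0) - γ p u i k * (if l = j then 1 else 0)) :=
      hcurv (p, u) hq
    refine (gaussConnection_flat_iff (hγd p u hq) (hΓd p u hq) (hdet (p, u) hq) ?_).2 h1
    filter_upwards [(isOpen_fiber hO p).mem_nhds hq] with w hw using hsymm _ hw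
  obtain ⟨Z, Y, r₁, hr₁, hrO, hZ, hZ0, hZd⟩ :=
    exists_invertible_parallel_frame_apply hO hA hp₀ hflat
  have hB₁ : IsOpen {p | (p, (0 : 𝔼 n)) ∈ O} := hO.preimage (by fun_prop)
  have ht : ContDiffOn ℝ ∞ (fun p => gaussFormL (γ p) (K p) 0) {p | (p, (0 : 𝔼 n)) ∈ O} := by
    refine contDiffOn_gaussFormL fun a c => ?_
    have h1 := contDiffOn_gaussForm hγ hKO a c
    have h2 : ContDiff ℝ ∞ fun p : P => (p, (0 : 𝔼 n)) := contDiff_prodMk_left 0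
    exact h1.comp h2.contDiffOn fun p hp => hp
  -- `T p` identifies the model space, carrying the form `ds² + Kγ` at `u = 0`, with a subspace of
  -- `(E, s p)` by an isometry.
  obtain ⟨T, B', hB', hp', hBB', hT, hTs⟩ := exists_smooth_isometry (s := s)
    (by rw [hE]; simp) hB₁ ht
    (fun p hp x y => by
      rw [gaussFormL_apply, gaussFormL_apply]; exact gaussFormAt_symm (hsymm _ hp) x y)
    (fun p hp x hx => by
      rw [gaussFormL_apply]; exact gaussFormAt_pos (hKpos p (hOB _ hp)) (hpos _ hp) hx)
    (hs.mono fun p hp => hOB _ hp) (fun p hp => hssymm p (hOB _ hp))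
    (fun p hp => hspos p (hOB _ hp)) hp₀
  obtain ⟨r₂, hr₂, hrB'⟩ := Metric.isOpen_iff.1 hB' p₀ hp'
  let e₀ : EuclideanSpace ℝ (Option (Fin n)) := EuclideanSpace.single none 1
  -- The index `none` stands for the position vector, so `e₀` picks the position column of the
  -- frame.
  let ψ : P × 𝔼 n → E := fun q => T q.1 (Z q e₀)
  have hr₃ : 0 < min r₁ r₂ := lt_min hr₁ hr₂
  set r₃ := min r₁ r₂ with hr₃def
  have hsub₁ : Metric.ball p₀ r₃ ×ˢ Metric.ball (0 : 𝔼 n) r₃ ⊆ Metric.ball p₀ r₁ ×ˢ Metric.ball 0 r₁ :=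
    prod_mono (Metric.ball_subset_ball (min_le_left _ _)) (Metric.ball_subset_ball (min_le_left _ _))
  have hsub₂ : Metric.ball p₀ r₃ ⊆ B' := (Metric.ball_subset_ball (min_le_right _ _)).trans hrB'
  have hψ : ContDiffOn ℝ ∞ ψ (Metric.ball p₀ r₃ ×ˢ Metric.ball 0 r₃) :=
    (hT.comp contDiff_fst.contDiffOn fun q hq => hsub₂ hq.1).clm_apply
      ((hZ.mono hsub₁).clm_apply contDiffOn_const)
  -- Parallel invariance concerns `Y`; applied to `Z x` and `Z y`, with `Y Z = 1`, it shows that `T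
  -- ∘ Z` is isometric from the form at `u`.
  have hiso : ∀ p ∈ Metric.ball p₀ r₃, ∀ u ∈ Metric.ball (0 : 𝔼 n) r₃, ∀ x y,
      s p (T p (Z (p, u) x)) (T p (Z (p, u) y)) = gaussFormAt (γ p) (K p) u x y := by
    intro p hp u hu x y
    have hu₁ := hsub₁ (mk_mem_prod hp hu)
    have hV : ∀ u ∈ Metric.ball (0 : 𝔼 n) r₁, (p, u) ∈ O := fun u hu => hrO ⟨hu₁.1, hu⟩
    rw [hTs p (hsub₂ hp), gaussFormL_apply]
    have h1 := gaussFormAt_parallel (γ := γ p) (κ := K p) Metric.isOpen_ball (convex_ball 0 r₁)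
      (Metric.mem_ball_self hr₁) (fun u hu => hγd p u (hV u hu))
      (fun u hu => hdet (p, u) (hV u hu)) (fun u hu => hsymm (p, u) (hV u hu))
      (Y := fun u => Y (p, u)) (fun x => (hZ0 p hu₁.1 x).2)
      (fun u hu x => (hZd p hu₁.1 u hu x).2.2) hu₁.2 (Z (p, u) x) (Z (p, u) y)
    have h2 := (hZd p hu₁.1 u hu₁.2 x).1
    have h3 := (hZd p hu₁.1 u hu₁.2 y).1
    rw [← h1]
    exact congrArg₂ (gaussFormAt (γ p) (K p) u) h2 h3
  have hdψ : ∀ p ∈ Metric.ball p₀ r₃, ∀ u ∈ Metric.ball (0 : 𝔼 n) r₃, ∀ v,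
      fderiv ℝ (fun u => ψ (p, u)) u v =
        T p (Z (p, u) (matrixConnection (gaussCoeff (γ p) (K p)) u v e₀)) := by
    intro p hp u hu v
    have hu₁ := hsub₁ (mk_mem_prod hp hu)
    have h1 := (T p).hasFDerivAt.comp u (hZd p hu₁.1 u hu₁.2 e₀).2.1
    exact congrArg (fun L : 𝔼 n →L[ℝ] E => L v) h1.fderiv
  -- The connection sends the position vector to the tangent vector `v`. So `dψ(v)` is the image of
  -- `(0, v)`, and all scalar products are read off from `ds² + Kγ`.
  have hval : ∀ p u v, ∀ a, matrixConnection (gaussCoeff (γ p) (K p)) u v e₀ a =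
      a.elim 0 fun i => v i := by
    intro p u v a
    rw [matrixConnection_apply]
    rcases a with _ | k <;> simp [e₀, gaussCoeff]
  have hmain : ∀ p ∈ Metric.ball p₀ r₃, ∀ u ∈ Metric.ball (0 : 𝔼 n) r₃,
      s p (ψ (p, u)) (ψ (p, u)) = 1 ∧
          ∀ v, s p (ψ (p, u)) (fderiv ℝ (fun u => ψ (p, u)) u v) = 0 ∧
            ∀ w, s p (fderiv ℝ (fun u => ψ (p, u)) u v) (fderiv ℝ (fun u => ψ (p, u)) u w) =
              K p * ∑ i, ∑ j, v i * w j * γ p u i j := by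
    intro p hp u hu
    refine ⟨?_, fun v => ⟨?_, fun w => ?_⟩⟩
    · rw [hiso p hp u hu, gaussFormAt_eq]
      simp [e₀]
    · rw [hdψ p hp u hu, hiso p hp u hu, gaussFormAt_eq, hval]
      simp [e₀]
    · rw [hdψ p hp u hu, hdψ p hp u hu, hiso p hp u hu, gaussFormAt_eq]
      simp only [hval, Option.elim]
      ring
  have hO₃ : IsOpen (Metric.ball p₀ r₃ ×ˢ Metric.ball (0 : 𝔼 n) r₃) :=
    Metric.isOpen_ball.prod Metric.isOpen_ball
  have hp₃ : p₀ ∈ Metric.ball p₀ r₃ := Metric.mem_ball_self hr₃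
  have h0₃ : (0 : 𝔼 n) ∈ Metric.ball (0 : 𝔼 n) r₃ := Metric.mem_ball_self hr₃
  obtain ⟨r₄, hr₄, hinj⟩ := exists_ball_injOn hO₃ hψ (mk_mem_prod hp₃ h0₃)
    ((injective_iff_map_eq_zero _).2 fun v hv => by
      by_contra hne
      have h1 := ((hmain p₀ hp₃ 0 h0₃).2 v).2 v
      rw [hv, map_zero] at h1
      exact (mul_pos (hKpos p₀ (hOB _ hp₀)) (hpos _ hp₀ v hne)).ne h1)
  refine ⟨ψ, min r₃ r₄, lt_min hr₃ hr₄, (Set.prod_mono ?_ ?_).trans (hsub₁.trans hrO),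
    hψ.mono (Set.prod_mono ?_ ?_), fun p hp => ⟨(hinj p ?_).mono ?_, fun u hu => hmain p ?_ u ?_⟩⟩
  all_goals first
    | exact Metric.ball_subset_ball (min_le_left _ _)
    | exact Metric.ball_subset_ball (min_le_right _ _)
    | exact Metric.ball_subset_ball (min_le_left _ _) hp
    | exact Metric.ball_subset_ball (min_le_right _ _) hp
    | exact Metric.ball_subset_ball (min_le_left _ _) hu

end SphereMap

/-! ### Conformal maps from hypersurface coordinates -/

section Local

variable {N n : ℕ}

local notation:max "𝔼" n:max => EuclideanSpace ℝ (Fin n)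

/-- The homogeneous extension of a map of the unit hypersurface onto a hypersurface of the unit
sphere of an inner product is conformal if the map is a homothety. -/
theorem halfHessianSq_eq_of_sphere_map {D : Set (𝔼 N)} {h : 𝔼 N → ℝ} (hh : IsConicNorm D h)
    {V : Set (𝔼 n)} {φ : 𝔼 n → 𝔼 N} (hφ : IsUnitParam D h V φ) {E : Type*} [NormedAddCommGroup E]
    [NormedSpace ℝ E] {s : E →L[ℝ] E →L[ℝ] ℝ} (hs : ∀ x y, s x y = s y x) {ψ : 𝔼 n → E} {H : ℝ}
    (hH : 0 < H) {U : 𝔼 N → 𝔼 n} {y : 𝔼 N} (hy : y ∈ D) (hU : DifferentiableAt ℝ U y)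
    (hUV : U y ∈ V) (hφU : ∀ᶠ z in 𝓝 y, z = h z • φ (U z)) (hψ : DifferentiableAt ℝ ψ (U y))
    (h1 : s (ψ (U y)) (ψ (U y)) = 1) (h2 : ∀ v, s (ψ (U y)) (fderiv ℝ ψ (U y) v) = 0)
    (h3 : ∀ v w, s (fderiv ℝ ψ (U y) v) (fderiv ℝ ψ (U y) w) =
      H ^ 2 * ∑ i, ∑ j, v i * w j * fiberMetric h φ (U y) i j) (ξ η : 𝔼 N) :
    halfHessianSq h y ξ η = (1 / H * h y ^ (1 - H)) ^ 2 *
      s (fderiv ℝ (fun z => h z ^ H • ψ (U z)) y ξ) (fderiv ℝ (fun z => h z ^ H • ψ (U z)) y η) := by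
  have hpos := hh.pos y hy
  have hhd := (hh.differentiableAt hy).hasFDerivAt
  have hφd : HasFDerivAt φ (fderiv ℝ φ (U y)) (U y) :=
    ((hφ.smooth.contDiffAt (hφ.isOpen.mem_nhds hUV)).differentiableAt (by simp)).hasFDerivAt
  have hc : HasFDerivAt (fun z => h z ^ H • ψ (U z)) _ y :=
    (hhd.rpow_const (p := H) (Or.inl hpos.ne')).fun_smul (hψ.hasFDerivAt.comp y hU.hasFDerivAt)
  have hid : HasFDerivAt (fun z => h z • φ (U z)) _ y := hhd.fun_smul (hφd.comp y hU.hasFDerivAt)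
  have hid' := hid.unique ((hasFDerivAt_id y).congr_of_eventuallyEq
    (hφU.mono fun z hz => hz.symm))
  -- Differentiating `z = h(z) φ(U z)` splits each vector into a radial and a tangential part. These
  -- are orthogonal for `g`, and their images under the extension are orthogonal for `s`.
  have hdec : ∀ ξ, ξ = fderiv ℝ h y ξ • φ (U y) + h y • fderiv ℝ φ (U y) (fderiv ℝ U y ξ) := by
    intro ξ
    have := congrArg (fun T : 𝔼 N →L[ℝ] 𝔼 N => T ξ) hid'
    simp only [FunLike.coe_add, Pi.add_apply, FunLike.coe_smul, Pi.smul_apply,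
      ContinuousLinearMap.smulRight_apply, ContinuousLinearMap.comp_apply,
      ContinuousLinearMap.id_apply] at this
    rw [add_comm] at this
    exact this.symm
  have hcd : ∀ ξ, fderiv ℝ (fun z => h z ^ H • ψ (U z)) y ξ =
      (H * h y ^ (H - 1) * fderiv ℝ h y ξ) • ψ (U y) +
        h y ^ H • fderiv ℝ ψ (U y) (fderiv ℝ U y ξ) := by
    intro ξ
    rw [hc.fderiv]
    simp only [FunLike.coe_add, Pi.add_apply, FunLike.coe_smul, Pi.smul_apply,
      ContinuousLinearMap.smulRight_apply, ContinuousLinearMap.comp_apply, smul_eq_mul]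
    rw [add_comm]
  have hmem := hφ.mem _ hUV
  -- The fundamental tensor is homogeneous of degree zero, so it may be evaluated on the unit
  -- hypersurface.
  have hgy : halfHessianSq h y ξ η = halfHessianSq h (φ (U y)) ξ η := by
    conv_lhs => rw [hφU.self_of_nhds]
    exact hh.halfHessianSq_smul hmem hpos _ _
  have e1 : hessForm h (φ (U y)) (φ (U y)) (φ (U y)) = 1 := by
    rw [← hh.halfHessianSq_eq_hessForm hmem, hh.halfHessianSq_self_self hmem, hφ.unit _ hUV]
    norm_num
  have e2 : ∀ v, hessForm h (φ (U y)) (φ (U y)) (fderiv ℝ φ (U y) v) = 0 := by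
    intro v
    rw [← hh.halfHessianSq_eq_hessForm hmem, hh.halfHessianSq_self hmem,
      fderiv_norm_comp_param hh hφ hUV, mul_zero]
  have e3 : ∀ v, hessForm h (φ (U y)) (fderiv ℝ φ (U y) v) (φ (U y)) = 0 := by
    intro v
    rw [← hh.halfHessianSq_eq_hessForm hmem, hh.halfHessianSq_symm hmem,
      hh.halfHessianSq_eq_hessForm hmem, e2]
  have e4 : ∀ v w, hessForm h (φ (U y)) (fderiv ℝ φ (U y) v) (fderiv ℝ φ (U y) w) =
      ∑ i, ∑ j, v i * w j * fiberMetric h φ (U y) i j := by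
    intro v w
    rw [← hh.halfHessianSq_eq_hessForm hmem, fiberMetric_sum hh hφ hUV]
  have e5 : ∀ v, s (fderiv ℝ ψ (U y) v) (ψ (U y)) = 0 := fun v => by rw [hs, h2]
  rw [hgy, hh.halfHessianSq_eq_hessForm hmem]
  conv_lhs => rw [hdec ξ, hdec η]
  rw [hcd, hcd]
  simp only [map_add, map_smul, FunLike.coe_add, Pi.add_apply, FunLike.coe_smul, Pi.smul_apply,
    e1, e2, e3, e4, e5, h1, h2, h3, smul_eq_mul, mul_zero, add_zero, zero_add, mul_one]
  have r1 : h y ^ (1 - H) * h y ^ (H - 1) = 1 := by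
    rw [← Real.rpow_add hpos]
    simp
  have r2 : h y ^ (1 - H) * h y ^ H = h y := by
    rw [← Real.rpow_add hpos]
    simp
  have r3 : (1 / H) * H = 1 := by field_simp
  set S := ∑ i, ∑ j, (fderiv ℝ U y ξ) i * (fderiv ℝ U y η) j * fiberMetric h φ (U y) i j
  set a := fderiv ℝ h y ξ
  set b := fderiv ℝ h y η
  calc b * a + h y * (h y * S)
      = ((1 / H) * H) ^ 2 * (h y ^ (1 - H) * h y ^ (H - 1)) ^ 2 * (a * b) +
        ((1 / H) * H) ^ 2 * (h y ^ (1 - H) * h y ^ H) ^ 2 * S := by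
        rw [r1, r2, r3]; ring
    _ = _ := by ring

variable {P : Type*} [NormedAddCommGroup P] [NormedSpace ℝ P]

theorem contDiffOn_fiberMetric {D : Set (P × 𝔼 N)} (hD : IsOpen D) {f : P × 𝔼 N → ℝ}
    (hf : ContDiffOn ℝ ∞ f D)
    (hfib : ∀ q ∈ D, IsConicNorm {y | (q.1, y) ∈ D} fun y => f (q.1, y))
    {O : Set (P × 𝔼 n)} (hO : IsOpen O) {φ : P → 𝔼 n → 𝔼 N}
    (hφ : ContDiffOn ℝ ∞ (fun q : P × 𝔼 n => φ q.1 q.2) O)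
    (hφD : ∀ q ∈ O, (q.1, φ q.1 q.2) ∈ D) (i j : Fin n) :
    ContDiffOn ℝ ∞ (fun q : P × 𝔼 n => fiberMetric (fun y => f (q.1, y)) (φ q.1) q.2 i j) O := by
  have h0 : ContDiffOn ℝ ∞ (fun q : P × 𝔼 N => fderiv ℝ (fderiv ℝ fun y => f (q.1, y) ^ 2) q.2) D :=
    contDiffOn_fderiv_snd hD (F := fun q : P × 𝔼 N => fderiv ℝ (fun y => f (q.1, y) ^ 2) q.2)
      (contDiffOn_fderiv_snd hD (F := fun q => f q ^ 2) (hf.pow 2))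
  have h1 : ContDiffOn ℝ ∞ (fun q : P × 𝔼 N => hessForm (fun y => f (q.1, y)) q.2) D :=
    h0.const_smul (1 / 2 : ℝ)
  have h2 : ContDiffOn ℝ ∞ (fun q : P × 𝔼 n => hessForm (fun y => f (q.1, y)) (φ q.1 q.2)) O :=
    h1.comp (f := fun q : P × 𝔼 n => (q.1, φ q.1 q.2)) (contDiff_fst.contDiffOn.prodMk hφ) hφD
  have h3 : ContDiffOn ℝ ∞ (fun q : P × 𝔼 n => fderiv ℝ (φ q.1) q.2) O :=
    contDiffOn_fderiv_snd hO (F := fun q : P × 𝔼 n => φ q.1 q.2) hφ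
  refine ((h2.clm_apply (h3.clm_apply (contDiffOn_const (c := EuclideanSpace.single i 1)))).clm_apply
    (h3.clm_apply (contDiffOn_const (c := EuclideanSpace.single j 1)))).congr fun q hq => ?_
  exact (hfib _ (hφD q hq)).halfHessianSq_eq_hessForm (hφD q hq) _ _

/-- Local existence of conformal maps of a smooth family of norms whose unit hypersurfaces have
constant positive curvature. -/
theorem exists_conformal_family [FiniteDimensional ℝ P] (hN : N = n + 1) (hn : 2 ≤ n)
    {D : Set (P × 𝔼 N)} (hD : IsOpen D) {f : P × 𝔼 N → ℝ} (hf : ContDiffOn ℝ ∞ f D)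
    (hfib : ∀ q ∈ D, IsConicNorm {y | (q.1, y) ∈ D} fun y => f (q.1, y)) {K : P → ℝ}
    (hKpos : ∀ q ∈ D, 0 < K q.1)
    (hK : ∀ q ∈ D, HasUnitCurvature n {y | (q.1, y) ∈ D} (fun y => f (q.1, y)) (K q.1))
    {B : Set P} (hDB : ∀ q ∈ D, q.1 ∈ B) {E : Type*} [NormedAddCommGroup E]
    [NormedSpace ℝ E] [FiniteDimensional ℝ E] (hE : Module.finrank ℝ E = N)
    {s : P → E →L[ℝ] E →L[ℝ] ℝ} (hs : ContDiffOn ℝ ∞ s B)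
    (hssymm : ∀ p ∈ B, ∀ x y, s p x y = s p y x) (hspos : ∀ p ∈ B, ∀ x, x ≠ 0 → 0 < s p x x)
    {q₀ : P × 𝔼 N} (hq₀ : q₀ ∈ D) :
    ∃ (W : Set (P × 𝔼 N)) (c : P × 𝔼 N → E), IsOpen W ∧ q₀ ∈ W ∧ W ⊆ D ∧
      (∀ q ∈ W, ∀ k : ℝ, 0 < k → (q.1, k • q.2) ∈ W) ∧ ContDiffOn ℝ ∞ c W ∧
      (∀ p y z, (p, y) ∈ W → (p, z) ∈ W → c (p, y) = c (p, z) → y = z) ∧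
      (∀ q ∈ W, ∀ k : ℝ, 0 < k → c (q.1, k • q.2) = k ^ √(K q.1) • c q) ∧
      (∀ q ∈ W, f q = 1 → s q.1 (c q) (c q) = 1) ∧
      ∀ q ∈ W, ∀ ξ η, halfHessianSq (fun y => f (q.1, y)) q.2 ξ η =
        (1 / √(K q.1) * f q ^ (1 - √(K q.1))) ^ 2 *
          s q.1 (fderiv ℝ (fun y => c (q.1, y)) q.2 ξ) (fderiv ℝ (fun y => c (q.1, y)) q.2 η) := by
  obtain ⟨p₀, y₀⟩ := q₀
  obtain ⟨L, l, Q, hl, hlL, hQy, hQL, hsplit⟩ :=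
    exists_splitting hN ((hfib _ hq₀).ne_zero y₀ hq₀)
  let O₀ : Set (P × 𝔼 n) := {q | (q.1, y₀ + L q.2) ∈ D}
  -- The second condition keeps the centre `u = 0` of the chart admissible for every parameter
  -- occurring in `O`; the smoothness of `K` is read off there.
  let O : Set (P × 𝔼 n) := {q | (q.1, y₀ + L q.2) ∈ D ∧ (q.1, y₀) ∈ D}
  have hO₀ : IsOpen O₀ := hD.preimage (by fun_prop)
  have hO : IsOpen O := hO₀.inter (hD.preimage (by fun_prop : Continuous fun q : P × 𝔼 n => (q.1, y₀)))
  let B₀ : Set P := {p | (p, y₀) ∈ D}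
  have hmem0 : ∀ p ∈ B₀, (p, (0 : 𝔼 n)) ∈ O := fun p hp => ⟨by
    have hp : (p, y₀) ∈ D := hp
    simpa using hp, hp⟩
  let φ : P → 𝔼 n → 𝔼 N := fun p => radialParam (fun y => f (p, y)) y₀ L
  have hφ : ∀ q ∈ O, IsUnitParam {y | (q.1, y) ∈ D} (fun y => f (q.1, y))
      {u | y₀ + L u ∈ {y | (q.1, y) ∈ D}} (φ q.1) :=
    fun q hq => isUnitParam_radialParam (hfib _ hq.1) hl hlL hQL
  have haff : ContDiff ℝ ∞ fun q : P × 𝔼 n => (q.1, y₀ + L q.2) := by fun_prop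
  have hfaff : ContDiffOn ℝ ∞ (fun q : P × 𝔼 n => f (q.1, y₀ + L q.2)) O :=
    hf.comp haff.contDiffOn fun q hq => hq.1
  have hφs : ContDiffOn ℝ ∞ (fun q : P × 𝔼 n => φ q.1 q.2) O :=
    (hfaff.inv fun q hq => ((hfib _ hq.1).pos _ hq.1).ne').smul haff.snd.contDiffOn
  let γ : P → 𝔼 n → Matrix (Fin n) (Fin n) ℝ := fun p => fiberMetric (fun y => f (p, y)) (φ p)
  have hγ : ∀ i j, ContDiffOn ℝ ∞ (fun q : P × 𝔼 n => γ q.1 q.2 i j) O :=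
    contDiffOn_fiberMetric hD hf hfib hO hφs fun q hq => (hφ q hq).mem q.2 hq.1
  have hdet : ∀ q ∈ O, (γ q.1 q.2).det ≠ 0 := fun q hq =>
    fiberMetric_det_ne_zero (hfib _ hq.1) (hφ q hq) hq.1
  have hγpos : ∀ q ∈ O, ∀ v : 𝔼 n, v ≠ 0 → 0 < ∑ i, ∑ j, v i * v j * γ q.1 q.2 i j := by
    intro q hq v hv
    rw [fiberMetric_sum (hfib _ hq.1) (hφ q hq) hq.1]
    exact (hfib _ hq.1).posDef _ ((hφ q hq).mem q.2 hq.1) _ fun h0 =>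
      hv ((hφ q hq).immersion q.2 hq.1 (h0.trans (map_zero _).symm))
  let i₀ : Fin n := ⟨0, by omega⟩
  let i₁ : Fin n := ⟨1, by omega⟩
  have hij : i₀ ≠ i₁ := by simp [i₀, i₁]
  -- `K` is the quotient of a curvature component by a positive metric component at `u = 0`.
  have hKs : ContDiffOn ℝ ∞ K B₀ := by
    have h1 := (contDiffOn_riemannTensor hO hγ hdet i₀ i₁ i₀ i₁).comp
      (contDiff_prodMk_left (0 : 𝔼 n)).contDiffOn hmem0
    have h2 := (hγ i₁ i₁).comp (contDiff_prodMk_left (0 : 𝔼 n)).contDiffOn hmem0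
    have hne : ∀ p ∈ B₀, γ p 0 i₁ i₁ ≠ 0 := fun p hp =>
      (fiberMetric_diag_pos (hfib _ hp) (hφ _ (hmem0 p hp)) (hmem0 p hp).1 i₁).ne'
    refine (h1.div h2 hne).congr fun p hp => ?_
    have := unitCurvature_mul (hK _ hp) (hφ _ (hmem0 p hp)) (hmem0 p hp).1 hij
    exact (eq_div_iff (hne p hp)).2 this.symm
  obtain ⟨ψ, r, hr, hrO, hψ, hψp⟩ := exists_sphere_map (γ := γ) (K := K) (hE.trans hN) hO hγ hdet
    (fun q hq => fiberMetric_isSymm (hfib _ hq.1) (hφ q hq) hq.1) hγpos (B := B₀)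
    (fun q hq => hq.2) hKs (fun p hp => hKpos _ hp) (fun q hq => hK _ hq.1 _ _ (hφ q hq) q.2 hq.1)
    (hs.mono fun p hp => hDB _ hp) (fun p hp => hssymm p (hDB _ hp))
    (fun p hp => hspos p (hDB _ hp)) (hmem0 p₀ hq₀)
  -- The coordinate of the point where the ray through `y` meets the affine hyperplane `y₀ + L u`;
  -- it is constant on rays.
  let U : 𝔼 N → 𝔼 n := fun y => (l y)⁻¹ • Q y
  have hU : ContDiffOn ℝ ∞ U {y | 0 < l y} :=
    (l.contDiff.contDiffOn.inv fun y hy => ne_of_gt hy).smul Q.contDiff.contDiffOn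
  have hlo : IsOpen {y | 0 < l y} := isOpen_lt continuous_const l.continuous
  let W : Set (P × 𝔼 N) := {q | (q ∈ D ∧ q.1 ∈ Metric.ball p₀ r) ∧ 0 < l q.2 ∧ U q.2 ∈ Metric.ball 0 r}
  have hW : IsOpen W :=
    (hD.inter (Metric.isOpen_ball.preimage continuous_fst)).inter
      ((hU.continuousOn.isOpen_inter_preimage hlo Metric.isOpen_ball).preimage continuous_snd)
  have hUk : ∀ y, ∀ k : ℝ, 0 < k → U (k • y) = U y := by
    intro y k hk
    simp only [U, map_smul, smul_eq_mul, smul_smul, mul_inv]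
    congr 1
    field_simp
  have hyU : ∀ y, 0 < l y → y = l y • (y₀ + L (U y)) := by
    intro y hy
    conv_lhs => rw [hsplit y]
    simp only [U, map_smul, smul_add, smul_smul, mul_inv_cancel₀ hy.ne', one_smul]
  have hyφ : ∀ p y, (p, y) ∈ D → 0 < l y → y = f (p, y) • φ p (U y) := by
    intro p y hyD hy
    have hmem : (p, y₀ + L (U y)) ∈ D := by
      have := (hfib _ hyD).conic y hyD (l y)⁻¹ (inv_pos.2 hy)
      rwa [hyU y hy, smul_smul, ← hyU y hy, inv_mul_cancel₀ hy.ne', one_smul] at this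
    have h1 : f (p, y) = l y * f (p, y₀ + L (U y)) := by
      conv_lhs => rw [hyU y hy]
      exact (hfib _ hyD).homogeneous _ hmem _ hy
    rw [h1]
    simp only [φ, radialParam, smul_smul]
    rw [mul_assoc, mul_inv_cancel₀ ((hfib _ hyD).pos _ hmem).ne', mul_one]
    exact hyU y hy
  let c : P × 𝔼 N → E := fun q => f q ^ √(K q.1) • ψ (q.1, U q.2)
  have hUW : ∀ q ∈ W, (q.1, U q.2) ∈ Metric.ball p₀ r ×ˢ Metric.ball 0 r :=
    fun q hq => mk_mem_prod hq.1.2 hq.2.2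
  have hWO : ∀ q ∈ W, (q.1, U q.2) ∈ O := fun q hq => hrO (hUW q hq)
  have hfpos : ∀ q ∈ D, 0 < f q := fun q hq => (hfib q hq).pos q.2 hq
  refine ⟨W, c, hW, ?_, fun q hq => hq.1.1, ?_, ?_, ?_, ?_, ?_, ?_⟩
  · refine ⟨⟨hq₀, Metric.mem_ball_self hr⟩, by simp [hl], ?_⟩
    simp [U, hQy, hr]
  · rintro q ⟨⟨h1, h2⟩, h3, h4⟩ k hk
    refine ⟨⟨(hfib q h1).conic q.2 h1 k hk, h2⟩, by simpa using mul_pos hk h3, ?_⟩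
    change U (k • q.2) ∈ _
    rwa [hUk _ k hk]
  · have hKW : ContDiffOn ℝ ∞ (fun q : P × 𝔼 N => √(K q.1)) W :=
      (hKs.comp contDiff_fst.contDiffOn fun q hq => (hWO q hq).2).sqrt fun q hq =>
        (hKpos q hq.1.1).ne'
    have hUs : ContDiffOn ℝ ∞ (fun q : P × 𝔼 N => (q.1, U q.2)) W :=
      contDiff_fst.contDiffOn.prodMk (hU.comp contDiff_snd.contDiffOn fun q hq => hq.2.1)
    exact ((hf.mono fun q hq => hq.1.1).rpow hKW fun q hq => (hfpos q hq.1.1).ne').smul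
      (hψ.comp hUs hUW)
  -- The `s`-length of `c` determines `f`, because `√K ≠ 0`. Then injectivity of `ψ` determines the
  -- ray, and the two together determine the vector.
  · intro p y z hy hz hyz
    have hy1 := ((hψp p hy.1.2).2 _ hy.2.2).1
    have hz1 := ((hψp p hz.1.2).2 _ hz.2.2).1
    have h1 : s p (c (p, y)) (c (p, y)) = (f (p, y) ^ √(K p)) ^ 2 := by
      simp only [c, map_smul, FunLike.coe_smul, Pi.smul_apply, hy1, smul_eq_mul]
      ring
    have h2 : s p (c (p, z)) (c (p, z)) = (f (p, z) ^ √(K p)) ^ 2 := by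
      simp only [c, map_smul, FunLike.coe_smul, Pi.smul_apply, hz1, smul_eq_mul]
      ring
    have hfy := hfpos _ hy.1.1
    have hfz := hfpos _ hz.1.1
    have h3 : f (p, y) ^ √(K p) = f (p, z) ^ √(K p) := by
      rw [hyz, h2] at h1
      exact ((sq_eq_sq₀ (Real.rpow_pos_of_pos hfz _).le (Real.rpow_pos_of_pos hfy _).le).1 h1).symm
    have h4 : f (p, y) = f (p, z) :=
      (Real.rpow_left_inj hfy.le hfz.le (Real.sqrt_pos.2 (hKpos _ hy.1.1)).ne').1 h3
    have h5 : ψ (p, U y) = ψ (p, U z) := by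
      have h6 : f (p, y) ^ √(K p) • ψ (p, U y) = f (p, z) ^ √(K p) • ψ (p, U z) := hyz
      rw [h3] at h6
      exact smul_right_injective E (Real.rpow_pos_of_pos hfz _).ne' h6
    have h7 : U y = U z := (hψp p hy.1.2).1 hy.2.2 hz.2.2 h5
    rw [hyφ p y hy.1.1 hy.2.1, hyφ p z hz.1.1 hz.2.1, h4, h7]
  · intro q hq k hk
    simp only [c]
    rw [(hfib q hq.1.1).homogeneous q.2 hq.1.1 k hk, hUk _ k hk,
      Real.mul_rpow hk.le (hfpos q hq.1.1).le, smul_smul]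
  · intro q hq hq1
    simp only [c, hq1, Real.one_rpow, one_smul]
    exact ((hψp q.1 hq.1.2).2 _ hq.2.2).1
  · rintro ⟨p, y⟩ hq ξ η
    have hK0 := hKpos _ hq.1.1
    have hψd : DifferentiableAt ℝ (fun u => ψ (p, u)) (U y) :=
      (((contDiffOn_snd_of_contDiffOn hψ p).contDiffAt ((isOpen_fiber
        (Metric.isOpen_ball.prod Metric.isOpen_ball) p).mem_nhds (hUW _ hq)))).differentiableAt
          (by simp)
    obtain ⟨h1, h2⟩ := (hψp p hq.1.2).2 _ hq.2.2
    refine halfHessianSq_eq_of_sphere_map (hfib _ hq.1.1) (hφ _ (hWO _ hq))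
      (hssymm p (hDB _ hq.1.1)) (ψ := fun u => ψ (p, u)) (Real.sqrt_pos.2 hK0) (U := U) hq.1.1
      ((hU.contDiffAt (hlo.mem_nhds hq.2.1)).differentiableAt (by simp)) (hWO _ hq).1 ?_ hψd h1
      (fun v => (h2 v).1) (fun v w => ?_) ξ η
    · filter_upwards [(isOpen_fiber hW p).mem_nhds hq] with z hz using hyφ p z hz.1.1 hz.2.1
    · rw [Real.sq_sqrt hK0.le]
      exact (h2 v).2 w

end Local

open Bundle

/-! ### Linear changes of coordinates -/

section LinearChange

variable {N n : ℕ}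

local notation:max "𝔼" n:max => EuclideanSpace ℝ (Fin n)

variable {D : Set (𝔼 N)} {h : 𝔼 N → ℝ} (A : 𝔼 N ≃L[ℝ] 𝔼 N)

theorem IsConicNorm.comp_equiv (hh : IsConicNorm D h) :
    IsConicNorm {y | A y ∈ D} fun y => h (A y) where
  isOpen := hh.isOpen.preimage A.continuous
  ne_zero y hy h0 := hh.ne_zero _ hy (by rw [h0, map_zero])
  conic y hy k hk := by
    have := hh.conic _ hy k hk
    rwa [← map_smul] at this
  smooth := hh.smooth.comp A.contDiff.contDiffOn fun _ hy => hy
  pos y hy := hh.pos _ hy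
  homogeneous y hy k hk := by rw [map_smul, hh.homogeneous _ hy k hk]
  posDef y hy ξ hξ := by
    rw [halfHessianSq_comp h A]
    exact hh.posDef _ hy _ ((map_ne_zero_iff A A.injective).2 hξ)

theorem HasUnitCurvature.comp_equiv {K : ℝ} (hK : HasUnitCurvature n D h K) :
    HasUnitCurvature n {y | A y ∈ D} (fun y => h (A y)) K := by
  intro V φ hφ
  have hd : ∀ u v, fderiv ℝ (fun u => A (φ u)) u v = A (fderiv ℝ φ u v) := by
    intro u v
    have h1 := A.comp_fderiv (f := φ) (x := u)
    exact congrArg (fun T : 𝔼 n →L[ℝ] 𝔼 N => T v) h1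
  have h1 : IsUnitParam D h V fun u => A (φ u) := by
    refine ⟨hφ.isOpen, A.contDiff.comp_contDiffOn hφ.smooth, hφ.mem, hφ.unit, fun u hu => ?_⟩
    intro v w hvw
    rw [hd, hd] at hvw
    exact hφ.immersion u hu (A.injective hvw)
  have h2 : fiberMetric (fun y => h (A y)) φ = fiberMetric h fun u => A (φ u) := by
    ext u i j
    simp only [fiberMetric, Matrix.of_apply, hd]
    exact halfHessianSq_comp h A _ _ _
  rw [h2]
  exact hK V _ h1

end LinearChange

/-! ### Fibres of the tangent bundle -/

section Fibers

variable {N : ℕ} {M : Type*} [TopologicalSpace M] [ChartedSpace (EuclideanSpace ℝ (Fin N)) M]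
  [IsManifold (𝓡 N) ∞ M]

local notation:max "𝔼" n:max => EuclideanSpace ℝ (Fin n)

/-- The linear map of `T_x M` given by the bundle chart at `x₀`. -/
def fiberCoord (x₀ x : M) : 𝔼 N →L[ℝ] 𝔼 N :=
  (trivializationAt (𝔼 N) (TangentSpace (𝓡 N)) x₀).continuousLinearMapAt ℝ x

/-- The linear map to `T_x M` given by the bundle chart at `x₀`. -/
def fiberCoordSymm (x₀ x : M) : 𝔼 N →L[ℝ] 𝔼 N :=
  (trivializationAt (𝔼 N) (TangentSpace (𝓡 N)) x₀).symmL ℝ x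

variable {x₀ x : M}

theorem fiberCoordSymm_fiberCoord (hx : x ∈ (chartAt (𝔼 N) x₀).source) (y : 𝔼 N) :
    fiberCoordSymm x₀ x (fiberCoord x₀ x y) = y :=
  (trivializationAt (𝔼 N) (TangentSpace (𝓡 N)) x₀).symmL_continuousLinearMapAt hx y

theorem fiberCoord_fiberCoordSymm (hx : x ∈ (chartAt (𝔼 N) x₀).source) (y : 𝔼 N) :
    fiberCoord x₀ x (fiberCoordSymm x₀ x y) = y :=
  (trivializationAt (𝔼 N) (TangentSpace (𝓡 N)) x₀).continuousLinearMapAt_symmL hx y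

theorem trivializationAt_snd (hx : x ∈ (chartAt (𝔼 N) x₀).source) (y : TangentSpace (𝓡 N) x) :
    (trivializationAt (𝔼 N) (TangentSpace (𝓡 N)) x₀ ⟨x, y⟩).2 = fiberCoord x₀ x y :=
  ((trivializationAt (𝔼 N) (TangentSpace (𝓡 N)) x₀).continuousLinearMapAt_apply_of_mem ℝ hx y).symm

variable (x) in
theorem contMDiff_fiber_inclusion : ContMDiff 𝓘(ℝ, 𝔼 N) (𝓡 N).tangent ∞
    fun w : 𝔼 N => (⟨x, w⟩ : TangentBundle (𝓡 N) M) := by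
  intro w
  rw [contMDiffAt_totalSpace]
  refine ⟨contMDiffAt_const, ?_⟩
  have h : (fun w : 𝔼 N => (trivializationAt (𝔼 N) (TangentSpace (𝓡 N)) x
      (⟨x, w⟩ : TangentBundle (𝓡 N) M)).2) = fiberCoord x x :=
    funext fun w => trivializationAt_snd (mem_chart_source _ x) w
  change ContMDiffAt 𝓘(ℝ, 𝔼 N) 𝓘(ℝ, 𝔼 N) ∞ (fun w : 𝔼 N =>
    (trivializationAt (𝔼 N) (TangentSpace (𝓡 N)) x (⟨x, w⟩ : TangentBundle (𝓡 N) M)).2) w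
  rw [h]
  exact (fiberCoord x x).contDiff.contMDiff.contMDiffAt

/-- Smoothness on the bundle becomes ordinary smoothness on a fibre by reading the map in the bundle
chart at `x` itself and undoing the linear chart map. -/
theorem contDiffOn_fiber_map {C : (x : M) → TangentSpace (𝓡 N) x → TangentSpace (𝓡 N) x}
    {W : Set (TangentBundle (𝓡 N) M)}
    (hC : ContMDiffOn (𝓡 N).tangent (𝓡 N).tangent ∞ (totalMap C) W) (x : M) :
    ContDiffOn ℝ ∞ (F := 𝔼 N) (fun w : 𝔼 N => C x w) {w | (⟨x, w⟩ : TangentBundle (𝓡 N) M) ∈ W} := by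
  have h1 : ContMDiffOn 𝓘(ℝ, 𝔼 N) (𝓡 N).tangent ∞
      (fun w : 𝔼 N => (⟨x, C x w⟩ : TangentBundle (𝓡 N) M))
      {w | (⟨x, w⟩ : TangentBundle (𝓡 N) M) ∈ W} :=
    hC.comp (contMDiff_fiber_inclusion x).contMDiffOn fun w hw => hw
  have h2 : ContMDiffOn 𝓘(ℝ, 𝔼 N) 𝓘(ℝ, 𝔼 N) ∞ (fun w : 𝔼 N => fiberCoord x x (C x w))
      {w | (⟨x, w⟩ : TangentBundle (𝓡 N) M) ∈ W} := by
    intro w hw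
    refine (contMDiffWithinAt_totalSpace.1 (h1 w hw)).2.congr (fun z _ => ?_) ?_ <;>
    exact (trivializationAt_snd (mem_chart_source _ x) _).symm
  have h3 := (fiberCoordSymm x x).contDiff.comp_contDiffOn h2.contDiffOn
  exact h3.congr fun w _ => (fiberCoordSymm_fiberCoord (mem_chart_source _ x) _).symm

/-- The admissible tangent vectors at a point. -/
def FinslerSpace.fiberDomain (Φ : FinslerSpace N M) (x : M) : Set (𝔼 N) :=
  {w | (⟨x, w⟩ : TangentBundle (𝓡 N) M) ∈ Φ.domain}

/-- The Finsler metric function on a tangent space. -/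
def FinslerSpace.fiberNorm (Φ : FinslerSpace N M) (x : M) (w : 𝔼 N) : ℝ := Φ.F ⟨x, w⟩

theorem FinslerSpace.isConicNorm (Φ : FinslerSpace N M) (x : M) :
    IsConicNorm (Φ.fiberDomain x) (Φ.fiberNorm x) where
  isOpen := Φ.isOpen_domain.preimage (contMDiff_fiber_inclusion x).continuous
  ne_zero _ hy := Φ.ne_zero _ hy
  conic _ hy k hk := Φ.conic _ hy k hk
  smooth := (Φ.smooth.comp (contMDiff_fiber_inclusion x).contMDiffOn fun _ hw => hw).contDiffOn
  pos _ hy := Φ.pos _ hy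
  homogeneous _ hy k hk := Φ.homogeneous _ hy k hk
  posDef _ hy := Φ.posDef _ hy

theorem FinslerSpace.hasUnitCurvature_iff (Φ : FinslerSpace N M) (K : M → ℝ) :
    Φ.IndicatrixHasConstantCurvature K ↔
      ∀ x, HasUnitCurvature (N - 1) (Φ.fiberDomain x) (Φ.fiberNorm x) (K x) := by
  refine forall_congr' fun x => forall₂_congr fun V φ => ⟨fun h hφ => ?_, fun h hφ => ?_⟩
  · exact h ⟨hφ.isOpen, hφ.smooth, fun u hu => ⟨hφ.mem u hu, hφ.unit u hu⟩, hφ.immersion⟩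
  · exact h ⟨hφ.isOpen, hφ.smooth, fun u hu => (hφ.mapsTo hu).1, fun u hu => (hφ.mapsTo hu).2,
      hφ.immersion⟩

theorem IsConformalAutomorphismOn.multiplier_eq {Φ : FinslerSpace N M} {S : RiemMetric N M}
    {H : M → ℝ} {W : Set (TangentBundle (𝓡 N) M)}
    {C : (x : M) → TangentSpace (𝓡 N) x → TangentSpace (𝓡 N) x} {q : TangentBundle (𝓡 N) M → ℝ}
    (hC : IsConformalAutomorphismOn Φ S H W C q) (hH : ∀ x, 0 < H x)
    {v : TangentBundle (𝓡 N) M} (hv : v ∈ W) :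
    q v = (1 / H v.1 * Φ.F v ^ (1 - H v.1)) ^ 2 := by
  obtain ⟨x, y⟩ := v
  have hh := Φ.isConicNorm x
  have hyD : (y : 𝔼 N) ∈ Φ.fiberDomain x := hC.subset hv
  have hWo : IsOpen {w : 𝔼 N | (⟨x, w⟩ : TangentBundle (𝓡 N) M) ∈ W} :=
    hC.isOpen.preimage (contMDiff_fiber_inclusion x).continuous
  have hd : DifferentiableAt ℝ (F := 𝔼 N) (fun w : 𝔼 N => C x w) y :=
    ((contDiffOn_fiber_map hC.smooth x).contDiffAt
    (hWo.mem_nhds (show (y : 𝔼 N) ∈ _ from hv))).differentiableAt (by simp)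
  refine hh.multiplier_eq hyD (s := S.inner x) (hH x) hd (hC.homogeneous _ hv) ?_
    (hC.conformal _ hv y y)
  exact hC.unit _ (hC.conic _ hv _ (inv_pos.2 (hh.pos _ hyD))) (hh.apply_inv_smul hyD)

theorem IsConformallyAutomorphic.hasConstantCurvature (hN : 1 ≤ N) {Φ : FinslerSpace N M}
    {S : RiemMetric N M} {H : M → ℝ} (h : IsConformallyAutomorphic Φ S H) :
    Φ.IndicatrixHasConstantCurvature fun x => H x ^ 2 := by
  rw [FinslerSpace.hasUnitCurvature_iff]
  intro x
  refine hasUnitCurvature_of_conformal (Φ.isConicNorm x) (by omega) (s := S.inner x)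
    (S.symm x) (S.pos x) (h.1 x) fun y hy => ?_
  obtain ⟨W, C, q, hvW, hC⟩ := h.2 _ hy
  exact ⟨{w | (⟨x, w⟩ : TangentBundle (𝓡 N) M) ∈ W}, fun w => C x w, fun w => q ⟨x, w⟩,
    hC.isOpen.preimage (contMDiff_fiber_inclusion x).continuous, hvW, fun w hw => hC.subset hw,
    contDiffOn_fiber_map hC.smooth x, fun w hw => hC.homogeneous _ hw,
    fun w hw => hC.unit _ hw, fun w hw => hC.conformal _ hw⟩

end Fibers

/-! ### Bundle charts of the tangent bundle -/

theorem fderiv_comp_linear {E F G X : Type*} [NormedAddCommGroup E] [NormedSpace ℝ E]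
    [NormedAddCommGroup F] [NormedSpace ℝ F] [NormedAddCommGroup G] [NormedSpace ℝ G]
    [NormedAddCommGroup X] [NormedSpace ℝ X] (B : F →L[ℝ] X) (A : G →L[ℝ] E) {c : E → F} {y : G}
    {c' : E →L[ℝ] F} (hc : HasFDerivAt c c' (A y)) :
    fderiv ℝ (fun w => B (c (A w))) y = B.comp (c'.comp A) :=
  (B.hasFDerivAt.comp y (hc.comp y A.hasFDerivAt)).fderiv

section Coordinates

variable {N : ℕ} {M : Type*} [TopologicalSpace M] [ChartedSpace (EuclideanSpace ℝ (Fin N)) M]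
  [IsManifold (𝓡 N) ∞ M]

local notation:max "𝔼" n:max => EuclideanSpace ℝ (Fin n)

/-- The linear equivalence of `T_x M` given by the bundle chart at `x₀`. -/
def fiberEquiv {x₀ x : M} (hx : x ∈ (chartAt (𝔼 N) x₀).source) : 𝔼 N ≃L[ℝ] 𝔼 N :=
  ContinuousLinearEquiv.equivOfInverse (fiberCoord x₀ x) (fiberCoordSymm x₀ x)
    (fiberCoordSymm_fiberCoord hx) (fiberCoord_fiberCoordSymm hx)

variable (v₀ : TangentBundle (𝓡 N) M)

theorem mem_tangent_extChartAt_source {v : TangentBundle (𝓡 N) M} :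
    v ∈ (extChartAt (𝓡 N).tangent v₀).source ↔ v.1 ∈ (chartAt (𝔼 N) v₀.1).source := by
  rw [extChartAt_source]
  exact TangentBundle.mem_chart_source_iff _ _

omit [IsManifold (𝓡 N) ∞ M] in
theorem symm_mem_chart_source {x₀ : M} {p : 𝔼 N} (hp : p ∈ (extChartAt (𝓡 N) x₀).target) :
    (extChartAt (𝓡 N) x₀).symm p ∈ (chartAt (𝔼 N) x₀).source := by
  rw [← extChartAt_source (𝓡 N)]
  exact (extChartAt (𝓡 N) x₀).map_target hp

theorem mem_tangent_extChartAt_target {q : 𝔼 N × 𝔼 N} :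
    q ∈ (extChartAt (𝓡 N).tangent v₀).target ↔ q.1 ∈ (extChartAt (𝓡 N) v₀.1).target := by
  rw [FiberBundle.extChartAt_target]
  exact ⟨fun h => h.1.1, fun h => ⟨⟨h, symm_mem_chart_source h⟩, trivial⟩⟩

theorem tangent_extChartAt_apply {v : TangentBundle (𝓡 N) M}
    (hv : v.1 ∈ (chartAt (𝔼 N) v₀.1).source) :
    extChartAt (𝓡 N).tangent v₀ v = (extChartAt (𝓡 N) v₀.1 v.1, fiberCoord v₀.1 v.1 v.2) := by
  rw [FiberBundle.extChartAt]
  refine Prod.ext rfl ?_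
  exact trivializationAt_snd hv v.2

theorem tangent_extChartAt_symm_apply {p : 𝔼 N} (hp : p ∈ (extChartAt (𝓡 N) v₀.1).target)
    (w : 𝔼 N) : (extChartAt (𝓡 N).tangent v₀).symm (p, w) =
      ⟨(extChartAt (𝓡 N) v₀.1).symm p,
        fiberCoordSymm v₀.1 ((extChartAt (𝓡 N) v₀.1).symm p) w⟩ := by
  have hx := symm_mem_chart_source hp
  have h1 : extChartAt (𝓡 N).tangent v₀ ⟨(extChartAt (𝓡 N) v₀.1).symm p,
      fiberCoordSymm v₀.1 ((extChartAt (𝓡 N) v₀.1).symm p) w⟩ = (p, w) := by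
    rw [tangent_extChartAt_apply v₀ hx]
    exact Prod.ext ((extChartAt (𝓡 N) v₀.1).right_inv hp) (fiberCoord_fiberCoordSymm hx w)
  rw [← h1]
  exact (extChartAt (𝓡 N).tangent v₀).left_inv ((mem_tangent_extChartAt_source v₀).2 hx)

/-- The components of a Riemannian metric in the bundle chart at `x₀`. -/
def metricCoord (S : RiemMetric N M) (x₀ x : M) : 𝔼 N →L[ℝ] 𝔼 N →L[ℝ] ℝ :=
  (S.inner x : 𝔼 N →L[ℝ] 𝔼 N →L[ℝ] ℝ).bilinearComp (fiberCoordSymm x₀ x) (fiberCoordSymm x₀ x)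

/-- In finite dimension it suffices to test on fixed vectors, and these give smooth local sections
of the tangent bundle. -/
theorem contDiffOn_metricCoord (S : RiemMetric N M) : ContDiffOn ℝ ∞
    (fun p => metricCoord S v₀.1 ((extChartAt (𝓡 N) v₀.1).symm p))
    (extChartAt (𝓡 N) v₀.1).target := by
  have hsec : ∀ w : 𝔼 N, ContMDiffOn 𝓘(ℝ, 𝔼 N) (𝓡 N).tangent ∞
      (fun p => (⟨(extChartAt (𝓡 N) v₀.1).symm p,
        fiberCoordSymm v₀.1 ((extChartAt (𝓡 N) v₀.1).symm p) w⟩ : TangentBundle (𝓡 N) M))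
      (extChartAt (𝓡 N) v₀.1).target := by
    intro w
    have h1 : ContMDiffOn 𝓘(ℝ, 𝔼 N) 𝓘(ℝ, 𝔼 N × 𝔼 N) ∞ (fun p : 𝔼 N => (p, w))
        (extChartAt (𝓡 N) v₀.1).target := (contDiff_prodMk_left w).contMDiff.contMDiffOn
    refine ((contMDiffOn_extChartAt_symm v₀).comp h1 fun p hp =>
      (mem_tangent_extChartAt_target v₀).2 hp).congr fun p hp => ?_
    exact (tangent_extChartAt_symm_apply v₀ hp w).symm
  rw [contDiffOn_clm_apply]
  intro v
  rw [contDiffOn_clm_apply]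
  intro w
  have hS := S.contMDiff.comp_contMDiffOn (contMDiffOn_extChartAt_symm (I := 𝓡 N) (n := ∞) v₀.1)
  have h := ContMDiffOn.clm_bundle_apply₂ (F₃ := ℝ) (E₃ := fun _ : M => ℝ) hS (hsec v) (hsec w)
  refine ContMDiffOn.contDiffOn fun p hp => ?_
  exact (contMDiffWithinAt_totalSpace.1 (h p hp)).2

set_option maxHeartbeats 1000000 in
/-- Conformal maps of a Finsler space whose indicatrices have constant positive curvature, in a bundle
chart of the tangent bundle. -/
theorem exists_conformal_family_extChartAt (hN : 3 ≤ N) {Φ : FinslerSpace N M} {K : M → ℝ}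
    (hKpos : ∀ x, 0 < K x)
    (hK : ∀ x, HasUnitCurvature (N - 1) (Φ.fiberDomain x) (Φ.fiberNorm x) (K x))
    (S : RiemMetric N M) (hv₀ : v₀ ∈ Φ.domain) :
    ∃ (W : Set (𝔼 N × 𝔼 N)) (c : 𝔼 N × 𝔼 N → 𝔼 N), IsOpen W ∧
      extChartAt (𝓡 N).tangent v₀ v₀ ∈ W ∧ (∀ q ∈ W, q.1 ∈ (extChartAt (𝓡 N) v₀.1).target) ∧
      ContDiffOn ℝ ∞ c W ∧ (∀ p y z, (p, y) ∈ W → (p, z) ∈ W → c (p, y) = c (p, z) → y = z) ∧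
      ∀ x ∈ (chartAt (𝔼 N) v₀.1).source, ∀ y : 𝔼 N,
        (extChartAt (𝓡 N) v₀.1 x, fiberCoord v₀.1 x y) ∈ W → y ∈ Φ.fiberDomain x ∧
        (∀ k : ℝ, 0 < k → (extChartAt (𝓡 N) v₀.1 x, fiberCoord v₀.1 x (k • y)) ∈ W ∧
          c (extChartAt (𝓡 N) v₀.1 x, fiberCoord v₀.1 x (k • y)) =
            k ^ √(K x) • c (extChartAt (𝓡 N) v₀.1 x, fiberCoord v₀.1 x y)) ∧
        (Φ.fiberNorm x y = 1 → metricCoord S v₀.1 x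
          (c (extChartAt (𝓡 N) v₀.1 x, fiberCoord v₀.1 x y))
          (c (extChartAt (𝓡 N) v₀.1 x, fiberCoord v₀.1 x y)) = 1) ∧
        ∀ ξ η, halfHessianSq (Φ.fiberNorm x) y ξ η =
          (1 / √(K x) * Φ.fiberNorm x y ^ (1 - √(K x))) ^ 2 * metricCoord S v₀.1 x
            (fderiv ℝ (fun y => c (extChartAt (𝓡 N) v₀.1 x, y)) (fiberCoord v₀.1 x y)
              (fiberCoord v₀.1 x ξ))
            (fderiv ℝ (fun y => c (extChartAt (𝓡 N) v₀.1 x, y)) (fiberCoord v₀.1 x y)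
              (fiberCoord v₀.1 x η)) := by
  let χ := extChartAt (𝓡 N) v₀.1
  let Ψ := extChartAt (𝓡 N).tangent v₀
  let D : Set (𝔼 N × 𝔼 N) := {q | q.1 ∈ χ.target ∧
    fiberCoordSymm v₀.1 (χ.symm q.1) q.2 ∈ Φ.fiberDomain (χ.symm q.1)}
  let f : 𝔼 N × 𝔼 N → ℝ := fun q =>
    Φ.fiberNorm (χ.symm q.1) (fiberCoordSymm v₀.1 (χ.symm q.1) q.2)
  have hΨs : ∀ q : 𝔼 N × 𝔼 N, q.1 ∈ χ.target →
      Ψ.symm q = ⟨χ.symm q.1, fiberCoordSymm v₀.1 (χ.symm q.1) q.2⟩ :=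
    fun q hq => tangent_extChartAt_symm_apply v₀ hq q.2
  have hDeq : D = Ψ.target ∩ Ψ.symm ⁻¹' Φ.domain := by
    ext q
    rw [mem_inter_iff, mem_tangent_extChartAt_target, mem_preimage]
    refine and_congr_right fun hq => ?_
    rw [hΨs q hq]
    rfl
  have hD : IsOpen D := by
    rw [hDeq]
    exact (continuousOn_extChartAt_symm v₀).isOpen_inter_preimage (isOpen_extChartAt_target v₀)
      Φ.isOpen_domain
  have hf : ContDiffOn ℝ ∞ f D := by
    have h1 : ContMDiffOn 𝓘(ℝ, 𝔼 N × 𝔼 N) 𝓘(ℝ, ℝ) ∞ (fun q => Φ.F (Ψ.symm q)) D := by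
      rw [hDeq]
      exact Φ.smooth.comp ((contMDiffOn_extChartAt_symm v₀).mono inter_subset_left) fun q hq => hq.2
    refine h1.contDiffOn.congr fun q hq => ?_
    rw [hΨs q hq.1]
    rfl
  -- In the chart, each fibre differs from the true tangent space by a linear isomorphism, under
  -- which all the fibrewise hypotheses are invariant.
  have hfibD : ∀ q : 𝔼 N × 𝔼 N, ∀ hq : q ∈ D, {y | (q.1, y) ∈ D} =
      {y | (fiberEquiv (symm_mem_chart_source hq.1)).symm y ∈ Φ.fiberDomain (χ.symm q.1)} :=
    fun q hq => Set.ext fun y => ⟨fun h => h.2, fun h => ⟨hq.1, h⟩⟩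
  have hfib : ∀ q ∈ D, IsConicNorm {y | (q.1, y) ∈ D} fun y => f (q.1, y) := by
    intro q hq
    rw [hfibD q hq]
    exact (Φ.isConicNorm _).comp_equiv (fiberEquiv (symm_mem_chart_source hq.1)).symm
  have hcurv : ∀ q ∈ D, HasUnitCurvature (N - 1) {y | (q.1, y) ∈ D} (fun y => f (q.1, y))
      (K (χ.symm q.1)) := by
    intro q hq
    rw [hfibD q hq]
    exact (hK (χ.symm q.1)).comp_equiv (fiberEquiv (symm_mem_chart_source hq.1)).symm
  have hq₀ : Ψ v₀ ∈ D := by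
    rw [hDeq]
    refine ⟨mem_extChartAt_target v₀, ?_⟩
    rw [mem_preimage, extChartAt_to_inv]
    exact hv₀
  have hS : ContDiffOn ℝ ∞ (fun p => metricCoord S v₀.1 (χ.symm p)) χ.target :=
    contDiffOn_metricCoord v₀ S
  have hSs : ∀ p ∈ χ.target, ∀ x y, metricCoord S v₀.1 (χ.symm p) x y =
      metricCoord S v₀.1 (χ.symm p) y x := fun p _ x y => S.symm _ _ _
  have hSp : ∀ p ∈ χ.target, ∀ x, x ≠ 0 → 0 < metricCoord S v₀.1 (χ.symm p) x x :=
    fun p hp x hx => S.pos _ _ fun h0 => hx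
      ((fiberEquiv (symm_mem_chart_source hp)).symm.injective (h0.trans (map_zero _).symm))
  obtain ⟨W, c, hW, hqW, hWD, hcon, hc, hinj, hhom, hunit, hconf⟩ :=
    exists_conformal_family (K := fun p => K (χ.symm p)) (n := N - 1) (by omega) (by omega) hD hf
      hfib (fun q _ => hKpos _) hcurv (B := χ.target) (fun q hq => hq.1) (E := 𝔼 N) (by simp)
      (s := fun p => metricCoord S v₀.1 (χ.symm p)) hS hSs hSp (q₀ := Ψ v₀) hq₀
  refine ⟨W, c, hW, hqW, fun q hq => (hWD hq).1, hc, hinj, fun x hx y hy => ?_⟩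
  have hχ : χ.symm (χ x) = x := χ.left_inv (by rwa [extChartAt_source])
  have hfx : ∀ y, f (χ x, fiberCoord v₀.1 x y) = Φ.fiberNorm x y := by
    intro y
    simp only [f, hχ, fiberCoordSymm_fiberCoord hx]
  refine ⟨?_, fun k hk => ?_, fun h1 => ?_, fun ξ η => ?_⟩
  · have h1 := (hWD hy).2
    change fiberCoordSymm v₀.1 (χ.symm (χ x)) (fiberCoord v₀.1 x y) ∈ _ at h1
    rwa [hχ, fiberCoordSymm_fiberCoord hx] at h1
  · have h1 := hhom _ hy k hk
    simp only [← map_smul] at h1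
    change _ = k ^ √(K (χ.symm (χ x))) • _ at h1
    rw [hχ] at h1
    refine ⟨?_, h1⟩
    rw [map_smul]
    exact hcon _ hy k hk
  · have h2 := hunit _ hy ((hfx y).trans h1)
    change metricCoord S v₀.1 (χ.symm (χ x)) _ _ = 1 at h2
    rwa [hχ] at h2
  · have h1 := hconf _ hy (fiberCoord v₀.1 x ξ) (fiberCoord v₀.1 x η)
    rw [hfx] at h1
    change halfHessianSq (fun y => Φ.fiberNorm (χ.symm (χ x))
      (fiberCoordSymm v₀.1 (χ.symm (χ x)) y)) _ _ _ = (1 / √(K (χ.symm (χ x))) *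
        Φ.fiberNorm x y ^ (1 - √(K (χ.symm (χ x))))) ^ 2 *
          metricCoord S v₀.1 (χ.symm (χ x)) _ _ at h1
    rw [hχ] at h1
    refine Eq.trans ?_ h1
    have h2 := halfHessianSq_comp (Φ.fiberNorm x) (fiberEquiv hx).symm
      (fiberCoord v₀.1 x y) (fiberCoord v₀.1 x ξ) (fiberCoord v₀.1 x η)
    have h3 : ∀ w : 𝔼 N, (fiberEquiv hx).symm (fiberCoord v₀.1 x w) = w :=
      fiberCoordSymm_fiberCoord hx
    rw [h3, h3, h3] at h2
    exact h2.symm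

set_option maxHeartbeats 1000000 in
/-- Local existence of conformal automorphisms of a Finsler space whose indicatrices have constant
positive curvature. -/
theorem exists_isConformalAutomorphismOn (hN : 3 ≤ N) {Φ : FinslerSpace N M} {K : M → ℝ}
    (hKpos : ∀ x, 0 < K x) (hK : Φ.IndicatrixHasConstantCurvature K) (S : RiemMetric N M)
    (hv₀ : v₀ ∈ Φ.domain) : ∃ W C q, v₀ ∈ W ∧
      IsConformalAutomorphismOn Φ S (fun x => √(K x)) W C q := by
  obtain ⟨W, c, hW, hqW, hWt, hc, hinj, h⟩ := exists_conformal_family_extChartAt v₀ hN hKpos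
    ((Φ.hasUnitCurvature_iff K).1 hK) S hv₀
  let χ := extChartAt (𝓡 N) v₀.1
  let Ψ := extChartAt (𝓡 N).tangent v₀
  -- The coordinate map `c` conjugated by the fibre chart; the total map is then the chart
  -- expression `(p, w) ↦ (p, c(p, w))`, which gives its smoothness.
  let C : (x : M) → TangentSpace (𝓡 N) x → TangentSpace (𝓡 N) x := fun x w =>
    fiberCoordSymm v₀.1 x (c (χ x, fiberCoord v₀.1 x w))
  have hsrc : ∀ v ∈ Ψ.source, v.1 ∈ (chartAt (𝔼 N) v₀.1).source := fun v hv =>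
    (mem_tangent_extChartAt_source v₀).1 hv
  have hmem : ∀ (x : M) (y : 𝔼 N), (⟨x, y⟩ : TangentBundle (𝓡 N) M) ∈ Ψ.source ∩ Ψ ⁻¹' W ↔
      x ∈ (chartAt (𝔼 N) v₀.1).source ∧ (χ x, fiberCoord v₀.1 x y) ∈ W := by
    intro x y
    rw [mem_inter_iff, mem_tangent_extChartAt_source]
    refine and_congr_right fun hx => ?_
    rw [mem_preimage, tangent_extChartAt_apply v₀ hx]
  refine ⟨Ψ.source ∩ Ψ ⁻¹' W, C, fun v => (1 / √(K v.1) * Φ.F v ^ (1 - √(K v.1))) ^ 2,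
    ⟨mem_extChartAt_source v₀, hqW⟩, ?_, ?_, ?_, ?_, ?_, ?_, ?_, ?_, ?_⟩
  · exact (continuousOn_extChartAt v₀).isOpen_inter_preimage (isOpen_extChartAt_source v₀) hW
  · rintro ⟨x, y⟩ hv
    obtain ⟨hx, hy⟩ := (hmem x y).1 hv
    exact (h x hx y hy).1
  · rintro ⟨x, y⟩ hv k hk
    obtain ⟨hx, hy⟩ := (hmem x y).1 hv
    exact (hmem x (k • (y : 𝔼 N))).2 ⟨hx, ((h x hx y hy).2.1 k hk).1⟩
  · have h1 : ContMDiffOn (𝓡 N).tangent 𝓘(ℝ, 𝔼 N × 𝔼 N) ∞ Ψ (Ψ.source ∩ Ψ ⁻¹' W) := by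
      refine (contMDiffOn_extChartAt (x := v₀)).mono fun v hv => ?_
      rw [← extChartAt_source (𝓡 N).tangent]
      exact hv.1
    have h2 : ContDiffOn ℝ ∞ (fun q : 𝔼 N × 𝔼 N => (q.1, c q)) W :=
      contDiff_fst.contDiffOn.prodMk hc
    have h3 := (contMDiffOn_extChartAt_symm (I := (𝓡 N).tangent) (n := ∞) v₀).comp h2.contMDiffOn
      fun q hq => (mem_tangent_extChartAt_target v₀).2 (hWt q hq)
    refine (h3.comp h1 fun v hv => hv.2).congr fun v hv => ?_
    have hx := hsrc v hv.1
    change _ = Ψ.symm ((Ψ v).1, c (Ψ v))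
    have h4 : Ψ v = (χ v.1, fiberCoord v₀.1 v.1 v.2) := tangent_extChartAt_apply v₀ hx
    have h5 : χ.symm (χ v.1) = v.1 := χ.left_inv (by rwa [extChartAt_source])
    rw [h4, tangent_extChartAt_symm_apply v₀ (χ.map_source (by rwa [extChartAt_source]))]
    change _ = (⟨χ.symm (χ v.1), _⟩ : TangentBundle (𝓡 N) M)
    rw [h5]
    rfl
  · rintro ⟨x, y⟩ hv ⟨x', y'⟩ hv' heq
    obtain rfl : x = x' := congrArg TotalSpace.proj heq
    have h1 : C x y = C x y' := eq_of_heq (TotalSpace.mk.inj heq).2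
    obtain ⟨hx, hy⟩ := (hmem x y).1 hv
    have h2 : y = y' := (fiberEquiv hx).injective
      (hinj _ _ _ hy ((hmem x y').1 hv').2 ((fiberEquiv hx).symm.injective h1))
    rw [h2]
  · rintro ⟨x, y⟩ hv k hk
    obtain ⟨hx, hy⟩ := (hmem x y).1 hv
    refine (congrArg (fiberCoordSymm v₀.1 x) ((h x hx y hy).2.1 k hk).2).trans ?_
    exact map_smul _ _ _
  · rintro ⟨x, y⟩ hv h1
    obtain ⟨hx, hy⟩ := (hmem x y).1 hv
    exact (h x hx y hy).2.2.1 h1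
  · rintro ⟨x, y⟩ hv
    obtain ⟨hx, hy⟩ := (hmem x y).1 hv
    have hFv : 0 < Φ.F ⟨x, y⟩ := Φ.pos _ (h x hx y hy).1
    have := Real.sqrt_pos.2 (hKpos x)
    have := Real.rpow_pos_of_pos hFv (1 - √(K x))
    positivity
  · rintro ⟨x, y⟩ hv ξ η
    obtain ⟨hx, hy⟩ := (hmem x y).1 hv
    have hcd : HasFDerivAt (fun y => c (χ x, y))
        (fderiv ℝ (fun y => c (χ x, y)) (fiberCoord v₀.1 x y)) (fiberCoord v₀.1 x y) :=
      (((contDiffOn_snd_of_contDiffOn hc _).contDiffAt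
        ((isOpen_fiber hW _).mem_nhds hy)).differentiableAt (by simp)).hasFDerivAt
    have h5 : tangentDeriv C ⟨x, y⟩ = (fiberCoordSymm v₀.1 x).comp
        ((fderiv ℝ (fun y => c (χ x, y)) (fiberCoord v₀.1 x y)).comp (fiberCoord v₀.1 x)) :=
      fderiv_comp_linear (fiberCoordSymm v₀.1 x) (fiberCoord v₀.1 x) hcd
    rw [h5]
    exact (h x hx y hy).2.2.2 ξ η

end Coordinates

/-! ### Existence of Riemannian metrics -/

section Metric

variable {N : ℕ} {M : Type*} [TopologicalSpace M] [ChartedSpace (EuclideanSpace ℝ (Fin N)) M]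
  [IsManifold (𝓡 N) ∞ M]

local notation:max "𝔼" n:max => EuclideanSpace ℝ (Fin n)

/-- The minimum `m` of the form on the compact unit sphere gives `m ‖v‖² ≤ b v v`. Boundedness of
the unit ball is one of the fields of a Riemannian metric. -/
theorem isVonNBounded_of_posDef {E : Type*} [NormedAddCommGroup E] [NormedSpace ℝ E]
    [FiniteDimensional ℝ E] (b : E →L[ℝ] E →L[ℝ] ℝ) (hb : ∀ v, v ≠ 0 → 0 < b v v) :
    Bornology.IsVonNBounded ℝ {v | b v v < 1} := by
  have hc : Continuous fun v => b v v := by fun_prop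
  obtain ⟨m, hm, hmb⟩ : ∃ m, 0 < m ∧ ∀ v, m * ‖v‖ ^ 2 ≤ b v v := by
    rcases subsingleton_or_nontrivial E with hE | hE
    · exact ⟨1, one_pos, fun v => by simp [Subsingleton.elim v 0]⟩
    · obtain ⟨v₀, hv₀, hmin⟩ := (isCompact_sphere (0 : E) 1).exists_isMinOn
        (NormedSpace.sphere_nonempty.2 zero_le_one) hc.continuousOn
      have hv₀1 : ‖v₀‖ = 1 := by simpa using hv₀
      refine ⟨b v₀ v₀, hb v₀ (by rintro rfl; simp at hv₀1), fun v => ?_⟩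
      rcases eq_or_ne v 0 with rfl | hv
      · simp
      · have hn : ‖v‖ ≠ 0 := norm_ne_zero_iff.2 hv
        have h1 : b v₀ v₀ ≤ b (‖v‖⁻¹ • v) (‖v‖⁻¹ • v) :=
          hmin (by simp [norm_smul, inv_mul_cancel₀ hn])
        simp only [map_smul, FunLike.coe_smul, Pi.smul_apply, smul_eq_mul] at h1
        calc b v₀ v₀ * ‖v‖ ^ 2 ≤ ‖v‖⁻¹ * (‖v‖⁻¹ * b v v) * ‖v‖ ^ 2 := by gcongr
          _ = b v v := by field_simp
  rw [NormedSpace.isVonNBounded_iff, isBounded_iff_forall_norm_le]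
  refine ⟨√(1 / m), fun v hv => Real.le_sqrt_of_sq_le ?_⟩
  rw [le_div_iff₀ hm, mul_comm]
  exact (hmb v).trans (le_of_lt hv)

variable (N) in
/-- The standard inner product. -/
def dotForm : 𝔼 N →L[ℝ] 𝔼 N →L[ℝ] ℝ :=
  ∑ i, (EuclideanSpace.proj i : 𝔼 N →L[ℝ] ℝ).smulRight (EuclideanSpace.proj i : 𝔼 N →L[ℝ] ℝ)

omit [IsManifold (𝓡 N) ∞ M] [ChartedSpace (EuclideanSpace ℝ (Fin N)) M] [TopologicalSpace M] in
theorem dotForm_apply (v w : 𝔼 N) : dotForm N v w = ∑ i, v i * w i := by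
  simp [dotForm]

/-- The Euclidean metric of the bundle chart at `x₀`. -/
def chartMetric (x₀ x : M) : TangentSpace (𝓡 N) x →L[ℝ] TangentSpace (𝓡 N) x →L[ℝ] ℝ :=
  ((dotForm N).bilinearComp (fiberCoord x₀ x) (fiberCoord x₀ x) : 𝔼 N →L[ℝ] 𝔼 N →L[ℝ] ℝ)

theorem chartMetric_symm (x₀ x : M) (v w : TangentSpace (𝓡 N) x) :
    chartMetric x₀ x v w = chartMetric x₀ x w v := by
  change dotForm N (fiberCoord x₀ x v) (fiberCoord x₀ x w) =
    dotForm N (fiberCoord x₀ x w) (fiberCoord x₀ x v)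
  simp only [dotForm_apply, mul_comm]

theorem chartMetric_pos {x₀ x : M} (hx : x ∈ (chartAt (𝔼 N) x₀).source)
    (v : TangentSpace (𝓡 N) x) (hv : v ≠ 0) : 0 < chartMetric x₀ x v v := by
  change 0 < dotForm N (fiberCoord x₀ x v) (fiberCoord x₀ x v)
  rw [dotForm_apply]
  have h1 : fiberCoord x₀ x v ≠ 0 := fun h0 =>
    hv ((fiberEquiv hx).injective (h0.trans (map_zero _).symm))
  obtain ⟨i, hi⟩ : ∃ i, fiberCoord x₀ x v i ≠ 0 := by
    by_contra! hall
    exact h1 (PiLp.ext hall)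
  exact Finset.sum_pos' (fun i _ => mul_self_nonneg _) ⟨i, Finset.mem_univ i, mul_self_pos.2 hi⟩

-- In the trivialization at `x₀` this section is the constant `dotForm N`.
set_option synthInstance.maxHeartbeats 400000 in
theorem contMDiffOn_chartMetric (x₀ : M) :
    ContMDiffOn (𝓡 N) ((𝓡 N).prod 𝓘(ℝ, 𝔼 N →L[ℝ] 𝔼 N →L[ℝ] ℝ)) ∞
      (fun x => TotalSpace.mk' (𝔼 N →L[ℝ] 𝔼 N →L[ℝ] ℝ)
        (E := fun x : M => TangentSpace (𝓡 N) x →L[ℝ] TangentSpace (𝓡 N) x →L[ℝ] ℝ) x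
        (chartMetric x₀ x)) (chartAt (𝔼 N) x₀).source := by
  have hb : (chartAt (𝔼 N) x₀).source ⊆ (trivializationAt (𝔼 N →L[ℝ] 𝔼 N →L[ℝ] ℝ)
      (fun x : M => TangentSpace (𝓡 N) x →L[ℝ] TangentSpace (𝓡 N) x →L[ℝ] ℝ) x₀).baseSet := by
    intro x hx
    simpa [hom_trivializationAt_baseSet] using hx
  intro x hx
  refine (((trivializationAt (𝔼 N →L[ℝ] 𝔼 N →L[ℝ] ℝ)
      (fun x : M => TangentSpace (𝓡 N) x →L[ℝ] TangentSpace (𝓡 N) x →L[ℝ] ℝ)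
        x₀).contMDiffOn_section_iff (chartAt (𝔼 N) x₀).open_source hb).2 ?_) x hx
  refine (contMDiffOn_const (c := dotForm N)).congr fun z hz => ?_
  rw [hom_trivializationAt_apply]
  ext v w
  rw [inCoordinates_apply_eq₂ hz hz (mem_univ _)]
  have h1 : ∀ v : 𝔼 N, fiberCoord x₀ z
      ((trivializationAt (𝔼 N) (TangentSpace (𝓡 N)) x₀).symm z v) = v := by
    intro v
    rw [← Trivialization.symmL_apply (R := ℝ) _ hz]
    exact fiberCoord_fiberCoordSymm hz v
  have h2 : ∀ r : ℝ, (trivializationAt ℝ (fun _ : M => ℝ) x₀).linearMapAt ℝ z r = r := by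
    intro r
    simp
  refine (h2 _).trans ?_
  change dotForm N (fiberCoord x₀ z _) (fiberCoord x₀ z _) = dotForm N v w
  rw [h1, h1]

-- Symmetric positive definite forms are a convex set, so a partition of unity glues the Euclidean
-- metrics of the bundle charts.
set_option synthInstance.maxHeartbeats 400000 in
set_option maxHeartbeats 2000000 in
theorem nonempty_riemMetric [T2Space M] [SigmaCompactSpace M] : Nonempty (RiemMetric N M) := by
  let t : ∀ x : M, Set (TangentSpace (𝓡 N) x →L[ℝ] TangentSpace (𝓡 N) x →L[ℝ] ℝ) := fun x =>
    {b | (∀ v w, b v w = b w v) ∧ ∀ v, v ≠ 0 → 0 < b v v}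
  have hconv : ∀ x, Convex ℝ (t x) := by
    rintro x b ⟨hb, hbp⟩ b' ⟨hb', hbp'⟩ a a' ha ha' haa
    refine ⟨fun v w => ?_, fun v hv => ?_⟩
    · change a * b v w + a' * b' v w = a * b w v + a' * b' w v
      rw [hb, hb']
    · change 0 < a * b v v + a' * b' v v
      rcases ha.eq_or_lt with rfl | ha
      · have : a' = 1 := by linarith
        subst this
        have := hbp' v hv
        linarith
      · have := mul_pos ha (hbp v hv)
        have := mul_nonneg ha' (hbp' v hv).le
        linarith
  obtain ⟨s, hs⟩ := exists_contMDiffSection_forall_mem_convex_of_local (𝓡 N) (n := ⊤)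
    (F_fiber := 𝔼 N →L[ℝ] 𝔼 N →L[ℝ] ℝ)
    (V := fun x : M => TangentSpace (𝓡 N) x →L[ℝ] TangentSpace (𝓡 N) x →L[ℝ] ℝ) t hconv
    fun x₀ => ⟨(chartAt (𝔼 N) x₀).source, (chartAt (𝔼 N) x₀).open_source.mem_nhds
      (mem_chart_source _ _), chartMetric x₀, contMDiffOn_chartMetric x₀,
      fun x hx => ⟨chartMetric_symm x₀ x, chartMetric_pos hx⟩⟩
  exact ⟨⟨fun x => s x, fun x => (hs x).1, fun x => (hs x).2,
    fun x => isVonNBounded_of_posDef (E := 𝔼 N) (s x) (hs x).2, s.contMDiff⟩⟩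

end Metric

end FinslerConformal

end

/-! ### The main theorem -/

theorem proposition2p1 {N : ℕ} (hN : 3 ≤ N) {M : Type*} [TopologicalSpace M]
    [T2Space M] [SigmaCompactSpace M] [ChartedSpace (EuclideanSpace ℝ (Fin N)) M]
    [IsManifold (𝓡 N) ∞ M] (Φ : FinslerConformal.FinslerSpace N M) :
    ((∃ (S : FinslerConformal.RiemMetric N M) (H : M → ℝ),
        FinslerConformal.IsConformallyAutomorphic Φ S H) ↔
      ∃ K : M → ℝ, (∀ x, 0 < K x) ∧ Φ.IndicatrixHasConstantCurvature K) ∧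
    (∀ (S : FinslerConformal.RiemMetric N M) (H : M → ℝ),
      FinslerConformal.IsConformallyAutomorphic Φ S H →
        Φ.IndicatrixHasConstantCurvature (fun x => H x ^ 2) ∧
        (∀ K : M → ℝ, Φ.IndicatrixHasConstantCurvature K → ∀ x, K x = H x ^ 2) ∧
        ∀ W C q, FinslerConformal.IsConformalAutomorphismOn Φ S H W C q →
          ∀ v ∈ W, q v = (1 / H v.1 * Φ.F v ^ (1 - H v.1)) ^ 2) := by
  refine ⟨⟨?_, ?_⟩, fun S H h => ⟨h.hasConstantCurvature (by omega), fun K hK x => ?_,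
    fun W C q hC v hv => hC.multiplier_eq h.1 hv⟩⟩
  · rintro ⟨S, H, h⟩
    exact ⟨fun x => H x ^ 2, fun x => pow_pos (h.1 x) 2, h.hasConstantCurvature (by omega)⟩
  · rintro ⟨K, hKpos, hK⟩
    -- Any Riemannian metric works, because all inner products on a tangent space are linearly
    -- isometric; only the degree `√K` is forced.
    obtain ⟨S⟩ := FinslerConformal.nonempty_riemMetric (N := N) (M := M)
    exact ⟨S, fun x => √(K x), fun x => Real.sqrt_pos.2 (hKpos x), fun v hv =>
      FinslerConformal.exists_isConformalAutomorphismOn v hN hKpos hK S hv⟩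
  · exact FinslerConformal.HasUnitCurvature.unique (Φ.isConicNorm x) (n := N - 1) (by omega)
      (by omega) (Φ.fiber_nonempty x) ((Φ.hasUnitCurvature_iff K).1 hK x)
      ((Φ.hasUnitCurvature_iff _).1 (h.hasConstantCurvature (by omega)) x)
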